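/- Let $G$ be a simply connected (in particular connected) finite-dimensional real Lie group with Lie algebra $\mathfrak g$ (left-invariant vector fields), and let $\lambda\in\wedge^2\mathfrak g^*$ be a Lie algebra 2-cocycle, i.e. $\lambda(u,[v,w])+\lambda(v,[w,u])+\lambda(w,[u,v])=0$ for all $u,v,w\in\mathfrak g$. Write $\langle \mathrm{Ad}^*_{g^{-1}}\xi,v\rangle=\langle\xi,\mathrm{Ad}_{g^{-1}}v\rangle$. (1) There is a unique smooth map $\chi:G\to\mathfrak g^*$ with $\chi(gh)=\mathrm{Ad}^*_{g^{-1}}\chi(h)+\chi(g)$ for all $g,h\in G$ and $\langle d_e\chi(u),v\rangle=\lambda(u,v)$ for all $u,v\in\mathfrak g$. The associated affine coadjoint action of $G$ on $\mathfrak g^*$ is $g\cdot\xi=\mathrm{Ad}^*_{g^{-1}}\xi-\chi(g)$; let $\Gamma=G\times\mathfrak g^*\rightrightarrows\mathfrak g^*$ be its action groupoid, with $\mathbf s(g,\xi)=\xi$, $\mathbf t(g,\xi)=g\cdot\xi$ and $\mathbf m((g,\xi),(h,\eta))=(gh,\eta)$ if $\xi=h\cdot\eta$. (2) Let $\theta_L$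 be the Liouville 1-form on $p_G:T^*G\to G$, $\omega_{\rm can}=-d\theta_L$, $\lambda^L$ the left-invariant 2-form on $G$ with value $\lambda$ at $e$, and $\varphi:G\times\mathfrak g^*\to T^*G$, $\varphi(g,\xi)=\xi\circ (L_{g^{-1}})_*$. Let $\omega_\Gamma=-\varphi^*(\omega_{\rm can}+p_G^*\lambda^L)\in\Omega^2(\Gamma)$ be the canonical 2-form with magnetic term. In the left trivialization $T_{(g,\eta)}\Gamma\cong\mathfrak g\times\mathfrak g^*$ it is given by $$\omega_\Gamma\big((v_1,\xi_1),(v_2,\xi_2)\big)_{(g,\eta)}=\langle\xi_1,v_2\rangle-\langle\xi_2,v_1\rangle-\langle\eta,[v_1,v_2]\rangle-\lambda(v_1,v_2).$$ (3) $(\Gamma,\omega_\Gamma)$ is a symplectic groupoid: $\Gamma$ is a Lie groupoid, $\omega_\Gamma$ is a symplectic form, and $\mathrm{pr}_1^*\omega_\Gamma+\mathrm{pr}_2^*\omega_\Gamma-\mathbf m^*\omega_\Gamma=0$ on the manifold of composable pairs of arrows. (4) It integrates the affine Poisson structure $\pi_\lambda$ on $\mathfrak g^*$, i.e. the one with $\{l_v,l_w\}=l_{[v,w]}+\lambda(v,w)$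 for the linear functions $l_v(\xi)=\langle\xi,v\rangle$, $v,w\in\mathfrak g$: $\pi_\lambda$ is a Poisson structure, and $\mathbf t:(\Gamma,\omega_\Gamma)\to(\mathfrak g^*,\pi_\lambda)$ is a symplectic realization (a surjective submersion and a Poisson map), where the Poisson bracket of $\omega_\Gamma$ is $\{f,g\}=dg(X_f)$ with $\omega_\Gamma(X_f,\cdot)=df$. -/

import Mathlib

open scoped Manifold ContDiff

noncomputable section

namespace AffineCoadjoint

/-! ### Differential forms on manifolds -/

section Forms

variable {EM : Type*} [NormedAddCommGroup EM] [NormedSpace ℝ EM]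
  {HM : Type*} [TopologicalSpace HM] (I : ModelWithCorners ℝ EM HM)
  (M : Type*) [TopologicalSpace M] [ChartedSpace HM M]
  {EN : Type*} [NormedAddCommGroup EN] [NormedSpace ℝ EN]
  {HN : Type*} [TopologicalSpace HN] (J : ModelWithCorners ℝ EN HN)
  {N : Type*} [TopologicalSpace N] [ChartedSpace HN N]

/-- A (not necessarily smooth) differential `k`-form on `M`: an alternating `k`-linear form on every
tangent space. -/
abbrev DiffForm (k : ℕ) : Type _ := ∀ x : M, TangentSpace I x [⋀^Fin k]→L[ℝ] ℝ

variable {M} {k : ℕ}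

/-- The expression of a `k`-form in the preferred chart at `x₀`: its pullback along the inverse of
this chart, a `k`-form on the model vector space (meaningful on the target of the chart). -/
def inChart (σ : DiffForm I M k) (x₀ : M) (y : EM) : EM [⋀^Fin k]→L[ℝ] ℝ :=
  (σ ((extChartAt I x₀).symm y)).compContinuousLinearMap
    (mfderivWithin 𝓘(ℝ, EM) I (extChartAt I x₀).symm (Set.range I) y)

/-- A form is smooth if its expression in every preferred chart is smooth. -/
def IsSmoothForm (σ : DiffForm I M k) : Prop :=
  ∀ x₀ : M, ContDiffOn ℝ ∞ (inChart I σ x₀) (extChartAt I x₀).target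

/-- The exterior derivative of a form. At the point `x` it is the exterior derivative of the
expression of the form in the chart at `x`, pulled back along this chart. -/
def extDer (σ : DiffForm I M k) : DiffForm I M (k + 1) := fun x ↦
  (extDerivWithin (inChart I σ x) (Set.range I) (extChartAt I x x)).compContinuousLinearMap
    (mfderiv I 𝓘(ℝ, EM) (extChartAt I x) x)

/-- The pullback `f^* σ` of a form on `N` along a map `f : M → N`. -/
def pullback (f : M → N) (σ : DiffForm J N k) : DiffForm I M k := fun x ↦
  (σ (f x)).compContinuousLinearMap (mfderiv I J f x)

/-- Symplectic forms: smooth, closed, nondegenerate 2-forms. -/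
structure IsSymplecticForm (σ : DiffForm I M 2) : Prop where
  smooth : IsSmoothForm I σ
  closed : extDer I σ = 0
  nondegenerate : ∀ (x : M) (v : TangentSpace I x),
    (∀ w : TangentSpace I x, σ x ![v, w] = 0) → v = 0

/-- Submersions of finite-dimensional manifolds: smooth maps all of whose differentials are
surjective. -/
structure IsSmoothSubmersion (f : M → N) : Prop where
  smooth : ContMDiff I J ∞ f
  surjective_mfderiv : ∀ x : M, Function.Surjective (mfderiv I J f x)

/-! ### Poisson structures -/

variable (M) in
/-- A field of functions of pairs of covectors; it is a bivector field if it is bilinear,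
skew-symmetric and smooth, which is part of `IsPoissonStructure`. -/
abbrev CovectorPairing : Type _ :=
  ∀ x : M, (TangentSpace I x →L[ℝ] ℝ) → (TangentSpace I x →L[ℝ] ℝ) → ℝ

/-- The differential of a real function, as a covector. -/
def differential (f : M → ℝ) (x : M) : TangentSpace I x →L[ℝ] ℝ :=
  mfderiv I 𝓘(ℝ, ℝ) f x

/-- The bracket `{f, g} = π(df, dg)`. -/
def bracket (π : CovectorPairing I M) (f g : M → ℝ) (x : M) : ℝ :=
  π x (differential I f x) (differential I g x)

/-- `π` is a Poisson structure: a smooth bivector field whose bracket satisfies the Jacobi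
identity. -/
structure IsPoissonStructure (π : CovectorPairing I M) : Prop where
  add_left : ∀ x α α' β, π x (α + α') β = π x α β + π x α' β
  smul_left : ∀ x (c : ℝ) α β, π x (c • α) β = c * π x α β
  skew : ∀ x α β, π x α β = - π x β α
  smooth : ∀ f g : M → ℝ, ContMDiff I 𝓘(ℝ, ℝ) ∞ f → ContMDiff I 𝓘(ℝ, ℝ) ∞ g →
    ContMDiff I 𝓘(ℝ, ℝ) ∞ (bracket I π f g)
  jacobi : ∀ f g h : M → ℝ, ContMDiff I 𝓘(ℝ, ℝ) ∞ f → ContMDiff I 𝓘(ℝ, ℝ) ∞ g →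
    ContMDiff I 𝓘(ℝ, ℝ) ∞ h → ∀ x,
      bracket I π f (bracket I π g h) x + bracket I π g (bracket I π h f) x
        + bracket I π h (bracket I π f g) x = 0

/-- The vector `X` with `σ(X, ·) = α` (for a nondegenerate form on a finite-dimensional tangent
space, it exists and is unique). -/
def sharp (σ : DiffForm I M 2) (x : M) (α : TangentSpace I x →L[ℝ] ℝ) : TangentSpace I x :=
  Classical.epsilon fun X : TangentSpace I x ↦ ∀ Y : TangentSpace I x, σ x ![X, Y] = α Y

/-- The Poisson structure of a symplectic form `σ`: writing `X_α` for the vector with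
`σ(X_α, ·) = α`, it is `π(α, β) = β(X_α) = - σ(X_α, X_β)`. -/
def symplecticPoisson (σ : DiffForm I M 2) : CovectorPairing I M := fun x α β ↦
  β (sharp I σ x α)

/-- A symplectic realization `f : (M, σ) → (N, π)`: a surjective submersion from a symplectic
manifold which is a Poisson map. -/
structure IsSymplecticRealization (σ : DiffForm I M 2) (π : CovectorPairing J N) (f : M → N) :
    Prop where
  symplectic : IsSymplecticForm I σ
  submersion : IsSmoothSubmersion I J f
  surjective : Function.Surjective f
  poisson : ∀ (x : M) (α β : TangentSpace J (f x) →L[ℝ] ℝ),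
    symplecticPoisson I σ x (α.comp (mfderiv I J f x)) (β.comp (mfderiv I J f x)) = π (f x) α β

end Forms

/-! ### Lie groupoids and symplectic groupoids -/

/-- A groupoid with set of arrows `Γ` and set of objects `M`. The product `mul g h` is defined
if the source of `g` is the target of `h`. -/
structure GroupoidOn (Γ M : Type*) where
  src : Γ → M
  tgt : Γ → M
  unit : M → Γ
  inv : Γ → Γ
  mul : ∀ g h : Γ, src g = tgt h → Γ
  src_mul : ∀ g h e, src (mul g h e) = src h
  tgt_mul : ∀ g h e, tgt (mul g h e) = tgt g
  mul_assoc : ∀ g h k (e : src g = tgt h) (e' : src h = tgt k),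
    mul (mul g h e) k ((src_mul g h e).trans e') = mul g (mul h k e') (e.trans (tgt_mul h k e').symm)
  src_unit : ∀ x, src (unit x) = x
  tgt_unit : ∀ x, tgt (unit x) = x
  unit_mul : ∀ g, mul (unit (tgt g)) g (src_unit _) = g
  mul_unit : ∀ g, mul g (unit (src g)) (tgt_unit _).symm = g
  src_inv : ∀ g, src (inv g) = tgt g
  tgt_inv : ∀ g, tgt (inv g) = src g
  inv_mul : ∀ g, mul (inv g) g (src_inv g) = unit (src g)
  mul_inv : ∀ g, mul g (inv g) (tgt_inv g).symm = unit (tgt g)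

/-- The action groupoid of a left action: `s(g, x) = x`, `t(g, x) = g • x`, `(g, x)(h, y) = (gh, y)`
if `x = h • y`. -/
def actionGroupoid {G X : Type*} [Group G] (act : MulAction G X) : GroupoidOn (G × X) X where
  src p := p.2
  tgt p := p.1 • p.2
  unit x := (1, x)
  inv p := (p.1⁻¹, p.1 • p.2)
  mul p q _ := (p.1 * q.1, q.2)
  src_mul _ _ _ := rfl
  tgt_mul p q e := by
    change (p.1 * q.1) • q.2 = p.1 • p.2
    rw [mul_smul, e]
  mul_assoc p q r _ _ := by simp only [_root_.mul_assoc]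
  src_unit _ := rfl
  tgt_unit x := one_smul G x
  unit_mul p := by simp
  mul_unit p := by simp
  src_inv _ := rfl
  tgt_inv p := inv_smul_smul p.1 p.2
  inv_mul p := by simp
  mul_inv p := by simp

section LieGroupoids

variable {EΓ : Type*} [NormedAddCommGroup EΓ] [NormedSpace ℝ EΓ]
  {HΓ : Type*} [TopologicalSpace HΓ] (I : ModelWithCorners ℝ EΓ HΓ)
  {Γ : Type*} [TopologicalSpace Γ] [ChartedSpace HΓ Γ]
  {EM : Type*} [NormedAddCommGroup EM] [NormedSpace ℝ EM]
  {HM : Type*} [TopologicalSpace HM] (J : ModelWithCorners ℝ EM HM)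
  {M : Type*}
  {EP : Type*} [NormedAddCommGroup EP] [NormedSpace ℝ EP]
  {HP : Type*} [TopologicalSpace HP] (K : ModelWithCorners ℝ EP HP)
  {P : Type*} [TopologicalSpace P] [ChartedSpace HP P]

/-- The manifold `P`, with the maps `pr₁, pr₂ : P → Γ`, is the manifold of composable pairs of
arrows: `(pr₁, pr₂)` identifies `P` with the embedded submanifold `{(g, h) | s(g) = t(h)}` of
`Γ × Γ`, i.e. it is a smooth immersion, a topological embedding, and has this image. (The manifold
structure of an embedded submanifold is unique.) -/
structure IsComposablePairs (𝒢 : GroupoidOn Γ M) (pr₁ pr₂ : P → Γ) : Prop where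
  smooth_fst : ContMDiff K I ∞ pr₁
  smooth_snd : ContMDiff K I ∞ pr₂
  immersion : ∀ (c : P) (v : TangentSpace K c),
    mfderiv K I pr₁ c v = 0 → mfderiv K I pr₂ c v = 0 → v = 0
  embedding : Topology.IsEmbedding fun c ↦ (pr₁ c, pr₂ c)
  range_eq : Set.range (fun c ↦ (pr₁ c, pr₂ c)) = {p : Γ × Γ | 𝒢.src p.1 = 𝒢.tgt p.2}

variable {I K} in
theorem IsComposablePairs.src_eq_tgt {𝒢 : GroupoidOn Γ M} {pr₁ pr₂ : P → Γ}
    (h : IsComposablePairs I K 𝒢 pr₁ pr₂) (c : P) : 𝒢.src (pr₁ c) = 𝒢.tgt (pr₂ c) := by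
  have hc : (pr₁ c, pr₂ c) ∈ Set.range (fun c ↦ (pr₁ c, pr₂ c)) := ⟨c, rfl⟩
  rw [h.range_eq] at hc
  exact hc

variable {I K} in
/-- The multiplication as a map from the manifold of composable pairs to the manifold of arrows. -/
def IsComposablePairs.mulMap {𝒢 : GroupoidOn Γ M} {pr₁ pr₂ : P → Γ}
    (h : IsComposablePairs I K 𝒢 pr₁ pr₂) (c : P) : Γ :=
  𝒢.mul (pr₁ c) (pr₂ c) (h.src_eq_tgt c)

variable [TopologicalSpace M] [ChartedSpace HM M]

/-- Lie groupoids (`P`, `pr₁`, `pr₂` being the manifold of composable pairs): all structure maps are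
smooth, source and target are submersions. -/
structure IsLieGroupoid (𝒢 : GroupoidOn Γ M) (pr₁ pr₂ : P → Γ) : Prop where
  isManifold_arrows : IsManifold I ∞ Γ
  isManifold_objects : IsManifold J ∞ M
  isManifold_pairs : IsManifold K ∞ P
  pairs : IsComposablePairs I K 𝒢 pr₁ pr₂
  submersion_src : IsSmoothSubmersion I J 𝒢.src
  submersion_tgt : IsSmoothSubmersion I J 𝒢.tgt
  smooth_unit : ContMDiff J I ∞ 𝒢.unit
  smooth_inv : ContMDiff I I ∞ 𝒢.inv
  smooth_mul : ContMDiff K I ∞ pairs.mulMap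

/-- Symplectic groupoids: Lie groupoids with a multiplicative symplectic form on the manifold of
arrows. -/
structure IsSymplecticGroupoid (𝒢 : GroupoidOn Γ M) (pr₁ pr₂ : P → Γ) (σ : DiffForm I Γ 2) :
    Prop extends IsLieGroupoid I J K 𝒢 pr₁ pr₂ where
  symplectic : IsSymplecticForm I σ
  multiplicative :
    pullback K I pr₁ σ + pullback K I pr₂ σ - pullback K I pairs.mulMap σ = 0

/-- The groupoid `𝒢` with the symplectic form `σ` integrates the Poisson structure `π` on the
manifold of objects: `π` is the Poisson structure for which the target map is a symplectic
realization. -/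
structure IntegratesPoisson (𝒢 : GroupoidOn Γ M) (σ : DiffForm I Γ 2) (π : CovectorPairing J M) :
    Prop where
  poisson : IsPoissonStructure J π
  realization : IsSymplecticRealization I J σ π 𝒢.tgt

end LieGroupoids

/-! ### The coadjoint action, 2-cocycles, and the affine Poisson structure

The Lie algebra `𝔤` of a Lie group `G` modelled on `E` is `GroupLieAlgebra 𝓘(ℝ, E) G`, the tangent
space at `1`. Its underlying topological vector space is `E`, so that `𝔤^*` is `StrongDual ℝ E`. -/

section LieGroups

variable {E : Type*} [NormedAddCommGroup E] [NormedSpace ℝ E]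
  {G : Type*} [TopologicalSpace G] [ChartedSpace E G] [Group G]

/-- The adjoint representation: `Ad g` is the differential at `1` of `x ↦ g x g⁻¹`. -/
def Ad (g : G) : GroupLieAlgebra 𝓘(ℝ, E) G →L[ℝ] GroupLieAlgebra 𝓘(ℝ, E) G :=
  mfderiv 𝓘(ℝ, E) 𝓘(ℝ, E) (fun x : G ↦ g * x * g⁻¹) 1

/-- The coadjoint representation: `⟨coAd g ξ, v⟩ = ⟨ξ, Ad (g⁻¹) v⟩`. -/
def coAd (g : G) (ξ : StrongDual ℝ E) : StrongDual ℝ E :=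
  ξ.comp (Ad (E := E) g⁻¹ : E →L[ℝ] E)

/-- The identity `λ(u, [v, w]) + λ(v, [w, u]) + λ(w, [u, v]) = 0` for Lie algebra 2-cocycles. -/
def IsLieTwoCocycle (lam : GroupLieAlgebra 𝓘(ℝ, E) G [⋀^Fin 2]→L[ℝ] ℝ) : Prop :=
  ∀ u v w : GroupLieAlgebra 𝓘(ℝ, E) G,
    lam ![u, ⁅v, w⁆] + lam ![v, ⁅w, u⁆] + lam ![w, ⁅u, v⁆] = 0

variable (E G) in
/-- Smooth group 1-cocycles with values in the coadjoint representation. -/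
structure CoadjointCocycle where
  toFun : G → StrongDual ℝ E
  smooth : ContMDiff 𝓘(ℝ, E) 𝓘(ℝ, StrongDual ℝ E) ∞ toFun
  map_mul : ∀ g h : G, toFun (g * h) = coAd g (toFun h) + toFun g

/-- The group cocycle `χ` integrates `λ♭ : 𝔤 → 𝔤^*`, `⟨λ♭(u), v⟩ = λ(u, v)`: its differential at `1`
is `λ♭`. -/
def CoadjointCocycle.Integrates (χ : CoadjointCocycle E G)
    (lam : GroupLieAlgebra 𝓘(ℝ, E) G [⋀^Fin 2]→L[ℝ] ℝ) : Prop :=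
  ∀ u v : GroupLieAlgebra 𝓘(ℝ, E) G,
    (show StrongDual ℝ E from mfderiv 𝓘(ℝ, E) 𝓘(ℝ, StrongDual ℝ E) χ.toFun 1 u) v = lam ![u, v]

theorem Ad_one : Ad (1 : G) = ContinuousLinearMap.id ℝ (GroupLieAlgebra 𝓘(ℝ, E) G) := by
  have h : (fun x : G ↦ 1 * x * 1⁻¹) = id := by ext x; simp
  unfold Ad
  rw [h]
  exact mfderiv_id

theorem Ad_mul [LieGroup 𝓘(ℝ, E) ∞ G] (g h : G) :
    Ad (E := E) (g * h) = (Ad (E := E) g).comp (Ad (E := E) h) := by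
  have hs : ∀ a : G, ContMDiff 𝓘(ℝ, E) 𝓘(ℝ, E) ∞ (fun x : G ↦ a * x * a⁻¹) := fun a ↦
    (contMDiff_const.mul contMDiff_id).mul contMDiff_const
  have hd : ∀ a x : G, MDifferentiableAt 𝓘(ℝ, E) 𝓘(ℝ, E) (fun x : G ↦ a * x * a⁻¹) x := fun a x ↦
    (hs a).mdifferentiable (by simp) x
  have hc : (fun x : G ↦ g * h * x * (g * h)⁻¹) =
      (fun x : G ↦ g * x * g⁻¹) ∘ (fun x : G ↦ h * x * h⁻¹) := by
    ext x
    simp [mul_assoc]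
  have h1 : h * 1 * h⁻¹ = 1 := by simp
  have key := mfderiv_comp (1 : G) (hd g (h * 1 * h⁻¹)) (hd h 1)
  unfold Ad
  rw [hc, key, h1]
  rfl

theorem coAd_one (ξ : StrongDual ℝ E) : coAd (1 : G) ξ = ξ := by
  ext v
  have h : Ad (E := E) (1 : G)⁻¹ v = v := by
    rw [inv_one, Ad_one]
    rfl
  exact congrArg ξ h

theorem coAd_mul [LieGroup 𝓘(ℝ, E) ∞ G] (g h : G) (ξ : StrongDual ℝ E) :
    coAd (g * h) ξ = coAd g (coAd h ξ) := by
  ext v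
  have h' : Ad (E := E) (g * h)⁻¹ v = Ad (E := E) h⁻¹ (Ad (E := E) g⁻¹ v) := by
    rw [mul_inv_rev, Ad_mul]
    rfl
  exact congrArg ξ h'

/-- The affine coadjoint action `g • ξ = Ad^*_{g⁻¹} ξ - χ(g)` associated with a group 1-cocycle. -/
@[reducible]
def affineAction [LieGroup 𝓘(ℝ, E) ∞ G] (χ : CoadjointCocycle E G) :
    MulAction G (StrongDual ℝ E) where
  smul g ξ := coAd g ξ - χ.toFun g
  one_smul ξ := by
    change coAd (1 : G) ξ - χ.toFun 1 = ξ
    have h := χ.map_mul 1 1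
    rw [coAd_one, mul_one] at h
    have h0 : χ.toFun 1 = 0 := left_eq_add.mp h
    rw [coAd_one, h0, sub_zero]
  mul_smul g h ξ := by
    change coAd (g * h) ξ - χ.toFun (g * h) = coAd g (coAd h ξ - χ.toFun h) - χ.toFun g
    have hsub : coAd g (coAd h ξ - χ.toFun h) = coAd g (coAd h ξ) - coAd g (χ.toFun h) :=
      ContinuousLinearMap.sub_comp _ _ _
    rw [coAd_mul, χ.map_mul, hsub]
    abel

/-- The first projection of composable pairs of arrows of the action groupoid `G × 𝔤^*`, where
`(g, h, η)` stands for the composable pair of `(g, h • η)` and `(h, η)`. -/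
def composableFst [LieGroup 𝓘(ℝ, E) ∞ G] (χ : CoadjointCocycle E G)
    (c : G × G × StrongDual ℝ E) : G × StrongDual ℝ E :=
  (c.1, (actionGroupoid (affineAction χ)).tgt c.2)

/-- The second projection of composable pairs, with the same conventions. -/
def composableSnd (c : G × G × StrongDual ℝ E) : G × StrongDual ℝ E := c.2

/-- The identification of `E` with its bidual, `v ↦ (ξ ↦ ξ v)`, in finite dimension. -/
def bidual (E : Type*) [NormedAddCommGroup E] [NormedSpace ℝ E] [FiniteDimensional ℝ E] :
    E ≃ₗᵢ[ℝ] StrongDual ℝ (StrongDual ℝ E) :=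
  (NormedSpace.inclusionInDoubleDualLi ℝ :
    E →ₗᵢ[ℝ] StrongDual ℝ (StrongDual ℝ E)).toLinearIsometryEquiv <| by
    have h : ∀ (V : Type _) [NormedAddCommGroup V] [NormedSpace ℝ V] [FiniteDimensional ℝ V],
        Module.finrank ℝ (StrongDual ℝ V) = Module.finrank ℝ V := fun V _ _ _ ↦
      (LinearMap.toContinuousLinearMap (𝕜 := ℝ) (E := V) (F' := ℝ)).finrank_eq.symm.trans
        Subspace.dual_finrank_eq
    rw [h, h]

/-- The affine Poisson structure of a 2-cocycle on `𝔤^*`: for covectors `α, β` at `ξ`, which are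
elements `v, w` of `𝔤^{**} = 𝔤`, it is `π_ξ(α, β) = ⟨ξ, [v, w]⟩ + λ(v, w)`. So the bracket of the linear
functions given by `v, w ∈ 𝔤` is the function `ξ ↦ ⟨ξ, [v, w]⟩ + λ(v, w)`. -/
def affinePoisson [FiniteDimensional ℝ E] (lam : GroupLieAlgebra 𝓘(ℝ, E) G [⋀^Fin 2]→L[ℝ] ℝ) :
    CovectorPairing 𝓘(ℝ, StrongDual ℝ E) (StrongDual ℝ E) := fun ξ α β ↦
  let v : GroupLieAlgebra 𝓘(ℝ, E) G := (bidual E).symm α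
  let w : GroupLieAlgebra 𝓘(ℝ, E) G := (bidual E).symm β
  ξ (⁅v, w⁆ : GroupLieAlgebra 𝓘(ℝ, E) G) + lam ![v, w]

/-! ### The cotangent bundle and the canonical 2-form with magnetic term -/

section Cotangent

variable [IsManifold 𝓘(ℝ, E) 1 G]

variable (E G) in
/-- The cotangent bundle `T^*G`. -/
abbrev CotangentBundle : Type _ :=
  Bundle.TotalSpace (E →L[ℝ] ℝ)
    (fun g : G ↦ TangentSpace 𝓘(ℝ, E) g →L[ℝ] Bundle.Trivial G ℝ g)

variable (E) in
/-- The model with corners of the manifolds `T^*G` and `G × 𝔤^*`. -/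
abbrev modelProd : ModelWithCorners ℝ (E × StrongDual ℝ E) (ModelProd E (StrongDual ℝ E)) :=
  𝓘(ℝ, E).prod 𝓘(ℝ, StrongDual ℝ E)

variable (E G) in
/-- The Liouville form `θ_α(X) = ⟨α, p_* X⟩` on `T^*G`. -/
def liouville : DiffForm (modelProd E) (CotangentBundle E G) 1 := fun α ↦
  ContinuousAlternatingMap.ofSubsingleton ℝ (TangentSpace (modelProd E) α) ℝ (0 : Fin 1)
    ((α.snd : TangentSpace 𝓘(ℝ, E) α.proj →L[ℝ] ℝ).comp
      (mfderiv (modelProd E) 𝓘(ℝ, E) (fun β : CotangentBundle E G ↦ β.proj) α))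

variable (E G) in
/-- The canonical 2-form `-dθ` on `T^*G`. -/
def canonicalForm : DiffForm (modelProd E) (CotangentBundle E G) 2 :=
  - extDer (modelProd E) (liouville E G)

/-- The left-invariant 2-form on `G` with value `λ` at `1`. -/
def leftInvariantForm (lam : GroupLieAlgebra 𝓘(ℝ, E) G [⋀^Fin 2]→L[ℝ] ℝ) :
    DiffForm 𝓘(ℝ, E) G 2 := fun g ↦
  lam.compContinuousLinearMap
    (mfderiv 𝓘(ℝ, E) 𝓘(ℝ, E) (fun x : G ↦ g⁻¹ * x) g :
      TangentSpace 𝓘(ℝ, E) g →L[ℝ] E)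

/-- The canonical 2-form with magnetic term, `ω_can + p^* λ^L`, on `T^*G`. -/
def magneticForm (lam : GroupLieAlgebra 𝓘(ℝ, E) G [⋀^Fin 2]→L[ℝ] ℝ) :
    DiffForm (modelProd E) (CotangentBundle E G) 2 :=
  canonicalForm E G +
    pullback (modelProd E) 𝓘(ℝ, E) (fun β : CotangentBundle E G ↦ β.proj) (leftInvariantForm lam)

variable (E G) in
/-- The trivialization `G × 𝔤^* → T^*G` by left translations, `(g, ξ) ↦ ξ ∘ (L_{g⁻¹})_*`. -/
def leftTrivialization (p : G × StrongDual ℝ E) : CotangentBundle E G :=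
  ⟨p.1, p.2.comp (mfderiv 𝓘(ℝ, E) 𝓘(ℝ, E) (fun x : G ↦ p.1⁻¹ * x) p.1 :
    TangentSpace 𝓘(ℝ, E) p.1 →L[ℝ] E)⟩

/-- The 2-form `ω_Γ` on `G × 𝔤^*`: minus the pullback of the canonical 2-form with magnetic term along
the left trivialization. -/
def omegaGamma (lam : GroupLieAlgebra 𝓘(ℝ, E) G [⋀^Fin 2]→L[ℝ] ℝ) :
    DiffForm (modelProd E) (G × StrongDual ℝ E) 2 :=
  - pullback (modelProd E) (modelProd E) (leftTrivialization E G) (magneticForm lam)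

end Cotangent

/-- The tangent vector of `G × 𝔤^*` at `(g, η)` given by `(v, ξ) ∈ 𝔤 × 𝔤^*` under left translation. -/
def leftTangent (g : G) (η : StrongDual ℝ E) (v : GroupLieAlgebra 𝓘(ℝ, E) G) (ξ : StrongDual ℝ E) :
    TangentSpace (modelProd E) ((g, η) : G × StrongDual ℝ E) :=
  (mulInvariantVectorField (I := 𝓘(ℝ, E)) v g, ξ)

end LieGroups

end AffineCoadjoint

end

open AffineCoadjoint

set_option linter.unusedSectionVars false

noncomputable section

namespace AffineCoadjoint

/-! Everything is computed with the left Maurer-Cartan form θ (`leftMC`), which trivialises the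
tangent bundle of G. Two differential identities carry the proof: the Maurer-Cartan equation dθ(a,
b) = -[θ a, θ b] (`fderiv_chartMC_antisymm`), and the derivative of g ↦ Ad_{g⁻¹} v, which is a ↦ -[θ
a, Ad_{g⁻¹} v] (`hasMFDerivAt_adE_inv`).

The group cocycle: the cocycle law transports the derivative of χ at 1 to every point, so ⟨χ, w⟩
must be a primitive of the 1-form a ↦ λ(θ a, Ad_{g⁻¹} w). Since G is connected this gives
uniqueness. The two identities and the cocycle condition on λ make this form closed
(`extDer_adjointForm`), and closed 1-forms on a simply connected manifold are exact: local
primitives differ by local constants, hence define a covering, which has a global section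
(`exists_primitive`). Linearity in w and the cocycle law hold because both sides have the same
derivative and the same value at 1 (`exists_integrates`).

The 2-form: at (g, η) the Liouville form pulls back to η ∘ θ, so ω_Γ = d⟨η, θ⟩ - pr₁^* λ^L
(`omegaGamma_eq`), and the Maurer-Cartan equation gives the explicit formula (`omegaGamma_apply`).
Closedness reduces to that of λ^L, which is the cocycle condition again; nondegeneracy is read off
from the formula.

Multiplicativity and the Poisson property of the target both rest on λ(Ad_{g⁻¹} u, Ad_{g⁻¹} v) =
λ(u, v) - ⟨χ(g), [u, v]⟩ (`CoadjointCocycle.Integrates.altBilin_adE`): the failure of λ to be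
Ad-invariant is exactly the translation by χ in the affine action. For the Poisson property, the
Hamiltonian vector of the pullback of a covector u ∈ 𝔤 by the target map is explicit: the
left-invariant field of -Ad_{g⁻¹} u, with zero component along 𝔤^*. The Jacobi identity for π_λ
splits into symmetric second derivatives, which cancel, the Jacobi identity of 𝔤, and the cocycle
condition. -/

theorem minSmoothness_two_le_infty : minSmoothness ℝ 2 ≤ (∞ : WithTop ℕ∞) := by
  rw [minSmoothness_of_isRCLikeNormedField]
  exact WithTop.coe_le_coe.2 le_top

/-! ### Smooth families of alternating forms on vector spaces -/

section AlternatingCalculus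

variable {X : Type*} [NormedAddCommGroup X] [NormedSpace ℝ X]
  {V : Type*} [NormedAddCommGroup V] [NormedSpace ℝ V]
  {W : Type*} [NormedAddCommGroup W] [NormedSpace ℝ W] {k : ℕ} {n : WithTop ℕ∞}

/-- Values on tuples of basis vectors embed the space of forms linearly into a finite-dimensional
space, and a linear left inverse of this embedding, automatically continuous, recovers the form. -/
theorem contDiffAt_alternating_of_apply [FiniteDimensional ℝ V] {f : X → V [⋀^Fin k]→L[ℝ] ℝ} {x : X}
    (h : ∀ v : Fin k → V, ContDiffAt ℝ n (fun y ↦ f y v) x) : ContDiffAt ℝ n f x := by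
  classical
  let b := Module.finBasis ℝ V
  let T : (V [⋀^Fin k]→L[ℝ] ℝ) →ₗ[ℝ] ((Fin k → Fin (Module.finrank ℝ V)) → ℝ) :=
    { toFun := fun a σ ↦ a (fun i ↦ b (σ i))
      map_add' := fun _ _ ↦ rfl
      map_smul' := fun _ _ ↦ rfl }
  have hT : Function.Injective T := by
    intro a a' haa
    have : a.toAlternatingMap = a'.toAlternatingMap := by
      refine AlternatingMap.coe_multilinearMap_injective ?_
      refine Module.Basis.ext_multilinear (fun _ ↦ b) fun σ ↦ ?_
      exact congrFun haa σ
    ext v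
    exact congrArg (fun A : V [⋀^Fin k]→ₗ[ℝ] ℝ ↦ A v) this
  obtain ⟨S, hS⟩ := T.exists_leftInverse_of_injective (LinearMap.ker_eq_bot.2 hT)
  have hf : f = fun y ↦ LinearMap.toContinuousLinearMap S (fun σ ↦ f y (fun i ↦ b (σ i))) := by
    funext y
    exact (congrArg (fun A : (V [⋀^Fin k]→L[ℝ] ℝ) →ₗ[ℝ] _ ↦ A (f y)) hS).symm
  rw [hf]
  exact (LinearMap.toContinuousLinearMap S).contDiff.contDiffAt.comp x
    (contDiffAt_pi.2 fun σ ↦ h _)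

theorem contDiffAt_alternating_comp_apply {σ : X → W [⋀^Fin k]→L[ℝ] ℝ} {L : X → V →L[ℝ] W} {x : X}
    (hσ : ContDiffAt ℝ n σ x) (hL : ContDiffAt ℝ n L x) (v : Fin k → V) :
    ContDiffAt ℝ n (fun y ↦ σ y (fun i ↦ L y (v i))) x := by
  have h1 : ContDiffAt ℝ n (fun y ↦ (ContinuousMultilinearMap.compContinuousLinearMapContinuousMultilinear
      ℝ (fun _ : Fin k ↦ V) (fun _ : Fin k ↦ W) ℝ) (fun _ ↦ L y)) x :=
    (ContinuousMultilinearMap.contDiff _).contDiffAt.comp x (contDiffAt_pi.2 fun _ ↦ hL)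
  have h2 : ContDiffAt ℝ n (fun y ↦ (σ y).toContinuousMultilinearMap) x :=
    (ContinuousAlternatingMap.toContinuousMultilinearMapCLM ℝ :
      (W [⋀^Fin k]→L[ℝ] ℝ) →L[ℝ] _).contDiff.contDiffAt.comp x hσ
  have h3 := h1.clm_apply h2
  exact (ContinuousMultilinearMap.apply ℝ (fun _ : Fin k ↦ V) ℝ v).contDiff.contDiffAt.comp x h3

theorem contDiffAt_alternating_comp [FiniteDimensional ℝ V] {σ : X → W [⋀^Fin k]→L[ℝ] ℝ}
    {L : X → V →L[ℝ] W} {x : X} (hσ : ContDiffAt ℝ n σ x) (hL : ContDiffAt ℝ n L x) :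
    ContDiffAt ℝ n (fun y ↦ (σ y).compContinuousLinearMap (L y)) x :=
  contDiffAt_alternating_of_apply fun v ↦ contDiffAt_alternating_comp_apply hσ hL v

theorem contDiffAt_extDeriv {σ : X → X [⋀^Fin k]→L[ℝ] ℝ} {x : X} (hσ : ContDiffAt ℝ ∞ σ x) :
    ContDiffAt ℝ ∞ (extDeriv σ) x := by
  have h : ContDiffAt ℝ ∞ (fderiv ℝ σ) x := hσ.fderiv_right (m := ∞) (by simp)
  exact (ContinuousAlternatingMap.alternatizeUncurryFinCLM ℝ X ℝ).contDiff.contDiffAt.comp x h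

end AlternatingCalculus

/-! ### Differential forms on boundaryless manifolds: pullback, charts and d -/

section FormsBoundaryless

variable {EM : Type*} [NormedAddCommGroup EM] [NormedSpace ℝ EM]
  {HM : Type*} [TopologicalSpace HM] {I : ModelWithCorners ℝ EM HM} [I.Boundaryless]
  {M : Type*} [TopologicalSpace M] [ChartedSpace HM M] [IsManifold I ∞ M]
  {EN : Type*} [NormedAddCommGroup EN] [NormedSpace ℝ EN]
  {HN : Type*} [TopologicalSpace HN] {J : ModelWithCorners ℝ EN HN} [J.Boundaryless]
  {N : Type*} [TopologicalSpace N] [ChartedSpace HN N] [IsManifold J ∞ N] {k : ℕ}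

/-- Smoothness of a form at a point, in the preferred chart at this point. -/
def SmoothFormAt (I : ModelWithCorners ℝ EM HM) (σ : DiffForm I M k) (x : M) : Prop :=
  ContDiffAt ℝ ∞ (inChart I σ x) (extChartAt I x x)

theorem mdifferentiableAt_extChartAt_symm' {x₀ : M} {y : EM} (hy : y ∈ (extChartAt I x₀).target) :
    MDifferentiableAt 𝓘(ℝ, EM) I (extChartAt I x₀).symm y :=
  have : IsManifold I 1 M := .of_le (n := ∞) (by simp)
  (mdifferentiableWithinAt_extChartAt_symm hy).mdifferentiableAt (by simp [I.range_eq_univ])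

theorem mdifferentiableAt_extChartAt' {x₀ x : M} (hx : x ∈ (extChartAt I x₀).source) :
    MDifferentiableAt I 𝓘(ℝ, EM) (extChartAt I x₀) x :=
  have : IsManifold I 1 M := .of_le (n := ∞) (by simp)
  mdifferentiableAt_extChartAt (by rwa [extChartAt_source] at hx)

theorem contMDiffAt_extChartAt_symm' {x₀ : M} {y : EM} (hy : y ∈ (extChartAt I x₀).target) :
    ContMDiffAt 𝓘(ℝ, EM) I ∞ (extChartAt I x₀).symm y :=
  (contMDiffOn_extChartAt_symm x₀).contMDiffAt ((isOpen_extChartAt_target x₀).mem_nhds hy)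

omit [IsManifold I ∞ M] in
theorem inChart_apply (σ : DiffForm I M k) (x₀ : M) (y : EM) (v : Fin k → EM) :
    inChart I σ x₀ y v = (σ : M → EM [⋀^Fin k]→L[ℝ] ℝ) ((extChartAt I x₀).symm y)
      (fun i ↦ (mfderiv 𝓘(ℝ, EM) I (extChartAt I x₀).symm y : EM →L[ℝ] EM) (v i)) := by
  rw [← mfderivWithin_univ, ← I.range_eq_univ]
  rfl

/-- The expression of a pullback in preferred charts is the pullback of the expression. -/
theorem inChart_pullback_eventuallyEq {f : M → N} {x : M} (hf : ContMDiffAt I J ∞ f x)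
    (σ : DiffForm J N k) :
    inChart I (pullback I J f σ) x =ᶠ[nhds (extChartAt I x x)] fun y ↦
      (inChart J σ (f x) (writtenInExtChartAt I J x f y)).compContinuousLinearMap
        (fderiv ℝ (writtenInExtChartAt I J x f) y) := by
  have : IsManifold I 1 M := .of_le (n := ∞) (by simp)
  have : IsManifold J 1 N := .of_le (n := ∞) (by simp)
  have h1 : ∀ᶠ z in nhds x, ContMDiffAt I J 1 f z :=
    (contMDiffAt_iff_contMDiffAt_nhds (by simp)).1 (hf.of_le (by simp))
  have h2 : ∀ᶠ z in nhds x, f z ∈ (extChartAt J (f x)).source :=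
    hf.continuousAt.preimage_mem_nhds (extChartAt_source_mem_nhds (f x))
  have h3 := (h1.and h2).eventually_nhds
  have hc : Filter.Tendsto (extChartAt I x).symm (nhds (extChartAt I x x)) (nhds x) := by
    have := continuousAt_extChartAt_symm (I := I) x
    rwa [ContinuousAt, extChartAt_to_inv] at this
  filter_upwards [hc.eventually h3, (isOpen_extChartAt_target x).mem_nhds (mem_extChartAt_target x)]
    with y hy hyt
  obtain ⟨hy1, hy2⟩ := hy.self_of_nhds
  have hs := mdifferentiableAt_extChartAt_symm' hyt
  have hfd : MDifferentiableAt I J f ((extChartAt I x).symm y) := hy1.mdifferentiableAt (by simp)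
  set F := writtenInExtChartAt I J x f with hF
  have hFy : F y = extChartAt J (f x) (f ((extChartAt I x).symm y)) := rfl
  have hFt : F y ∈ (extChartAt J (f x)).target := (extChartAt J (f x)).map_source hy2
  have hp : (extChartAt J (f x)).symm (F y) = f ((extChartAt I x).symm y) :=
    (extChartAt J (f x)).left_inv hy2
  have hFd : HasMFDerivAt 𝓘(ℝ, EM) 𝓘(ℝ, EN) F y (mfderiv 𝓘(ℝ, EM) 𝓘(ℝ, EN) F y) :=
    ((mdifferentiableAt_extChartAt' hy2).comp y (hfd.comp y hs)).hasMFDerivAt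
  -- Chain rule for the two factorisations f ∘ ψ⁻¹ = φ⁻¹ ∘ F, where F is the expression of f in the
  -- charts ψ at x and φ at f x.
  have key : (mfderiv I J f ((extChartAt I x).symm y)).comp
      (mfderiv 𝓘(ℝ, EM) I (extChartAt I x).symm y) =
      ((mfderiv 𝓘(ℝ, EN) J (extChartAt J (f x)).symm (F y)).comp
        (mfderiv 𝓘(ℝ, EM) 𝓘(ℝ, EN) F y) : EM →L[ℝ] EN) := by
    have hA := hfd.hasMFDerivAt.comp y hs.hasMFDerivAt
    have hB := (mdifferentiableAt_extChartAt_symm' hFt).hasMFDerivAt.comp y hFd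
    have hev : f ∘ (extChartAt I x).symm =ᶠ[nhds y] (extChartAt J (f x)).symm ∘ F := by
      filter_upwards [(continuousAt_extChartAt_symm'' hyt).eventually hy] with z hz
      exact ((extChartAt J (f x)).left_inv hz.2).symm
    exact hasMFDerivAt_unique hA (hB.congr_of_eventuallyEq hev)
  ext v
  rw [inChart_apply]
  change _ = inChart J σ (f x) (F y) (fun i ↦ fderiv ℝ F y (v i))
  rw [inChart_apply, hp]
  change (σ : N → EN [⋀^Fin k]→L[ℝ] ℝ) (f ((extChartAt I x).symm y)) _ = _
  congr 1
  funext i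
  have := congrArg (fun A : EM →L[ℝ] EN ↦ A (v i)) key
  rw [mfderiv_eq_fderiv] at this
  exact this

omit [I.Boundaryless] [J.Boundaryless] in
theorem contDiffAt_writtenInExtChartAt [I.Boundaryless] {f : M → N} {x : M}
    (hf : ContMDiffAt I J ∞ f x) :
    ContDiffAt ℝ ∞ (writtenInExtChartAt I J x f) (extChartAt I x x) := by
  have := (contMDiffAt_iff.1 hf).2
  rwa [I.range_eq_univ, contDiffWithinAt_univ] at this

/-- Naturality of d on a vector space, applied to the chart expression of f; the chart derivatives
at both ends match by the chain rule. -/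
theorem extDer_pullback_apply {f : M → N} {x : M} (hf : ContMDiffAt I J ∞ f x)
    {σ : DiffForm J N k} (hσ : SmoothFormAt J σ (f x)) :
    extDer I (pullback I J f σ) x = pullback I J f (extDer J σ) x := by
  have hfx : writtenInExtChartAt I J x f (extChartAt I x x) = extChartAt J (f x) (f x) := by
    simp [writtenInExtChartAt]
  have hF := contDiffAt_writtenInExtChartAt hf
  have h1 : extDeriv (inChart I (pullback I J f σ) x) (extChartAt I x x) =
      (extDeriv (inChart J σ (f x)) (extChartAt J (f x) (f x))).compContinuousLinearMap
        (fderiv ℝ (writtenInExtChartAt I J x f) (extChartAt I x x)) := by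
    rw [(inChart_pullback_eventuallyEq hf σ).extDeriv_eq, extDeriv_pullback (r := ∞) _ hF minSmoothness_two_le_infty,
      hfx]
    rw [hfx]
    exact hσ.differentiableAt (by simp)
  have hfd : MDifferentiableAt I J f x := hf.mdifferentiableAt (by simp)
  have key : (fderiv ℝ (writtenInExtChartAt I J x f) (extChartAt I x x)).comp
      (mfderiv I 𝓘(ℝ, EM) (extChartAt I x) x) =
      (mfderiv J 𝓘(ℝ, EN) (extChartAt J (f x)) (f x)).comp (mfderiv I J f x) := by
    have hA : HasMFDerivAt I 𝓘(ℝ, EN) (writtenInExtChartAt I J x f ∘ extChartAt I x) x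
        ((fderiv ℝ (writtenInExtChartAt I J x f) (extChartAt I x x)).comp
      (mfderiv I 𝓘(ℝ, EM) (extChartAt I x) x)) :=
      ((hF.differentiableAt (by simp)).hasFDerivAt.hasMFDerivAt).comp x
        (mdifferentiableAt_extChartAt' (mem_extChartAt_source x)).hasMFDerivAt
    have hB := (mdifferentiableAt_extChartAt' (I := J)
        (mem_extChartAt_source (f x))).hasMFDerivAt.comp x hfd.hasMFDerivAt
    refine hasMFDerivAt_unique hA (hB.congr_of_eventuallyEq ?_)
    filter_upwards [extChartAt_source_mem_nhds (I := I) x] with z hz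
    change extChartAt J (f x) (f ((extChartAt I x).symm (extChartAt I x z))) = _
    rw [(extChartAt I x).left_inv hz]
    rfl
  have h0 : extDer I (pullback I J f σ) x =
      (extDeriv (inChart I (pullback I J f σ) x) (extChartAt I x x)).compContinuousLinearMap
        (mfderiv I 𝓘(ℝ, EM) (extChartAt I x) x) := by
    rw [← extDerivWithin_univ, ← I.range_eq_univ]; rfl
  have h0' : extDer J σ (f x) =
      (extDeriv (inChart J σ (f x)) (extChartAt J (f x) (f x))).compContinuousLinearMap
        (mfderiv J 𝓘(ℝ, EN) (extChartAt J (f x)) (f x)) := by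
    rw [← extDerivWithin_univ, ← J.range_eq_univ]; rfl
  rw [h0, h1]
  unfold pullback
  rw [h0']
  ext v
  change extDeriv (inChart J σ (f x)) (extChartAt J (f x) (f x)) _ =
    extDeriv (inChart J σ (f x)) (extChartAt J (f x) (f x)) _
  congr 1
  funext i
  exact congrArg (fun A : EM →L[ℝ] EN ↦ A (v i)) key

theorem smoothFormAt_pullback [FiniteDimensional ℝ EM] {f : M → N} {x : M}
    (hf : ContMDiffAt I J ∞ f x) {σ : DiffForm J N k} (hσ : SmoothFormAt J σ (f x)) :
    SmoothFormAt I (pullback I J f σ) x := by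
  have hfx : writtenInExtChartAt I J x f (extChartAt I x x) = extChartAt J (f x) (f x) := by
    simp [writtenInExtChartAt]
  have hF := contDiffAt_writtenInExtChartAt hf
  refine ContDiffAt.congr_of_eventuallyEq ?_ (inChart_pullback_eventuallyEq hf σ)
  have hσ' : ContDiffAt ℝ ∞ (inChart J σ (f x))
      (writtenInExtChartAt I J x f (extChartAt I x x)) := by rw [hfx]; exact hσ
  have h1 : ContDiffAt ℝ ∞ (fun y ↦ inChart J σ (f x) (writtenInExtChartAt I J x f y))
      (extChartAt I x x) := hσ'.comp _ hF
  exact contDiffAt_alternating_comp h1 (hF.fderiv_right (m := ∞) (by simp))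

omit [I.Boundaryless] [IsManifold I ∞ M] in
theorem inChart_model (τ : DiffForm 𝓘(ℝ, EM) EM k) (y : EM) :
    inChart 𝓘(ℝ, EM) τ y = τ := by
  funext z
  ext v
  rw [inChart_apply]
  have h : mfderiv 𝓘(ℝ, EM) 𝓘(ℝ, EM) (extChartAt 𝓘(ℝ, EM) y).symm z =
      ContinuousLinearMap.id ℝ EM := mfderiv_id
  change τ z (fun i ↦ (mfderiv 𝓘(ℝ, EM) 𝓘(ℝ, EM) (extChartAt 𝓘(ℝ, EM) y).symm z :
    EM →L[ℝ] EM) (v i)) = τ z v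
  rw [h]
  rfl

theorem extDer_model (τ : DiffForm 𝓘(ℝ, EM) EM k) : extDer 𝓘(ℝ, EM) τ = extDeriv τ := by
  funext z
  have h : mfderiv 𝓘(ℝ, EM) 𝓘(ℝ, EM) (extChartAt 𝓘(ℝ, EM) z) z =
      ContinuousLinearMap.id ℝ EM := mfderiv_id
  have h' : inChart 𝓘(ℝ, EM) τ z = (τ : EM → EM [⋀^Fin k]→L[ℝ] ℝ) := inChart_model τ z
  unfold extDer
  rw [h', h]
  change (extDerivWithin (τ : EM → EM [⋀^Fin k]→L[ℝ] ℝ) (Set.range (@id EM)) z) =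
    extDeriv (τ : EM → EM [⋀^Fin k]→L[ℝ] ℝ) z
  rw [Set.range_id]
  exact congrFun (extDerivWithin_univ (τ : EM → EM [⋀^Fin k]→L[ℝ] ℝ)) z

/-- Since a chart expression is itself a pullback along an inverse chart, the naturality results for
pullbacks also yield independence of the chart. -/
theorem pullback_extChartAt_symm (σ : DiffForm I M k) (x₀ : M) :
    pullback 𝓘(ℝ, EM) I (extChartAt I x₀).symm σ = inChart I σ x₀ := by
  funext y
  refine ContinuousAlternatingMap.ext fun v ↦ ?_
  exact (inChart_apply σ x₀ y v).symm

theorem contDiffAt_inChart [FiniteDimensional ℝ EM] {σ : DiffForm I M k} {x₀ : M} {y : EM}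
    (hy : y ∈ (extChartAt I x₀).target) (hσ : SmoothFormAt I σ ((extChartAt I x₀).symm y)) :
    ContDiffAt ℝ ∞ (inChart I σ x₀) y := by
  have := smoothFormAt_pullback (contMDiffAt_extChartAt_symm' hy) hσ
  rw [SmoothFormAt, inChart_model, pullback_extChartAt_symm] at this
  exact this

/-- Pulling back along the inverse of a chart transfers smoothness from the preferred chart of each
point to any chart containing it, so testing every point in its own chart is enough. -/
theorem isSmoothForm_iff [FiniteDimensional ℝ EM] {σ : DiffForm I M k} :
    IsSmoothForm I σ ↔ ∀ x, SmoothFormAt I σ x := by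
  refine ⟨fun h x ↦ (h x).contDiffAt
    ((isOpen_extChartAt_target x).mem_nhds (mem_extChartAt_target x)), fun h x₀ y hy ↦ ?_⟩
  exact (contDiffAt_inChart hy (h _)).contDiffWithinAt

/-- The exterior derivative can be computed in any preferred chart. -/
theorem inChart_extDer {σ : DiffForm I M k} {x₀ : M} {y : EM}
    (hy : y ∈ (extChartAt I x₀).target) (hσ : SmoothFormAt I σ ((extChartAt I x₀).symm y)) :
    inChart I (extDer I σ) x₀ y = extDeriv (inChart I σ x₀) y := by
  have := extDer_pullback_apply (contMDiffAt_extChartAt_symm' hy) hσ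
  rw [extDer_model, pullback_extChartAt_symm, pullback_extChartAt_symm] at this
  exact this.symm

theorem IsSmoothForm.extDer [FiniteDimensional ℝ EM] {σ : DiffForm I M k} (hσ : IsSmoothForm I σ) :
    IsSmoothForm I (extDer I σ) := by
  intro x₀ y hy
  refine ContDiffAt.contDiffWithinAt ?_
  have h := contDiffAt_extDeriv ((hσ x₀).contDiffAt ((isOpen_extChartAt_target x₀).mem_nhds hy))
  refine h.congr_of_eventuallyEq ?_
  filter_upwards [(isOpen_extChartAt_target x₀).mem_nhds hy] with z hz
  exact inChart_extDer hz (isSmoothForm_iff.1 hσ _)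

omit [IsManifold I ∞ M] in
theorem extDer_eq_extDeriv (σ : DiffForm I M k) (x : M) : AffineCoadjoint.extDer I σ x =
      (extDeriv (inChart I σ x) (extChartAt I x x)).compContinuousLinearMap
        (mfderiv I 𝓘(ℝ, EM) (extChartAt I x) x) := by
  rw [← extDerivWithin_univ, ← I.range_eq_univ]; rfl

theorem extDer_extDer [FiniteDimensional ℝ EM] {σ : DiffForm I M k} (hσ : IsSmoothForm I σ) :
    AffineCoadjoint.extDer I (AffineCoadjoint.extDer I σ) = 0 := by
  funext x
  rw [extDer_eq_extDeriv]
  have h : inChart I (AffineCoadjoint.extDer I σ) x =ᶠ[nhds (extChartAt I x x)]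
      extDeriv (inChart I σ x) := by
    filter_upwards [(isOpen_extChartAt_target x).mem_nhds (mem_extChartAt_target x)] with z hz
    exact inChart_extDer hz (isSmoothForm_iff.1 hσ _)
  rw [h.extDeriv_eq, extDeriv_extDeriv_apply (r := ∞) (isSmoothForm_iff.1 hσ x)
    minSmoothness_two_le_infty]
  rfl

omit [I.Boundaryless] [IsManifold I ∞ M] in
theorem inChart_sub (σ τ : DiffForm I M k) (x : M) :
    inChart I (σ - τ) x = inChart I σ x - inChart I τ x := rfl

theorem IsSmoothForm.sub {σ τ : DiffForm I M k} (hσ : IsSmoothForm I σ) (hτ : IsSmoothForm I τ) :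
    IsSmoothForm I (σ - τ) := fun x ↦ by
  rw [inChart_sub]
  exact (hσ x).sub (hτ x)

theorem extDer_sub [FiniteDimensional ℝ EM] {σ τ : DiffForm I M k} (hσ : IsSmoothForm I σ)
    (hτ : IsSmoothForm I τ) : AffineCoadjoint.extDer I (σ - τ) =
      AffineCoadjoint.extDer I σ - AffineCoadjoint.extDer I τ := by
  funext x
  have h1 := (isSmoothForm_iff.1 hσ x).differentiableAt (by simp)
  have h2 := (isSmoothForm_iff.1 hτ x).differentiableAt (by simp)
  have h3 : extDeriv (inChart I σ x - inChart I τ x) (extChartAt I x x) =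
      extDeriv (inChart I σ x) (extChartAt I x x) - extDeriv (inChart I τ x) (extChartAt I x x) := by
    rw [extDeriv, fderiv_sub h1 h2]
    exact (ContinuousAlternatingMap.alternatizeUncurryFinCLM ℝ EM ℝ).map_sub _ _
  change _ = AffineCoadjoint.extDer I σ x - AffineCoadjoint.extDer I τ x
  rw [extDer_eq_extDeriv, extDer_eq_extDeriv, extDer_eq_extDeriv, inChart_sub, h3]
  rfl

theorem pullback_pullback {EP : Type*} [NormedAddCommGroup EP] [NormedSpace ℝ EP]
    {HP : Type*} [TopologicalSpace HP] {K : ModelWithCorners ℝ EP HP}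
    {P : Type*} [TopologicalSpace P] [ChartedSpace HP P] {f : M → N} {g : N → P}
    (hf : ContMDiff I J ∞ f) (hg : ContMDiff J K ∞ g) (σ : DiffForm K P k) :
    pullback I J f (pullback J K g σ) = pullback I K (g ∘ f) σ := by
  funext x
  unfold pullback
  rw [mfderiv_comp x (hg.mdifferentiableAt (by simp)) (hf.mdifferentiableAt (by simp))]
  rfl

end FormsBoundaryless

/-! ### Gluing local functions that differ by local constants -/

section Gluing

/-- The additive group of real numbers with the discrete topology. -/
def DiscreteReal : Type := ℝ

instance : AddCommGroup DiscreteReal := inferInstanceAs (AddCommGroup ℝ)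

instance : TopologicalSpace DiscreteReal := ⊥

instance : DiscreteTopology DiscreteReal := ⟨rfl⟩

variable {B : Type*} [TopologicalSpace B] {U : B → Set B}

/-- The fibre bundle with discrete fibres of the functions which locally differ by constants from
the given local functions. -/
def gluingCore (hU : ∀ i, IsOpen (U i)) (hmem : ∀ i, i ∈ U i) (f : B → B → DiscreteReal)
    (hf : ∀ i j, ∀ x ∈ U i ∩ U j, ∀ᶠ z in nhds x, f i z - f j z = f i x - f j x) :
    FiberBundleCore B B DiscreteReal where
  baseSet := U
  isOpen_baseSet := hU
  indexAt := id
  mem_baseSet_at := hmem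
  coordChange i j x v := v + (f i x - f j x)
  coordChange_self i x _ v := by simp
  continuousOn_coordChange i j := by
    rintro ⟨x, v⟩ ⟨hx, -⟩
    refine ContinuousAt.continuousWithinAt ?_
    have h : (fun p : B × DiscreteReal ↦ p.2 + (f i p.1 - f j p.1)) =ᶠ[nhds (x, v)]
        fun _ ↦ v + (f i x - f j x) := by
      -- The fibre is discrete, so the neighbourhoods of (x, v) come from those of x with v fixed;
      -- there the transition constant does not change.
      rw [nhds_prod_eq, nhds_discrete DiscreteReal, Filter.prod_pure]
      filter_upwards [Filter.image_mem_map (hf i j x hx)] with p hp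
      obtain ⟨z, hz, rfl⟩ := hp
      exact congrArg (v + ·) hz
    exact continuousAt_const.congr h.symm
  coordChange_comp i j k x _ v := by abel

/-- On a simply connected space, local functions which locally differ by constants are, up to
constants, restrictions of a global function. -/
theorem exists_glued_function [SimplyConnectedSpace B] [LocallyPathConnectedSpace B]
    (hU : ∀ i, IsOpen (U i)) (hmem : ∀ i, i ∈ U i) (f : B → B → DiscreteReal)
    (hf : ∀ i j, ∀ x ∈ U i ∩ U j, ∀ᶠ z in nhds x, f i z - f j z = f i x - f j x) :
    ∃ g : B → DiscreteReal, ∀ x, ∀ᶠ z in nhds x, g z = f x z + (g x - f x x) := by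
  let Z := gluingCore hU hmem f hf
  have hcov : IsCoveringMap (Bundle.TotalSpace.proj : Bundle.TotalSpace DiscreteReal Z.Fiber → B) :=
    FiberBundle.isCoveringMap
  obtain ⟨b⟩ : Nonempty B := inferInstance
  -- A lift of the identity map to the covering, which exists as B is simply connected and locally
  -- path connected: a global continuous section.
  obtain ⟨F, ⟨-, hF⟩, -⟩ := hcov.existsUnique_continuousMap_lifts (ContinuousMap.id B) b
    (⟨b, (0 : DiscreteReal)⟩ : Bundle.TotalSpace DiscreteReal Z.Fiber) rfl
  have hp : ∀ x, (F x).1 = x := fun x ↦ congrFun hF x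
  let s : B → DiscreteReal := fun x ↦ (F x).2
  -- Read in the trivialization of index x, the section is s z + f z z - f x z. It is continuous
  -- with discrete values, hence constant near x, which says that z ↦ f z z + s z and f x differ by
  -- a constant there.
  refine ⟨fun x ↦ f x x + s x, fun x ↦ ?_⟩
  have hc : ContinuousAt (fun z ↦ (Z.localTriv x (F z)).2) x := by
    have h1 : ContinuousAt (Z.localTriv x) (F x) := by
      refine (Z.localTriv x).continuousAt ?_
      rw [FiberBundleCore.mem_localTriv_source, hp]
      exact hmem x
    exact continuous_snd.continuousAt.comp (h1.comp F.continuous.continuousAt)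
  have hc' : ∀ᶠ z in nhds x, (Z.localTriv x (F z)).2 = (Z.localTriv x (F x)).2 := by
    rw [ContinuousAt, nhds_discrete DiscreteReal, Filter.tendsto_pure] at hc
    exact hc
  have hval : ∀ z, (Z.localTriv x (F z)).2 = s z + (f z z - f x z) := by
    intro z
    change s z + (f (F z).1 (F z).1 - f x (F z).1) = _
    rw [hp]
  filter_upwards [hc'] with z hz
  rw [hval, hval, sub_self, add_zero] at hz
  rw [← hz]
  abel

end Gluing

/-! ### Functions with vanishing differential -/

section Constancy

variable {EM : Type*} [NormedAddCommGroup EM] [NormedSpace ℝ EM]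
  {HM : Type*} [TopologicalSpace HM] {I : ModelWithCorners ℝ EM HM} [I.Boundaryless]
  {M : Type*} [TopologicalSpace M] [ChartedSpace HM M] [IsManifold I ∞ M]
  {V : Type*} [NormedAddCommGroup V] [NormedSpace ℝ V]

omit [I.Boundaryless] [IsManifold I ∞ M] in
theorem hasMFDerivAt_of_eq {f : M → V} {x : M} {f' g' : EM →L[ℝ] V}
    (h : HasMFDerivAt I 𝓘(ℝ, V) f x f') (e : f' = g') : HasMFDerivAt I 𝓘(ℝ, V) f x g' := e ▸ h

/-- In a chart the derivative vanishes on a ball, which is connected. -/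
theorem eventually_eq_of_mfderiv_eq_zero {f : M → V} {x : M}
    (h : ∀ᶠ z in nhds x, HasMFDerivAt I 𝓘(ℝ, V) f z (0 : EM →L[ℝ] V)) :
    ∀ᶠ z in nhds x, f z = f x := by
  have hc : Filter.Tendsto (extChartAt I x).symm (nhds (extChartAt I x x)) (nhds x) := by
    have := continuousAt_extChartAt_symm (I := I) x
    rwa [ContinuousAt, extChartAt_to_inv] at this
  have h1 := (hc.eventually h).and
    ((isOpen_extChartAt_target x).mem_nhds (mem_extChartAt_target x))
  obtain ⟨ε, hε, hb⟩ := Metric.eventually_nhds_iff_ball.1 h1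
  have hd : ∀ y ∈ Metric.ball (extChartAt I x x) ε,
      HasFDerivAt (f ∘ (extChartAt I x).symm) (0 : EM →L[ℝ] V) y := by
    intro y hy
    have := (hb y hy).1.comp y (mdifferentiableAt_extChartAt_symm' (hb y hy).2).hasMFDerivAt
    have h2 := this.hasFDerivAt
    exact h2.congr_fderiv (ContinuousLinearMap.zero_comp _)
  have hmem : ∀ᶠ z in nhds x, extChartAt I x z ∈ Metric.ball (extChartAt I x x) ε :=
    (continuousAt_extChartAt x).preimage_mem_nhds (Metric.ball_mem_nhds _ hε)
  filter_upwards [hmem, extChartAt_source_mem_nhds (I := I) x] with z hz hzs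
  have := Metric.isOpen_ball.is_const_of_fderiv_eq_zero (convex_ball _ _).isPreconnected
    (fun y hy ↦ (hd y hy).differentiableAt.differentiableWithinAt)
    (fun y hy ↦ (hd y hy).fderiv) hz (Metric.mem_ball_self hε)
  change f ((extChartAt I x).symm (extChartAt I x z)) = f ((extChartAt I x).symm (extChartAt I x x))
    at this
  rwa [(extChartAt I x).left_inv hzs, extChartAt_to_inv] at this

theorem eq_of_mfderiv_eq_zero [PreconnectedSpace M] {f : M → V}
    (h : ∀ _z, HasMFDerivAt I 𝓘(ℝ, V) f _z (0 : EM →L[ℝ] V)) (x y : M) : f x = f y :=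
  ((IsLocallyConstant.iff_eventually_eq f).2 fun _ ↦
    eventually_eq_of_mfderiv_eq_zero (.of_forall h)).apply_eq_of_preconnectedSpace x y

end Constancy

/-! ### Closed 1-forms and their primitives -/

section OneForms

variable {X : Type*} [NormedAddCommGroup X] [NormedSpace ℝ X]

theorem extDeriv_one_apply {σ : X → X [⋀^Fin 1]→L[ℝ] ℝ} {x : X} (h : DifferentiableAt ℝ σ x)
    (a b : X) : extDeriv σ x ![a, b] =
      fderiv ℝ (fun y ↦ σ y ![b]) x a - fderiv ℝ (fun y ↦ σ y ![a]) x b := by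
  rw [extDeriv_apply h]
  have h0 : (0 : Fin 2).removeNth ![a, b] = ![b] := by ext i; fin_cases i; rfl
  have h1 : (1 : Fin 2).removeNth ![a, b] = ![a] := by ext i; fin_cases i; rfl
  rw [Fin.sum_univ_two, h0, h1]
  simp [sub_eq_add_neg]

theorem extDeriv_two_apply {σ : X → X [⋀^Fin 2]→L[ℝ] ℝ} {x : X} (h : DifferentiableAt ℝ σ x)
    (a b c : X) : extDeriv σ x ![a, b, c] =
      fderiv ℝ (fun y ↦ σ y ![b, c]) x a - fderiv ℝ (fun y ↦ σ y ![a, c]) x b +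
        fderiv ℝ (fun y ↦ σ y ![a, b]) x c := by
  rw [extDeriv_apply h]
  have h0 : (0 : Fin 3).removeNth ![a, b, c] = ![b, c] := by ext i; fin_cases i <;> rfl
  have h1 : (1 : Fin 3).removeNth ![a, b, c] = ![a, c] := by ext i; fin_cases i <;> rfl
  have h2 : (2 : Fin 3).removeNth ![a, b, c] = ![a, b] := by ext i; fin_cases i <;> rfl
  rw [Fin.sum_univ_three, h0, h1, h2]
  simp [sub_eq_add_neg]

/-- A `1`-form as a field of covectors. -/
def toCovector (σ : X [⋀^Fin 1]→L[ℝ] ℝ) : X →L[ℝ] ℝ :=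
  (ContinuousAlternatingMap.ofSubsingletonLIE (𝕜 := ℝ) (E := X) (F := ℝ) (0 : Fin 1)).symm σ

theorem toCovector_apply (σ : X [⋀^Fin 1]→L[ℝ] ℝ) (v : X) : toCovector σ v = σ ![v] := by
  change σ (fun _ ↦ v) = _
  congr 1
  ext i
  fin_cases i
  rfl

theorem contDiffAt_toCovector {Y : Type*} [NormedAddCommGroup Y] [NormedSpace ℝ Y]
    {σ : Y → X [⋀^Fin 1]→L[ℝ] ℝ} {y : Y} {n : WithTop ℕ∞} (h : ContDiffAt ℝ n σ y) :
    ContDiffAt ℝ n (fun z ↦ toCovector (σ z)) y :=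
  (ContinuousAlternatingMap.ofSubsingletonLIE (𝕜 := ℝ) (E := X) (F := ℝ)
    (0 : Fin 1)).symm.contDiff.contDiffAt.comp y h

variable {EM : Type*} [NormedAddCommGroup EM] [NormedSpace ℝ EM] [FiniteDimensional ℝ EM]
  {HM : Type*} [TopologicalSpace HM] {I : ModelWithCorners ℝ EM HM} [I.Boundaryless]
  {M : Type*} [TopologicalSpace M] [ChartedSpace HM M] [IsManifold I ∞ M]

/-- A `1`-form on a manifold as a field of covectors. -/
def covectorField (σ : DiffForm I M 1) (x : M) : EM →L[ℝ] ℝ :=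
  toCovector ((σ : M → EM [⋀^Fin 1]→L[ℝ] ℝ) x)

theorem covectorField_apply (σ : DiffForm I M 1) (x : M) (v : EM) :
    covectorField σ x v = (σ : M → EM [⋀^Fin 1]→L[ℝ] ℝ) x ![v] := toCovector_apply _ _

/-- Poincaré lemma on a convex ball in the chart: dσ = 0 says that the derivative of the associated
covector field is symmetric. -/
theorem exists_local_primitive {σ : DiffForm I M 1} (hσ : IsSmoothForm I σ)
    (hc : extDer I σ = 0) (x₀ : M) : ∃ (U : Set M) (f : M → ℝ), IsOpen U ∧ x₀ ∈ U ∧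
      ∀ z ∈ U, HasMFDerivAt I 𝓘(ℝ, ℝ) f z (covectorField (EM := EM) σ z) := by
  obtain ⟨ε, hε, hb⟩ := Metric.mem_nhds_iff.1
    ((isOpen_extChartAt_target (I := I) x₀).mem_nhds (mem_extChartAt_target x₀))
  have hd : ∀ y ∈ Metric.ball (extChartAt I x₀ x₀) ε, ContDiffAt ℝ ∞ (inChart I σ x₀) y :=
    fun y hy ↦ contDiffAt_inChart (hb hy) (isSmoothForm_iff.1 hσ _)
  obtain ⟨F, hF⟩ := (convex_ball (extChartAt I x₀ x₀) ε).exists_forall_hasFDerivAt_of_fderiv_symmetric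
    Metric.isOpen_ball
    (show DifferentiableOn ℝ (fun y ↦ toCovector (inChart I σ x₀ y)) _ from fun y hy ↦ ((contDiffAt_toCovector (hd y hy)).differentiableAt
      (by simp)).differentiableWithinAt) (fun y hy a b ↦ by
      have h1 := (hd y hy).differentiableAt (n := ∞) (by simp)
      have h2 := (contDiffAt_toCovector (hd y hy)).differentiableAt (n := ∞) (by simp)
      have h3 := inChart_extDer (hb hy) (isSmoothForm_iff.1 hσ _)
      have h4 : inChart I (extDer I σ) x₀ y = 0 := by rw [hc]; rfl
      have h5 := extDeriv_one_apply h1 a b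
      rw [← h3, h4] at h5
      have h6 : ∀ a b, fderiv ℝ (fun y ↦ toCovector (inChart I σ x₀ y)) y a b =
          fderiv ℝ (fun y ↦ inChart I σ x₀ y ![b]) y a := by
        intro a b
        have := h2.hasFDerivAt.clm_apply (hasFDerivAt_const b y)
        simp only [toCovector_apply] at this
        rw [this.fderiv]
        simp
      rw [h6, h6]
      exact (sub_eq_zero.1 h5.symm))
  refine ⟨(extChartAt I x₀).source ∩ extChartAt I x₀ ⁻¹' Metric.ball (extChartAt I x₀ x₀) ε,
    F ∘ extChartAt I x₀, isOpen_extChartAt_preimage' x₀ Metric.isOpen_ball,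
    ⟨mem_extChartAt_source x₀, Metric.mem_ball_self hε⟩, fun z hz ↦ ?_⟩
  have h := (hF _ hz.2).hasMFDerivAt.comp z (mdifferentiableAt_extChartAt' hz.1).hasMFDerivAt
  have : IsManifold I 1 M := .of_le (n := ∞) (by simp)
  refine hasMFDerivAt_of_eq h (ContinuousLinearMap.ext fun v ↦ ?_)
  have h7 := mfderivWithin_extChartAt_symm_comp_mfderiv_extChartAt' hz.1
  rw [I.range_eq_univ, mfderivWithin_univ] at h7
  have h8 := congrArg (fun A : EM →L[ℝ] EM ↦ A v) h7
  refine (toCovector_apply (inChart I σ x₀ (extChartAt I x₀ z)) _).trans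
    (((inChart_apply σ x₀ (extChartAt I x₀ z) _).trans ?_).trans (covectorField_apply σ z v).symm)
  rw [(extChartAt I x₀).left_inv hz.1]
  congr 1
  ext i
  fin_cases i
  exact h8

/-- Bootstrapping: in a chart the derivative of f is the smooth covector field of σ, so f gains one
more order of differentiability. -/
theorem contMDiffAt_of_hasMFDerivAt_covectorField {σ : DiffForm I M 1} (hσ : IsSmoothForm I σ)
    {f : M → ℝ} (h : ∀ x, HasMFDerivAt I 𝓘(ℝ, ℝ) f x (covectorField (EM := EM) σ x)) :
    ContMDiff I 𝓘(ℝ, ℝ) ∞ f := by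
  intro x
  rw [contMDiffAt_iff]
  refine ⟨(h x).continuousAt, ?_⟩
  rw [I.range_eq_univ, contDiffWithinAt_univ]
  have hd : ∀ y ∈ (extChartAt I x).target, HasFDerivAt (f ∘ (extChartAt I x).symm)
      (toCovector (inChart I σ x y)) y := by
    intro y hy
    have h2 := ((h _).comp y (mdifferentiableAt_extChartAt_symm' hy).hasMFDerivAt).hasFDerivAt
    refine h2.congr_fderiv (ContinuousLinearMap.ext fun v ↦ ?_)
    refine (covectorField_apply σ ((extChartAt I x).symm y) _).trans
      (Eq.trans ?_ ((toCovector_apply _ _).trans (inChart_apply σ x y _)).symm)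
    congr 1
    ext i
    fin_cases i
    rfl
  have hon : ContDiffOn ℝ (∞ + 1) (f ∘ (extChartAt I x).symm) (extChartAt I x).target := by
    rw [contDiffOn_succ_iff_fderiv_of_isOpen (isOpen_extChartAt_target x)]
    refine ⟨fun y hy ↦ (hd y hy).differentiableAt.differentiableWithinAt, by simp, ?_⟩
    have h3 : ContDiffOn ℝ ∞ (fun y ↦ toCovector (inChart I σ x y)) (extChartAt I x).target :=
      fun y hy ↦ (contDiffAt_toCovector (contDiffAt_inChart hy
        (isSmoothForm_iff.1 hσ _))).contDiffWithinAt
    exact h3.congr fun y hy ↦ (hd y hy).fderiv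
  exact (hon.contDiffAt ((isOpen_extChartAt_target x).mem_nhds (mem_extChartAt_target x))).of_le
    (by simp)

/-- On a simply connected manifold, closed `1`-forms are exact. -/
theorem exists_primitive [SimplyConnectedSpace M] [LocallyPathConnectedSpace M]
    {σ : DiffForm I M 1} (hσ : IsSmoothForm I σ) (hc : extDer I σ = 0) (x₀ : M) :
    ∃ f : M → ℝ, f x₀ = 0 ∧ ContMDiff I 𝓘(ℝ, ℝ) ∞ f ∧
      ∀ x, HasMFDerivAt I 𝓘(ℝ, ℝ) f x (covectorField (EM := EM) σ x) := by
  choose U f hU hmem hf using exists_local_primitive hσ hc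
  -- On overlaps two local primitives have the same differential, so their difference is locally
  -- constant.
  obtain ⟨g, hg⟩ := exists_glued_function hU hmem f (fun i j x hx ↦ by
    have h : ∀ᶠ z in nhds x, HasMFDerivAt I 𝓘(ℝ, ℝ) (fun z ↦ f i z - f j z) z
        (0 : EM →L[ℝ] ℝ) := by
      filter_upwards [((hU i).inter (hU j)).mem_nhds hx] with z hz
      exact hasMFDerivAt_of_eq ((hf i z hz.1).sub (hf j z hz.2)) (sub_self (_ : EM →L[ℝ] ℝ))
    exact eventually_eq_of_mfderiv_eq_zero (V := ℝ) h)
  let g' : M → ℝ := g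
  have hg' : ∀ x, HasMFDerivAt I 𝓘(ℝ, ℝ) g' x (covectorField (EM := EM) σ x) := by
    intro x
    have h1 : HasMFDerivAt I 𝓘(ℝ, ℝ) (fun z ↦ f x z + (g' x - f x x)) x
        (covectorField (EM := EM) σ x) :=
      hasMFDerivAt_of_eq ((hf x x (hmem x)).add (hasMFDerivAt_const (g' x - f x x) x))
        (add_zero (_ : EM →L[ℝ] ℝ))
    exact h1.congr_of_eventuallyEq (hg x)
  have hg0 : ∀ x, HasMFDerivAt I 𝓘(ℝ, ℝ) (fun z ↦ g' z - g' x₀) x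
      (covectorField (EM := EM) σ x) := fun x ↦
    hasMFDerivAt_of_eq ((hg' x).sub (hasMFDerivAt_const (g' x₀) x)) (sub_zero (_ : EM →L[ℝ] ℝ))
  exact ⟨fun z ↦ g' z - g' x₀, sub_self _, contMDiffAt_of_hasMFDerivAt_covectorField hσ hg0, hg0⟩

end OneForms

/-! ### Derivatives as maps between model spaces -/

section Derivatives

variable {EM : Type*} [NormedAddCommGroup EM] [NormedSpace ℝ EM]
  {HM : Type*} [TopologicalSpace HM] {I : ModelWithCorners ℝ EM HM}
  {M : Type*} [TopologicalSpace M] [ChartedSpace HM M]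
  {EN : Type*} [NormedAddCommGroup EN] [NormedSpace ℝ EN]
  {HN : Type*} [TopologicalSpace HN] {J : ModelWithCorners ℝ EN HN}
  {N : Type*} [TopologicalSpace N] [ChartedSpace HN N]
  {EP : Type*} [NormedAddCommGroup EP] [NormedSpace ℝ EP]
  {HP : Type*} [TopologicalSpace HP] {K : ModelWithCorners ℝ EP HP}
  {P : Type*} [TopologicalSpace P] [ChartedSpace HP P]

variable (I J) in
/-- The differential of a map between manifolds, as a map between the model vector spaces. -/
def tderiv (f : M → N) (x : M) : EM →L[ℝ] EN := mfderiv I J f x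

theorem tderiv_comp {g : N → P} {f : M → N} {x : M} (hg : MDifferentiableAt J K g (f x))
    (hf : MDifferentiableAt I J f x) :
    tderiv I K (fun z ↦ g (f z)) x = (tderiv J K g (f x)).comp (tderiv I J f x) :=
  mfderiv_comp x hg hf

theorem HasMFDerivAt.tderiv_eq {f : M → N} {x : M} {f' : EM →L[ℝ] EN}
    (h : HasMFDerivAt I J f x f') : tderiv I J f x = f' := h.mfderiv

theorem hasMFDerivAt_tderiv {f : M → N} {x : M} (h : MDifferentiableAt I J f x) :
    HasMFDerivAt I J f x (tderiv (EM := EM) (EN := EN) I J f x) := h.hasMFDerivAt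

theorem tderiv_congr {f g : M → N} {x : M} (h : f =ᶠ[nhds x] g) :
    tderiv I J f x = tderiv I J g x := h.mfderiv_eq

theorem tderiv_eq_fderiv {f : EM → EN} {x : EM} :
    tderiv 𝓘(ℝ, EM) 𝓘(ℝ, EN) f x = fderiv ℝ f x := mfderiv_eq_fderiv

theorem tderiv_id {x : M} : tderiv I I (fun z : M ↦ z) x = ContinuousLinearMap.id ℝ EM := mfderiv_id

/-- The tangent space at x is identified with the model space by the preferred chart at x, so this
chart has trivial derivative at x itself, though in general not at nearby points. -/
theorem tderiv_extChartAt_self [IsManifold I 1 M] (x : M) :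
    tderiv I 𝓘(ℝ, EM) (extChartAt I x) x = ContinuousLinearMap.id ℝ EM := by
  have h : tderiv I 𝓘(ℝ, EM) (extChartAt I x) x = tangentCoordChange I x x x :=
    if_pos (mdifferentiableAt_extChartAt (mem_chart_source HM x))
  rw [h]
  ext v
  exact tangentCoordChange_self (mem_extChartAt_source x)

theorem tderiv_extChartAt_symm_self [I.Boundaryless] [IsManifold I 1 M] (x : M) :
    tderiv 𝓘(ℝ, EM) I (extChartAt I x).symm (extChartAt I x x) = ContinuousLinearMap.id ℝ EM := by
  have h7 := mfderivWithin_extChartAt_symm_comp_mfderiv_extChartAt' (mem_extChartAt_source (I := I) x)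
  rw [I.range_eq_univ, mfderivWithin_univ] at h7
  have h8 : (tderiv 𝓘(ℝ, EM) I (extChartAt I x).symm (extChartAt I x x)).comp
    (tderiv I 𝓘(ℝ, EM) (extChartAt I x) x) = ContinuousLinearMap.id ℝ EM := h7
  rwa [tderiv_extChartAt_self, ContinuousLinearMap.comp_id] at h8

theorem isInvertible_tderiv_extChartAt_symm [I.Boundaryless] [IsManifold I 1 M] {x : M} {y : EM}
    (hy : y ∈ (extChartAt I x).target) :
    (tderiv 𝓘(ℝ, EM) I (extChartAt I x).symm y).IsInvertible := by
  have := isInvertible_mfderivWithin_extChartAt_symm hy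
  rwa [I.range_eq_univ, mfderivWithin_univ] at this

theorem inChart_apply' [I.Boundaryless] {k : ℕ} (σ : DiffForm I M k) (x₀ : M) (y : EM)
    (v : Fin k → EM) :
    inChart I σ x₀ y v = (σ : M → EM [⋀^Fin k]→L[ℝ] ℝ) ((extChartAt I x₀).symm y)
      (fun i ↦ tderiv 𝓘(ℝ, EM) I (extChartAt I x₀).symm y (v i)) :=
  inChart_apply σ x₀ y v

theorem contMDiffAt_clm_of_apply {V W : Type*} [NormedAddCommGroup V] [NormedSpace ℝ V]
    [FiniteDimensional ℝ V] [NormedAddCommGroup W] [NormedSpace ℝ W] {n : WithTop ℕ∞}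
    {f : M → V →L[ℝ] W} {x : M} (h : ∀ v, ContMDiffAt I 𝓘(ℝ, W) n (fun z ↦ f z v) x) :
    ContMDiffAt I 𝓘(ℝ, V →L[ℝ] W) n f x := by
  classical
  let b := Module.finBasis ℝ V
  let c : Fin (Module.finrank ℝ V) → V →L[ℝ] ℝ := fun i ↦ LinearMap.toContinuousLinearMap (b.coord i)
  let Φ : (Fin (Module.finrank ℝ V) → W) →L[ℝ] (V →L[ℝ] W) :=
    ∑ i, (ContinuousLinearMap.smulRightL ℝ V W (c i)).comp (ContinuousLinearMap.proj i)
  have hf : f = fun z ↦ Φ (fun i ↦ f z (b i)) := by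
    funext z
    ext v
    have h1 : f z v = f z (∑ i, b.repr v i • b i) := by rw [b.sum_repr v]
    rw [h1, map_sum]
    simp [Φ, c]
  rw [hf]
  exact Φ.contDiff.contMDiff.contMDiffAt.comp x (contMDiffAt_pi_space.2 fun i ↦ h _)

end Derivatives

/-! ### The Maurer-Cartan form and its structure equation -/

section LieGroups

variable {E : Type*} [NormedAddCommGroup E] [NormedSpace ℝ E]
  {G : Type*} [TopologicalSpace G] [ChartedSpace E G] [Group G] [LieGroup 𝓘(ℝ, E) ∞ G]

theorem contMDiff_mul_left' (g : G) : ContMDiff 𝓘(ℝ, E) 𝓘(ℝ, E) ∞ (fun x : G ↦ g * x) :=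
  contMDiff_mul_left

theorem mdifferentiableAt_mul_left' (g x : G) :
    MDifferentiableAt 𝓘(ℝ, E) 𝓘(ℝ, E) (fun x : G ↦ g * x) x :=
  (contMDiff_mul_left' g).mdifferentiable (by simp) x

theorem mdifferentiableAt_mul_right' (g x : G) :
    MDifferentiableAt 𝓘(ℝ, E) 𝓘(ℝ, E) (fun x : G ↦ x * g) x :=
  (contMDiff_mul_right (I := 𝓘(ℝ, E)) (n := ∞)).mdifferentiable (by simp) x

theorem mdifferentiableAt_conj (g x : G) :
    MDifferentiableAt 𝓘(ℝ, E) 𝓘(ℝ, E) (fun x : G ↦ g * x * g⁻¹) x :=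
  (mdifferentiableAt_mul_right' g⁻¹ (g * x)).comp x (mdifferentiableAt_mul_left' g x)

variable (E) in
/-- The left Maurer-Cartan form `T_g G → T_1 G`, as an endomorphism of the model space. -/
def leftMC (g : G) : E →L[ℝ] E := tderiv 𝓘(ℝ, E) 𝓘(ℝ, E) (fun x : G ↦ g⁻¹ * x) g

variable (E) in
/-- The adjoint action on the model space. -/
def adE (g : G) : E →L[ℝ] E := Ad (E := E) g

theorem adE_one : adE E (1 : G) = ContinuousLinearMap.id ℝ E := Ad_one

theorem adE_mul (g h : G) : adE E (g * h) = (adE E g).comp (adE E h) := Ad_mul g h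

theorem adE_inv_adE (g : G) (v : E) : adE E g⁻¹ (adE E g v) = v := by
  have := adE_mul (E := E) g⁻¹ g
  rw [inv_mul_cancel, adE_one] at this
  exact (congrArg (fun A : E →L[ℝ] E ↦ A v) this).symm

theorem adE_adE_inv (g : G) (v : E) : adE E g (adE E g⁻¹ v) = v := by
  simpa using adE_inv_adE (E := E) g⁻¹ v

theorem leftMC_comp_tderiv_mul_left (g : G) :
    (leftMC E g).comp (tderiv 𝓘(ℝ, E) 𝓘(ℝ, E) (fun x : G ↦ g * x) 1) =
      ContinuousLinearMap.id ℝ E := by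
  have h1 := tderiv_comp (K := 𝓘(ℝ, E)) (mdifferentiableAt_mul_left' g⁻¹ (g * 1))
    (mdifferentiableAt_mul_left' g 1)
  simp only [inv_mul_cancel_left, mul_one] at h1
  rw [tderiv_id] at h1
  exact h1.symm

theorem tderiv_mul_left_comp_leftMC (g : G) :
    (tderiv 𝓘(ℝ, E) 𝓘(ℝ, E) (fun x : G ↦ g * x) 1).comp (leftMC E g) =
      ContinuousLinearMap.id ℝ E := by
  have h1 := tderiv_comp (K := 𝓘(ℝ, E)) (mdifferentiableAt_mul_left' g (g⁻¹ * g))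
    (mdifferentiableAt_mul_left' g⁻¹ g)
  simp only [mul_inv_cancel_left, inv_mul_cancel] at h1
  rw [tderiv_id] at h1
  exact h1.symm

theorem isInvertible_leftMC (g : G) : (leftMC E g).IsInvertible :=
  .of_inverse (leftMC_comp_tderiv_mul_left g) (tderiv_mul_left_comp_leftMC g)

/-- The left-invariant vector field as a map to the model space. -/
def leftField (v : E) (g : G) : E := tderiv 𝓘(ℝ, E) 𝓘(ℝ, E) (fun x : G ↦ g * x) 1 v

theorem leftMC_leftField (v : E) (g : G) : leftMC E g (leftField v g) = v :=
  congrArg (fun A : E →L[ℝ] E ↦ A v) (leftMC_comp_tderiv_mul_left g)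

theorem leftField_leftMC (a : E) (g : G) : leftField (leftMC E g a) g = a :=
  congrArg (fun A : E →L[ℝ] E ↦ A a) (tderiv_mul_left_comp_leftMC g)

theorem leftMC_one : leftMC E (1 : G) = ContinuousLinearMap.id ℝ E := by
  unfold leftMC
  simp only [inv_one, one_mul]
  exact tderiv_id

variable (E) in
/-- The left Maurer-Cartan form in the chart at `x₀`. -/
def chartMC (x₀ : G) (y : E) : E →L[ℝ] E :=
  (leftMC E ((extChartAt 𝓘(ℝ, E) x₀).symm y)).comp
    (tderiv 𝓘(ℝ, E) 𝓘(ℝ, E) (extChartAt 𝓘(ℝ, E) x₀).symm y)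

theorem chartMC_self (x : G) : chartMC E x (extChartAt 𝓘(ℝ, E) x x) = leftMC E x := by
  unfold chartMC
  rw [tderiv_extChartAt_symm_self, extChartAt_to_inv, ContinuousLinearMap.comp_id]

theorem isInvertible_chartMC {x₀ : G} {y : E} (hy : y ∈ (extChartAt 𝓘(ℝ, E) x₀).target) :
    (chartMC E x₀ y).IsInvertible :=
  (isInvertible_leftMC _).comp (isInvertible_tderiv_extChartAt_symm hy)

/-- The derivative of x ↦ g⁻¹ x at x = g depends smoothly on g in tangent coordinates. These use the
chart at x₀⁻¹ x₀ = 1 on the target side, and the image point g⁻¹ g is also 1, so that chart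
contributes the identity and only `chartMC` remains. -/
theorem contDiffAt_chartMC (x₀ : G) :
    ContDiffAt ℝ ∞ (chartMC E x₀) (extChartAt 𝓘(ℝ, E) x₀ x₀) := by
  have h0 : ContMDiffAt (𝓘(ℝ, E).prod 𝓘(ℝ, E)) 𝓘(ℝ, E) ∞
      (Function.uncurry fun g x : G ↦ g⁻¹ * x) (x₀, x₀) :=
    (contMDiff_fst.inv.mul contMDiff_snd).contMDiffAt
  have h1 := ContMDiffAt.mfderiv (m := ∞) (fun g x : G ↦ g⁻¹ * x) (fun g : G ↦ g) h0
    contMDiffAt_id (by simp)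
  have h2 : ContMDiffAt 𝓘(ℝ, E) 𝓘(ℝ, E) ∞ (extChartAt 𝓘(ℝ, E) x₀).symm
      (extChartAt 𝓘(ℝ, E) x₀ x₀) := contMDiffAt_extChartAt_symm' (mem_extChartAt_target x₀)
  rw [← extChartAt_to_inv (I := 𝓘(ℝ, E)) x₀] at h1
  have h3 := (h1.comp _ h2).contDiffAt
  rw [extChartAt_to_inv] at h3
  refine h3.congr_of_eventuallyEq ?_
  filter_upwards [(isOpen_extChartAt_target x₀).mem_nhds (mem_extChartAt_target x₀)] with y hy
  have hs : (extChartAt 𝓘(ℝ, E) x₀).symm y ∈ (extChartAt 𝓘(ℝ, E) x₀).source :=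
    (extChartAt 𝓘(ℝ, E) x₀).map_target hy
  rw [Function.comp_apply, inTangentCoordinates_eq_mfderiv_comp (by rwa [extChartAt_source] at hs)
    (by simp)]
  have e1 : mfderivWithin 𝓘(ℝ, E) 𝓘(ℝ, E) (extChartAt 𝓘(ℝ, E) x₀).symm (Set.range 𝓘(ℝ, E))
      (extChartAt 𝓘(ℝ, E) x₀ ((extChartAt 𝓘(ℝ, E) x₀).symm y)) =
      tderiv 𝓘(ℝ, E) 𝓘(ℝ, E) (extChartAt 𝓘(ℝ, E) x₀).symm y := by
    rw [ModelWithCorners.range_eq_univ, mfderivWithin_univ, (extChartAt 𝓘(ℝ, E) x₀).right_inv hy]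
    rfl
  have e2 : tderiv 𝓘(ℝ, E) 𝓘(ℝ, E) (extChartAt 𝓘(ℝ, E) (x₀⁻¹ * x₀))
    (((extChartAt 𝓘(ℝ, E) x₀).symm y)⁻¹ * (extChartAt 𝓘(ℝ, E) x₀).symm y) =
      ContinuousLinearMap.id ℝ E := by
    rw [inv_mul_cancel, inv_mul_cancel]
    exact tderiv_extChartAt_self 1
  change chartMC E x₀ y = (tderiv 𝓘(ℝ, E) 𝓘(ℝ, E) (extChartAt 𝓘(ℝ, E) (x₀⁻¹ * x₀))
    (((extChartAt 𝓘(ℝ, E) x₀).symm y)⁻¹ * (extChartAt 𝓘(ℝ, E) x₀).symm y)).comp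
      ((leftMC E ((extChartAt 𝓘(ℝ, E) x₀).symm y)).comp
      (mfderivWithin 𝓘(ℝ, E) 𝓘(ℝ, E) (extChartAt 𝓘(ℝ, E) x₀).symm (Set.range 𝓘(ℝ, E))
      (extChartAt 𝓘(ℝ, E) x₀ ((extChartAt 𝓘(ℝ, E) x₀).symm y)) : E →L[ℝ] E))
  rw [e1, e2, ContinuousLinearMap.id_comp]
  rfl

variable [FiniteDimensional ℝ E]

theorem lieGroup_minSmoothness : LieGroup 𝓘(ℝ, E) (minSmoothness ℝ 3) G := by
  refine LieGroup.of_le (n := ∞) ?_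
  rw [minSmoothness_of_isRCLikeNormedField]
  exact WithTop.coe_le_coe.2 le_top

attribute [local instance] lieGroup_minSmoothness

variable (E G) in
/-- The Lie bracket of `T_1 G` as a continuous bilinear map on the model space. -/
def lieCLM : E →L[ℝ] E →L[ℝ] E :=
  LinearMap.toContinuousBilinearMap (E := E) (F := E) (G := E) <|
    LinearMap.mk₂ ℝ (M := GroupLieAlgebra 𝓘(ℝ, E) G) (Nₗ := GroupLieAlgebra 𝓘(ℝ, E) G)
      (Pₗ := GroupLieAlgebra 𝓘(ℝ, E) G) (fun u v ↦ ⁅u, v⁆) add_lie smul_lie lie_add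
      (fun r a b ↦ lie_smul r a b)

theorem lieCLM_skew (u v : E) : lieCLM E G u v = - lieCLM E G v u :=
  (lie_skew (L := GroupLieAlgebra 𝓘(ℝ, E) G) u v).symm

theorem lieCLM_jacobi (u v w : E) : lieCLM E G u (lieCLM E G v w) + lieCLM E G v (lieCLM E G w u) +
    lieCLM E G w (lieCLM E G u v) = 0 :=
  lie_jacobi (L := GroupLieAlgebra 𝓘(ℝ, E) G) u v w

/-- This is the Maurer-Cartan equation at x. It comes from differentiating θ(F_u) = u for the
left-invariant fields F_u, whose brackets are the left-invariant fields of the Lie brackets. -/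
theorem fderiv_chartMC_antisymm (x : G) (a b : E) :
    fderiv ℝ (chartMC E x) (extChartAt 𝓘(ℝ, E) x x) a b -
      fderiv ℝ (chartMC E x) (extChartAt 𝓘(ℝ, E) x x) b a =
        - lieCLM E G (leftMC E x a) (leftMC E x b) := by
  set y₀ := extChartAt 𝓘(ℝ, E) x x with hy₀
  have hT := (isOpen_extChartAt_target (I := 𝓘(ℝ, E)) x).mem_nhds (mem_extChartAt_target x)
  -- The left-invariant field of u in the chart, written as the solution of θ(F u) = u.
  let F : E → E → E := fun u y ↦ (chartMC E x y).inverse u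
  have hFΛ : ∀ u, ∀ y ∈ (extChartAt 𝓘(ℝ, E) x).target, chartMC E x y (F u y) = u := by
    intro u y hy
    obtain ⟨e, he⟩ := isInvertible_chartMC (E := E) hy
    simp [F, ← he]
  have hΛ := contDiffAt_chartMC (E := E) x
  have hFd : ∀ u, DifferentiableAt ℝ (F u) y₀ := by
    intro u
    obtain ⟨e, he⟩ := isInvertible_chartMC (E := E) (mem_extChartAt_target (I := 𝓘(ℝ, E)) x)
    have h1 : ContDiffAt ℝ ∞ ContinuousLinearMap.inverse (chartMC E x y₀) := by
      rw [hy₀, ← he]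
      exact contDiffAt_map_inverse e
    exact ((h1.comp y₀ hΛ).clm_apply contDiffAt_const).differentiableAt (by simp)
  -- Product rule for the constant function y ↦ `chartMC E x y (F u y)`.
  have hd : ∀ u c, fderiv ℝ (chartMC E x) y₀ c (F u y₀) + leftMC E x (fderiv ℝ (F u) y₀ c) = 0 := by
    intro u c
    have h1 := (hΛ.differentiableAt (by simp)).hasFDerivAt.clm_apply (hFd u).hasFDerivAt
    have h2 : HasFDerivAt (fun y ↦ chartMC E x y (F u y)) (0 : E →L[ℝ] E) y₀ := by
      refine (hasFDerivAt_const u y₀).congr_of_eventuallyEq ?_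
      filter_upwards [hT] with y hy using hFΛ u y hy
    have h3 : chartMC E x y₀ (fderiv ℝ (F u) y₀ c) + fderiv ℝ (chartMC E x) y₀ c (F u y₀) = 0 :=
      congrArg (fun A : E →L[ℝ] E ↦ A c) (h1.unique h2)
    rwa [← chartMC_self x, add_comm]
  have hF0 : ∀ c, F (leftMC E x c) y₀ = c := by
    intro c
    obtain ⟨e, he⟩ := isInvertible_chartMC (E := E) (mem_extChartAt_target (I := 𝓘(ℝ, E)) x)
    have := chartMC_self (E := E) x
    rw [← he] at this
    simp only [F, hy₀, ← this, ← he]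
    simp
  -- The manifold bracket at x is computed in the chart at x, where the pulled back left-invariant
  -- fields are F u and F v and the derivative of the chart at x is the identity.
  have hbr : ∀ u v, leftMC E x (VectorField.lieBracket ℝ (F u) (F v) y₀) = lieCLM E G u v := by
    intro u v
    have hpb : ∀ u : E, VectorField.mpullbackWithin 𝓘(ℝ, E) 𝓘(ℝ, E) (extChartAt 𝓘(ℝ, E) x).symm
        (mulInvariantVectorField (I := 𝓘(ℝ, E)) (G := G) u) (Set.range 𝓘(ℝ, E)) =ᶠ[nhds y₀] F u := by
      intro u
      filter_upwards [hT] with y hy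
      have e1 : mfderivWithin 𝓘(ℝ, E) 𝓘(ℝ, E) (extChartAt 𝓘(ℝ, E) x).symm (Set.range 𝓘(ℝ, E)) y =
          tderiv 𝓘(ℝ, E) 𝓘(ℝ, E) (extChartAt 𝓘(ℝ, E) x).symm y := by
        rw [ModelWithCorners.range_eq_univ, mfderivWithin_univ]
        rfl
      change (mfderivWithin 𝓘(ℝ, E) 𝓘(ℝ, E) (extChartAt 𝓘(ℝ, E) x).symm (Set.range 𝓘(ℝ, E)) y
        : E →L[ℝ] E).inverse (leftField (E := E) u ((extChartAt 𝓘(ℝ, E) x).symm y)) =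
          (chartMC E x y).inverse u
      rw [e1]
      obtain ⟨e, he⟩ := isInvertible_chartMC (E := E) hy
      obtain ⟨e', he'⟩ := isInvertible_tderiv_extChartAt_symm hy
      have h4 : e (e'.symm (leftField u ((extChartAt 𝓘(ℝ, E) x).symm y))) = u := by
        have h5 : ∀ c, e c = leftMC E ((extChartAt 𝓘(ℝ, E) x).symm y) (e' c) := by
          intro c
          have h6 := congrArg (fun A : E →L[ℝ] E ↦ A c) he
          have h7 := congrArg (fun A : E →L[ℝ] E ↦ A c) he'
          exact h6.trans (congrArg (fun z : E ↦ leftMC E ((extChartAt 𝓘(ℝ, E) x).symm y) z) h7.symm)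
        rw [h5, e'.apply_symm_apply, leftMC_leftField]
      rw [← he, ← he', ContinuousLinearMap.inverse_equiv]
      have h8 : (e' : E →L[ℝ] E).inverse = e'.symm := ContinuousLinearMap.inverse_equiv e'
      exact (congrArg (fun A : E →L[ℝ] E ↦ A _) h8).trans (e.symm_apply_eq.2 h4.symm).symm
    have e2 : VectorField.mlieBracket 𝓘(ℝ, E) (mulInvariantVectorField (I := 𝓘(ℝ, E)) (G := G) u)
        (mulInvariantVectorField (I := 𝓘(ℝ, E)) (G := G) v) x =
          VectorField.lieBracket ℝ (F u) (F v) y₀ := by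
      have e3 : (mfderiv 𝓘(ℝ, E) 𝓘(ℝ, E) (extChartAt 𝓘(ℝ, E) x) x : E →L[ℝ] E).inverse =
          ContinuousLinearMap.id ℝ E := by
        have : (mfderiv 𝓘(ℝ, E) 𝓘(ℝ, E) (extChartAt 𝓘(ℝ, E) x) x : E →L[ℝ] E) =
          ContinuousLinearMap.id ℝ E := tderiv_extChartAt_self x
        rw [this]
        exact ContinuousLinearMap.inverse_id
      rw [← VectorField.mlieBracketWithin_univ, VectorField.mlieBracketWithin_apply]
      refine (congrArg (fun A : E →L[ℝ] E ↦ A _) e3).trans ?_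
      rw [Set.preimage_univ, Set.univ_inter]
      have e4 : Set.range 𝓘(ℝ, E) = Set.univ := ModelWithCorners.range_eq_univ _
      change VectorField.lieBracketWithin ℝ _ _ (Set.range 𝓘(ℝ, E)) y₀ = _
      conv_lhs => arg 4; rw [e4]
      refine (congrFun (VectorField.lieBracketWithin_univ (𝕜 := ℝ)) y₀).trans ?_
      exact (hpb u).lieBracket_vectorField_eq (hpb v)
    have e5 := congrFun (mulInvariantVector_mlieBracket (I := 𝓘(ℝ, E)) (G := G) u v) x
    rw [e2] at e5
    have e6 : leftField (lieCLM E G u v) x = VectorField.lieBracket ℝ (F u) (F v) y₀ := e5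
    rw [← e6, leftMC_leftField]
  have h1 := hbr (leftMC E x a) (leftMC E x b)
  have h2 := hd (leftMC E x b) a
  have h3 := hd (leftMC E x a) b
  rw [VectorField.lieBracket, hF0, hF0, map_sub] at h1
  rw [hF0] at h2 h3
  rw [← h1, eq_neg_of_add_eq_zero_left h2, eq_neg_of_add_eq_zero_left h3]
  abel

end LieGroups

/-! ### Smoothness and derivative of the adjoint representation -/

section AdjointCalculus

variable {E : Type*} [NormedAddCommGroup E] [NormedSpace ℝ E]
  {G : Type*} [TopologicalSpace G] [ChartedSpace E G] [Group G] [LieGroup 𝓘(ℝ, E) ∞ G]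

variable (E G) in
/-- The multiplication in the chart at the unit. -/
def chartMul (p : E × E) : E :=
  extChartAt 𝓘(ℝ, E) (1 : G) ((extChartAt 𝓘(ℝ, E) (1 : G)).symm p.1 *
    (extChartAt 𝓘(ℝ, E) (1 : G)).symm p.2)

variable (E G) in
/-- The unit in the chart at the unit. -/
def chartOne : E := extChartAt 𝓘(ℝ, E) (1 : G) 1

theorem symm_chartOne : (extChartAt 𝓘(ℝ, E) (1 : G)).symm (chartOne E G) = 1 := extChartAt_to_inv _

theorem chartOne_mem : chartOne E G ∈ (extChartAt 𝓘(ℝ, E) (1 : G)).target := mem_extChartAt_target _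

theorem contDiffAt_chartMul : ContDiffAt ℝ ∞ (chartMul E G) (chartOne E G, chartOne E G) := by
  have h1 : ContMDiffAt 𝓘(ℝ, E × E) 𝓘(ℝ, E) ∞
      (fun p : E × E ↦ (extChartAt 𝓘(ℝ, E) (1 : G)).symm p.1) (chartOne E G, chartOne E G) :=
    ContMDiffAt.comp (x := (chartOne E G, chartOne E G)) (contMDiffAt_extChartAt_symm' chartOne_mem)
      contDiff_fst.contMDiff.contMDiffAt
  have h2 : ContMDiffAt 𝓘(ℝ, E × E) 𝓘(ℝ, E) ∞
      (fun p : E × E ↦ (extChartAt 𝓘(ℝ, E) (1 : G)).symm p.2) (chartOne E G, chartOne E G) :=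
    ContMDiffAt.comp (x := (chartOne E G, chartOne E G)) (contMDiffAt_extChartAt_symm' chartOne_mem)
      contDiff_snd.contMDiff.contMDiffAt
  have h3 : ContMDiffAt 𝓘(ℝ, E) 𝓘(ℝ, E) ∞ (extChartAt 𝓘(ℝ, E) (1 : G))
      ((extChartAt 𝓘(ℝ, E) (1 : G)).symm (chartOne E G) *
        (extChartAt 𝓘(ℝ, E) (1 : G)).symm (chartOne E G)) := by
    rw [symm_chartOne, mul_one]
    exact contMDiffAt_extChartAt
  exact (h3.comp (chartOne E G, chartOne E G) (h1.mul h2)).contDiffAt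

theorem continuousAt_symm_chartOne :
    ContinuousAt (extChartAt 𝓘(ℝ, E) (1 : G)).symm (chartOne E G) :=
  continuousAt_extChartAt_symm (I := 𝓘(ℝ, E)) (1 : G)

theorem eventually_symm_mul_mem : ∀ᶠ p in nhds (chartOne E G, chartOne E G),
    p.1 ∈ (extChartAt 𝓘(ℝ, E) (1 : G)).target ∧ p.2 ∈ (extChartAt 𝓘(ℝ, E) (1 : G)).target ∧
    (extChartAt 𝓘(ℝ, E) (1 : G)).symm p.1 * (extChartAt 𝓘(ℝ, E) (1 : G)).symm p.2 ∈
      (extChartAt 𝓘(ℝ, E) (1 : G)).source ∧ DifferentiableAt ℝ (chartMul E G) p := by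
  have hT := (isOpen_extChartAt_target (I := 𝓘(ℝ, E)) (1 : G)).mem_nhds chartOne_mem
  have h1 := (continuousAt_fst (p := (chartOne E G, chartOne E G))).preimage_mem_nhds hT
  have h2 := (continuousAt_snd (p := (chartOne E G, chartOne E G))).preimage_mem_nhds hT
  have : IsTopologicalGroup G := topologicalGroup_of_lieGroup 𝓘(ℝ, E) ∞
  have h3 : ContinuousAt (fun p : E × E ↦ (extChartAt 𝓘(ℝ, E) (1 : G)).symm p.1 *
      (extChartAt 𝓘(ℝ, E) (1 : G)).symm p.2) (chartOne E G, chartOne E G) :=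
    (ContinuousAt.comp (x := (chartOne E G, chartOne E G)) continuousAt_symm_chartOne
      continuousAt_fst).mul (ContinuousAt.comp (x := (chartOne E G, chartOne E G))
        continuousAt_symm_chartOne continuousAt_snd)
  have h4 := h3.preimage_mem_nhds (t := (extChartAt 𝓘(ℝ, E) (1 : G)).source) (by
    simp only [symm_chartOne, mul_one]
    exact extChartAt_source_mem_nhds _)
  have h5 := ((contDiffAt_chartMul (E := E) (G := G)).of_le (m := 1) (by simp)).eventually (by simp)
  filter_upwards [h1, h2, h4, h5] with p a b c d
  exact ⟨a, b, c, d.differentiableAt (by simp)⟩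

/-- The vector ∂₁μ(e, y) v is the right-invariant field of v at g; left translation back to 1 turns
z ↦ z g into the conjugation z ↦ g⁻¹ z g. -/
theorem chartMC_fderiv_chartMul_left : ∀ᶠ y in nhds (chartOne E G), ∀ v,
    chartMC E (1 : G) y (fderiv ℝ (chartMul E G) (chartOne E G, y) (v, 0)) =
      adE E ((extChartAt 𝓘(ℝ, E) (1 : G)).symm y)⁻¹ v := by
  have hc : ContinuousAt (fun y : E ↦ (chartOne E G, y)) (chartOne E G) := by fun_prop
  filter_upwards [hc.eventually eventually_symm_mul_mem.eventually_nhds] with y hy v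
  set ψ := extChartAt 𝓘(ℝ, E) (1 : G) with hψ
  set g := ψ.symm y with hg
  obtain ⟨-, hyt, -, hd⟩ := hy.self_of_nhds
  have hμ : chartMul E G (chartOne E G, y) = y := by
    change ψ (ψ.symm (chartOne E G) * ψ.symm y) = y
    rw [hψ, symm_chartOne, one_mul]
    exact ψ.right_inv hyt
  have h1 : HasFDerivAt (fun z : E ↦ chartMul E G (z, y))
      ((fderiv ℝ (chartMul E G) (chartOne E G, y)).comp (ContinuousLinearMap.inl ℝ E E))
      (chartOne E G) :=
    HasFDerivAt.comp (f := fun z : E ↦ (z, y)) (chartOne E G) hd.hasFDerivAt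
      (hasFDerivAt_prodMk_left _ _)
  have hs : MDifferentiableAt 𝓘(ℝ, E) 𝓘(ℝ, E) ψ.symm (chartMul E G (chartOne E G, y)) := by
    rw [hμ]; exact mdifferentiableAt_extChartAt_symm' hyt
  have hs1 : MDifferentiableAt 𝓘(ℝ, E) 𝓘(ℝ, E) ψ.symm (chartOne E G) :=
    mdifferentiableAt_extChartAt_symm' chartOne_mem
  have e1 : tderiv 𝓘(ℝ, E) 𝓘(ℝ, E) (fun z ↦ g⁻¹ * ψ.symm (chartMul E G (z, y))) (chartOne E G) =
      (chartMC E (1 : G) y).comp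
        ((fderiv ℝ (chartMul E G) (chartOne E G, y)).comp (ContinuousLinearMap.inl ℝ E E)) := by
    have hA := tderiv_comp (K := 𝓘(ℝ, E)) (mdifferentiableAt_mul_left' g⁻¹ _)
      (MDifferentiableAt.comp (f := fun z : E ↦ chartMul E G (z, y)) (chartOne E G) hs
        h1.hasMFDerivAt.mdifferentiableAt)
    have hB := tderiv_comp (K := 𝓘(ℝ, E)) (f := fun z : E ↦ chartMul E G (z, y)) hs h1.hasMFDerivAt.mdifferentiableAt
    refine hA.trans ?_
    simp only [Function.comp_apply]
    rw [hμ]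
    refine (congrArg (ContinuousLinearMap.comp _) hB).trans ?_
    rw [hμ, tderiv_eq_fderiv, h1.fderiv]
    rfl
  have e2 : tderiv 𝓘(ℝ, E) 𝓘(ℝ, E) (fun z ↦ g⁻¹ * ψ.symm (chartMul E G (z, y))) (chartOne E G) =
      adE E g⁻¹ := by
    have hev : (fun z ↦ g⁻¹ * ψ.symm (chartMul E G (z, y))) =ᶠ[nhds (chartOne E G)]
        fun z ↦ g⁻¹ * ψ.symm z * g⁻¹⁻¹ := by
      have hc2 : ContinuousAt (fun z : E ↦ (z, y)) (chartOne E G) := by fun_prop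
      filter_upwards [hc2.eventually hy] with z hz
      have : ψ.symm (chartMul E G (z, y)) = ψ.symm z * g := ψ.left_inv hz.2.2.1
      rw [this, inv_inv, mul_assoc]
    rw [tderiv_congr hev, tderiv_comp (mdifferentiableAt_conj g⁻¹ _) hs1, hψ, symm_chartOne,
      chartOne, tderiv_extChartAt_symm_self, ContinuousLinearMap.comp_id]
    rfl
  exact congrArg (fun A : E →L[ℝ] E ↦ A v) (e1.symm.trans e2)

/-- Here ∂₂μ(y, e) v is the left-invariant field of v, on which θ is constant. -/
theorem chartMC_fderiv_chartMul_right : ∀ᶠ y in nhds (chartOne E G), ∀ v,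
    chartMC E (1 : G) y (fderiv ℝ (chartMul E G) (y, chartOne E G) (0, v)) = v := by
  have hc : ContinuousAt (fun y : E ↦ (y, chartOne E G)) (chartOne E G) := by fun_prop
  filter_upwards [hc.eventually eventually_symm_mul_mem.eventually_nhds] with y hy v
  set ψ := extChartAt 𝓘(ℝ, E) (1 : G) with hψ
  set g := ψ.symm y with hg
  obtain ⟨hyt, -, -, hd⟩ := hy.self_of_nhds
  have hμ : chartMul E G (y, chartOne E G) = y := by
    change ψ (ψ.symm y * ψ.symm (chartOne E G)) = y
    rw [hψ, symm_chartOne, mul_one]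
    exact ψ.right_inv hyt
  have h1 : HasFDerivAt (fun z : E ↦ chartMul E G (y, z))
      ((fderiv ℝ (chartMul E G) (y, chartOne E G)).comp (ContinuousLinearMap.inr ℝ E E))
      (chartOne E G) :=
    HasFDerivAt.comp (f := fun z : E ↦ (y, z)) (chartOne E G) hd.hasFDerivAt
      (hasFDerivAt_prodMk_right _ _)
  have hs : MDifferentiableAt 𝓘(ℝ, E) 𝓘(ℝ, E) ψ.symm (chartMul E G (y, chartOne E G)) := by
    rw [hμ]; exact mdifferentiableAt_extChartAt_symm' hyt
  have e1 : tderiv 𝓘(ℝ, E) 𝓘(ℝ, E) (fun z ↦ g⁻¹ * ψ.symm (chartMul E G (y, z))) (chartOne E G) =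
      (chartMC E (1 : G) y).comp
        ((fderiv ℝ (chartMul E G) (y, chartOne E G)).comp (ContinuousLinearMap.inr ℝ E E)) := by
    have hA := tderiv_comp (K := 𝓘(ℝ, E)) (mdifferentiableAt_mul_left' g⁻¹ _)
      (MDifferentiableAt.comp (f := fun z : E ↦ chartMul E G (y, z)) (chartOne E G) hs
        h1.hasMFDerivAt.mdifferentiableAt)
    have hB := tderiv_comp (K := 𝓘(ℝ, E)) (f := fun z : E ↦ chartMul E G (y, z)) hs h1.hasMFDerivAt.mdifferentiableAt
    refine hA.trans ?_
    simp only [Function.comp_apply]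
    rw [hμ]
    refine (congrArg (ContinuousLinearMap.comp _) hB).trans ?_
    rw [hμ, tderiv_eq_fderiv, h1.fderiv]
    rfl
  have e2 : tderiv 𝓘(ℝ, E) 𝓘(ℝ, E) (fun z ↦ g⁻¹ * ψ.symm (chartMul E G (y, z))) (chartOne E G) =
      ContinuousLinearMap.id ℝ E := by
    have hev : (fun z ↦ g⁻¹ * ψ.symm (chartMul E G (y, z))) =ᶠ[nhds (chartOne E G)] ψ.symm := by
      have hc2 : ContinuousAt (fun z : E ↦ (y, z)) (chartOne E G) := by fun_prop
      filter_upwards [hc2.eventually hy] with z hz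
      have : ψ.symm (chartMul E G (y, z)) = g * ψ.symm z := ψ.left_inv hz.2.2.1
      rw [this, inv_mul_cancel_left]
    rw [tderiv_congr hev, hψ, chartOne, tderiv_extChartAt_symm_self]
  exact congrArg (fun A : E →L[ℝ] E ↦ A v) (e1.symm.trans e2)

variable [FiniteDimensional ℝ E]

/-- Writing Ad_{g⁻¹} v as θ(∂₁μ(e, y) v) gives smoothness. For the derivative, compare with the
constant θ(∂₂μ(y, e) u): both derivatives at e contain the same mixed second derivative of μ, by
symmetry, so subtracting leaves the antisymmetrised derivative of θ, which the Maurer-Cartan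
equation evaluates. -/
theorem hasFDerivAt_adE_inv_chart (v : E) :
    ContDiffAt ℝ ∞ (fun y ↦ adE E ((extChartAt 𝓘(ℝ, E) (1 : G)).symm y)⁻¹ v) (chartOne E G) ∧
    HasFDerivAt (fun y ↦ adE E ((extChartAt 𝓘(ℝ, E) (1 : G)).symm y)⁻¹ v)
      (- (lieCLM E G).flip v) (chartOne E G) := by
  set e := chartOne E G with he
  have hΛ : ContDiffAt ℝ ∞ (chartMC E (1 : G)) e := contDiffAt_chartMC 1
  have hμ : ContDiffAt ℝ ∞ (fderiv ℝ (chartMul E G)) (e, e) :=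
    contDiffAt_chartMul.fderiv_right (m := ∞) (by simp)
  have hl : ∀ v, ContDiffAt ℝ ∞ (fun y ↦ fderiv ℝ (chartMul E G) (e, y) (v, 0)) e := fun v ↦
    (ContDiffAt.comp e hμ (contDiffAt_const.prodMk contDiffAt_id)).clm_apply contDiffAt_const
  have hP : ContDiffAt ℝ ∞ (fun y ↦ adE E ((extChartAt 𝓘(ℝ, E) (1 : G)).symm y)⁻¹ v) e := by
    refine (hΛ.clm_apply (hl v)).congr_of_eventuallyEq ?_
    filter_upwards [chartMC_fderiv_chartMul_left (E := E) (G := G)] with y hy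
    exact (hy v).symm
  refine ⟨hP, ?_⟩
  have hΛ1 : chartMC E (1 : G) e = ContinuousLinearMap.id ℝ E := by
    rw [he, chartOne, chartMC_self, leftMC_one]
  have hl0 : ∀ v, fderiv ℝ (chartMul E G) (e, e) (v, 0) = v := by
    intro v
    have := (chartMC_fderiv_chartMul_left (E := E) (G := G)).self_of_nhds v
    rwa [← he, hΛ1, he, symm_chartOne, inv_one, adE_one] at this
  have hr0 : ∀ v, fderiv ℝ (chartMul E G) (e, e) (0, v) = v := by
    intro v
    have := (chartMC_fderiv_chartMul_right (E := E) (G := G)).self_of_nhds v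
    rwa [← he, hΛ1] at this
  have hΛd := (hΛ.differentiableAt (by simp)).hasFDerivAt
  have hμd := (hμ.differentiableAt (by simp)).hasFDerivAt
  have hsymm : ∀ a b, fderiv ℝ (fderiv ℝ (chartMul E G)) (e, e) a b =
      fderiv ℝ (fderiv ℝ (chartMul E G)) (e, e) b a :=
    (contDiffAt_chartMul.isSymmSndFDerivAt minSmoothness_two_le_infty)
  have hd1 : HasFDerivAt (fun y ↦ fderiv ℝ (chartMul E G) (e, y) (v, 0))
      (((fderiv ℝ (fderiv ℝ (chartMul E G)) (e, e)).comp (ContinuousLinearMap.inr ℝ E E)).flip (v, 0))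
      e := by
    have h1 := (HasFDerivAt.comp (f := fun y : E ↦ (e, y)) e hμd
      (hasFDerivAt_prodMk_right e e)).clm_apply (hasFDerivAt_const (v, (0 : E)) e)
    refine h1.congr_fderiv ?_
    ext u
    simp
  have hd2 : ∀ u, HasFDerivAt (fun y ↦ fderiv ℝ (chartMul E G) (y, e) (0, u))
      (((fderiv ℝ (fderiv ℝ (chartMul E G)) (e, e)).comp (ContinuousLinearMap.inl ℝ E E)).flip (0, u))
      e := by
    intro u
    have h1 := (HasFDerivAt.comp (f := fun y : E ↦ (y, e)) e hμd
      (hasFDerivAt_prodMk_left e e)).clm_apply (hasFDerivAt_const ((0 : E), u) e)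
    refine h1.congr_fderiv ?_
    ext u
    simp
  have hD := hΛd.clm_apply hd1
  have hD' := hD.congr_of_eventuallyEq (f₁ := fun y ↦ adE E ((extChartAt 𝓘(ℝ, E) (1 : G)).symm y)⁻¹ v)
    (by
      filter_upwards [chartMC_fderiv_chartMul_left (E := E) (G := G)] with y hy
      exact (hy v).symm)
  refine hD'.congr_fderiv ?_
  ext u
  -- The constant θ(∂₂μ(y, e) u) = u has zero derivative; it is then evaluated in the direction v.
  have hR := (hΛd.clm_apply (hd2 u)).unique ((hasFDerivAt_const u e).congr_of_eventuallyEq (by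
    filter_upwards [chartMC_fderiv_chartMul_right (E := E) (G := G)] with y hy
    exact hy u))
  have hR' := congrArg (fun A : E →L[ℝ] E ↦ A v) hR
  have hMC := fderiv_chartMC_antisymm (E := E) (1 : G) u v
  rw [leftMC_one] at hMC
  change fderiv ℝ (chartMC E (1 : G)) e u v - fderiv ℝ (chartMC E (1 : G)) e v u =
    - lieCLM E G u v at hMC
  change chartMC E (1 : G) e (fderiv ℝ (fderiv ℝ (chartMul E G)) (e, e) (v, 0) (0, u)) +
    fderiv ℝ (chartMC E (1 : G)) e v (fderiv ℝ (chartMul E G) (e, e) (0, u)) = 0 at hR'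
  change chartMC E (1 : G) e (fderiv ℝ (fderiv ℝ (chartMul E G)) (e, e) (0, u) (v, 0)) +
    fderiv ℝ (chartMC E (1 : G)) e u (fderiv ℝ (chartMul E G) (e, e) (v, 0)) = - lieCLM E G u v
  rw [hr0] at hR'
  rw [hl0, hsymm, ← hMC, eq_neg_of_add_eq_zero_left hR']
  abel

theorem hasMFDerivAt_adE_inv_one (v : E) :
    HasMFDerivAt 𝓘(ℝ, E) 𝓘(ℝ, E) (fun g : G ↦ adE E g⁻¹ v) 1 (- (lieCLM E G).flip v) := by
  have h1 := (hasFDerivAt_adE_inv_chart (G := G) v).2.hasMFDerivAt.comp (1 : G)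
    (mdifferentiableAt_extChartAt' (mem_extChartAt_source (I := 𝓘(ℝ, E)) (1 : G))).hasMFDerivAt
  have h2 : (- (lieCLM E G).flip v).comp (tderiv 𝓘(ℝ, E) 𝓘(ℝ, E) (extChartAt 𝓘(ℝ, E) (1 : G)) 1) =
    - (lieCLM E G).flip v := by rw [tderiv_extChartAt_self, ContinuousLinearMap.comp_id]
  refine (hasMFDerivAt_of_eq h1 h2).congr_of_eventuallyEq ?_
  filter_upwards [extChartAt_source_mem_nhds (I := 𝓘(ℝ, E)) (1 : G)] with z hz
  simp only [Function.comp_apply, (extChartAt 𝓘(ℝ, E) (1 : G)).left_inv hz]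

theorem adE_inv_eq (x g : G) (v : E) : adE E g⁻¹ v = adE E (x⁻¹ * g)⁻¹ (adE E x⁻¹ v) := by
  have := adE_mul (E := E) (x⁻¹ * g)⁻¹ x⁻¹
  rw [mul_inv_rev, inv_inv, mul_inv_cancel_right] at this
  rw [this, mul_inv_rev, inv_inv]
  rfl

/-- Left translation reduces to the unit: Ad_{g⁻¹} v = Ad_{(x⁻¹g)⁻¹}(Ad_{x⁻¹} v). -/
theorem hasMFDerivAt_adE_inv (v : E) (x : G) :
    HasMFDerivAt 𝓘(ℝ, E) 𝓘(ℝ, E) (fun g : G ↦ adE E g⁻¹ v) x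
      (- ((lieCLM E G).flip (adE E x⁻¹ v)).comp (leftMC E x)) := by
  have h1 : HasMFDerivAt 𝓘(ℝ, E) 𝓘(ℝ, E) (fun g : G ↦ adE E g⁻¹ (adE E x⁻¹ v)) (x⁻¹ * x)
      (- (lieCLM E G).flip (adE E x⁻¹ v)) := by
    rw [inv_mul_cancel]; exact hasMFDerivAt_adE_inv_one _
  have h2 := h1.comp x (mdifferentiableAt_mul_left' x⁻¹ x).hasMFDerivAt
  refine hasMFDerivAt_of_eq (h2.congr_of_eventuallyEq (.of_forall fun g ↦ adE_inv_eq x g v)) ?_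
  exact ContinuousLinearMap.neg_comp _ _

theorem contMDiff_adE_inv_apply (v : E) :
    ContMDiff 𝓘(ℝ, E) 𝓘(ℝ, E) ∞ (fun g : G ↦ adE E g⁻¹ v) := by
  intro x
  have h1 : ∀ v : E, ContMDiffAt 𝓘(ℝ, E) 𝓘(ℝ, E) ∞ (fun g : G ↦ adE E g⁻¹ v) 1 := by
    intro v
    have h2 := (hasFDerivAt_adE_inv_chart (G := G) v).1.contMDiffAt.comp (1 : G)
      (contMDiffAt_extChartAt (I := 𝓘(ℝ, E)) (n := ∞))
    refine h2.congr_of_eventuallyEq ?_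
    filter_upwards [extChartAt_source_mem_nhds (I := 𝓘(ℝ, E)) (1 : G)] with z hz
    simp only [Function.comp_apply, (extChartAt 𝓘(ℝ, E) (1 : G)).left_inv hz]
  have h3 : ContMDiffAt 𝓘(ℝ, E) 𝓘(ℝ, E) ∞ (fun g : G ↦ adE E g⁻¹ (adE E x⁻¹ v)) (x⁻¹ * x) := by
    rw [inv_mul_cancel]; exact h1 _
  exact (h3.comp x (contMDiff_mul_left' x⁻¹).contMDiffAt).congr_of_eventuallyEq
    (.of_forall fun g ↦ adE_inv_eq x g v)

theorem contMDiff_adE_inv : ContMDiff 𝓘(ℝ, E) 𝓘(ℝ, E →L[ℝ] E) ∞ (fun g : G ↦ adE E g⁻¹) :=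
  fun _ ↦ contMDiffAt_clm_of_apply fun v ↦ (contMDiff_adE_inv_apply v).contMDiffAt

/-- The adjoint representation acts by automorphisms of the Lie algebra. -/
theorem adE_lieCLM (k : G) (a b : E) :
    adE E k (lieCLM E G a b) = lieCLM E G (adE E k a) (adE E k b) := by
  have hc : k * 1 * k⁻¹ = 1 := by simp
  have h1 : HasMFDerivAt 𝓘(ℝ, E) 𝓘(ℝ, E) (fun g : G ↦ adE E g⁻¹ (adE E k b)) (k * 1 * k⁻¹)
      (- (lieCLM E G).flip (adE E k b)) := by rw [hc]; exact hasMFDerivAt_adE_inv_one _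
  have h2 := HasMFDerivAt.tderiv_eq (h1.comp (1 : G) (mdifferentiableAt_conj k 1).hasMFDerivAt)
  have h3 := HasMFDerivAt.tderiv_eq
    (((adE E k).hasFDerivAt (x := adE E (1 : G)⁻¹ b)).hasMFDerivAt.comp (1 : G)
      (hasMFDerivAt_adE_inv_one (G := G) b))
  -- Ad_{(kgk⁻¹)⁻¹} Ad_k b = Ad_k Ad_{g⁻¹} b. Differentiating both sides in g at 1 gives the claim.
  have h4 : (fun g : G ↦ adE E g⁻¹ (adE E k b)) ∘ (fun g ↦ k * g * k⁻¹) =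
      (adE E k) ∘ fun g : G ↦ adE E g⁻¹ b := by
    funext g
    have e1 : (k * g * k⁻¹)⁻¹ * k = k * g⁻¹ := by group
    have e2 := adE_mul (E := E) (k * g * k⁻¹)⁻¹ k
    rw [e1, adE_mul] at e2
    exact (congrArg (fun A : E →L[ℝ] E ↦ A b) e2).symm
  rw [h4] at h2
  have h5 := congrArg (fun A : E →L[ℝ] E ↦ A a) (h3.symm.trans h2)
  change adE E k (- lieCLM E G a b) = - lieCLM E G (adE E k a) (adE E k b) at h5
  rw [map_neg] at h5
  exact neg_injective h5

/-- Split the derivative of the product into partial derivatives: moving h is a left translation,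
and moving g becomes, after translation back to 1, conjugation by h⁻¹. -/
theorem leftMC_tderiv_mul (g h : G) (a b : E) :
    leftMC E (g * h) (tderiv (𝓘(ℝ, E).prod 𝓘(ℝ, E)) 𝓘(ℝ, E) (fun p : G × G ↦ p.1 * p.2) (g, h) (a, b))
      = adE E h⁻¹ (leftMC E g a) + leftMC E h b := by
  have hm : MDifferentiableAt (𝓘(ℝ, E).prod 𝓘(ℝ, E)) 𝓘(ℝ, E) (fun p : G × G ↦ p.1 * p.2) (g, h) :=
    (contMDiff_mul 𝓘(ℝ, E) ∞).mdifferentiable (by simp) _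
  have h1 : tderiv (𝓘(ℝ, E).prod 𝓘(ℝ, E)) 𝓘(ℝ, E) (fun p : G × G ↦ p.1 * p.2) (g, h) (a, b) =
      tderiv 𝓘(ℝ, E) 𝓘(ℝ, E) (fun z : G ↦ z * h) g a + tderiv 𝓘(ℝ, E) 𝓘(ℝ, E) (fun z : G ↦ g * z) h b :=
    mfderiv_prod_eq_add_apply hm
  have h2 := tderiv_comp (K := 𝓘(ℝ, E)) (mdifferentiableAt_mul_left' (g * h)⁻¹ (g * h))
    (f := fun z : G ↦ g * z) (mdifferentiableAt_mul_left' g h)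
  have h3 := tderiv_comp (K := 𝓘(ℝ, E)) (f := fun z : G ↦ z * h)
    (mdifferentiableAt_mul_left' (g * h)⁻¹ (g * h))
    (mdifferentiableAt_mul_right' h g)
  have e2 : (fun z : G ↦ (g * h)⁻¹ * (g * z)) = fun z ↦ h⁻¹ * z := by funext z; group
  have e3 : (fun z : G ↦ (g * h)⁻¹ * (z * h)) = fun z ↦ h⁻¹ * (g⁻¹ * z) * h⁻¹⁻¹ := by
    funext z; group
  rw [e2] at h2
  have h4 := tderiv_comp (K := 𝓘(ℝ, E)) (mdifferentiableAt_conj h⁻¹ (g⁻¹ * g))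
    (mdifferentiableAt_mul_left' g⁻¹ g)
  rw [← e3, h3, inv_mul_cancel] at h4
  rw [h1, map_add]
  exact congrArg₂ (· + ·) (congrArg (fun A : E →L[ℝ] E ↦ A a) h4)
    (congrArg (fun A : E →L[ℝ] E ↦ A b) h2.symm)

end AdjointCalculus

/-! ### Product rules and bilinear form of λ -/

section Bilinear

variable {EM : Type*} [NormedAddCommGroup EM] [NormedSpace ℝ EM]
  {HM : Type*} [TopologicalSpace HM] {I : ModelWithCorners ℝ EM HM}
  {M : Type*} [TopologicalSpace M] [ChartedSpace HM M]
  {V : Type*} [NormedAddCommGroup V] [NormedSpace ℝ V]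
  {W : Type*} [NormedAddCommGroup W] [NormedSpace ℝ W]
  {X : Type*} [NormedAddCommGroup X] [NormedSpace ℝ X]

theorem hasMFDerivAt_bilinear (B : V →L[ℝ] W →L[ℝ] X) {f : M → V} {g : M → W} {x : M}
    {f' : EM →L[ℝ] V} {g' : EM →L[ℝ] W} (hf : HasMFDerivAt I 𝓘(ℝ, V) f x f')
    (hg : HasMFDerivAt I 𝓘(ℝ, W) g x g') :
    HasMFDerivAt I 𝓘(ℝ, X) (fun z ↦ B (f z) (g z)) x
      ((B (f x)).comp g' + (B.flip (g x)).comp f') := by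
  have h1 : HasMFDerivAt I 𝓘(ℝ, V × W) (fun z ↦ (f z, g z)) x (f'.prod g') :=
    ⟨hf.1.prodMk hg.1, hf.2.prodMk hg.2⟩
  have h2 := HasMFDerivAt.comp (f := fun z ↦ (f z, g z)) x
    (B.isBoundedBilinearMap.hasFDerivAt (f x, g x)).hasMFDerivAt h1
  refine hasMFDerivAt_of_eq h2 ?_
  ext v
  rfl

theorem hasMFDerivAt_clm_comp (A : V →L[ℝ] X) {f : M → V} {x : M}
    {f' : EM →L[ℝ] V} (hf : HasMFDerivAt I 𝓘(ℝ, V) f x f') :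
    HasMFDerivAt I 𝓘(ℝ, X) (fun z ↦ A (f z)) x (A.comp f') :=
  A.hasFDerivAt.hasMFDerivAt.comp x hf

/-- An alternating 2-form as a bilinear map. -/
def altBilin [FiniteDimensional ℝ V] (lam : V [⋀^Fin 2]→L[ℝ] ℝ) : V →L[ℝ] V →L[ℝ] ℝ :=
  have hs : ∀ u v, lam ![u, v] = - lam ![v, u] := fun u v ↦ by
    refine Eq.trans ?_ (lam.toAlternatingMap.map_swap ![v, u] (show (0 : Fin 2) ≠ 1 by decide))
    change _ = lam _
    congr 1
    ext i
    fin_cases i <;> rfl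
  have ha : ∀ u u' v, lam ![u + u', v] = lam ![u, v] + lam ![u', v] := fun u u' v ↦
    lam.toAlternatingMap.map_vecCons_add ![v] u u'
  have hc : ∀ (c : ℝ) (u v : V), lam ![c • u, v] = c • lam ![u, v] := fun c u v ↦
    lam.toAlternatingMap.map_vecCons_smul ![v] c u
  LinearMap.toContinuousBilinearMap <|
    LinearMap.mk₂ ℝ (fun u v ↦ lam ![u, v]) ha hc
      (fun u v v' ↦ by rw [hs, ha, hs v u, hs v' u]; ring)
      (fun c u v ↦ by rw [hs, hc, hs v u]; simp)

theorem altBilin_apply [FiniteDimensional ℝ V] (lam : V [⋀^Fin 2]→L[ℝ] ℝ) (u v : V) :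
    altBilin lam u v = lam ![u, v] := rfl

theorem altBilin_skew [FiniteDimensional ℝ V] (lam : V [⋀^Fin 2]→L[ℝ] ℝ) (u v : V) :
    altBilin lam u v = - altBilin lam v u := by
  refine Eq.trans ?_ (lam.toAlternatingMap.map_swap ![v, u] (show (0 : Fin 2) ≠ 1 by decide))
  change lam ![u, v] = lam _
  congr 1
  ext i
  fin_cases i <;> rfl

/-- A linear form as an alternating form of degree one. -/
def ofCovector (α : V →L[ℝ] ℝ) : V [⋀^Fin 1]→L[ℝ] ℝ :=
  ContinuousAlternatingMap.ofSubsingleton ℝ V ℝ (0 : Fin 1) α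

end Bilinear

/-! ### Integration of the Lie algebra cocycle to a group cocycle -/

section Cocycle

variable {E : Type*} [NormedAddCommGroup E] [NormedSpace ℝ E] [FiniteDimensional ℝ E]
  {G : Type*} [TopologicalSpace G] [ChartedSpace E G] [Group G] [LieGroup 𝓘(ℝ, E) ∞ G]

theorem IsLieTwoCocycle.altBilin_add {lam : E [⋀^Fin 2]→L[ℝ] ℝ}
    (h : IsLieTwoCocycle (G := G) lam) (u v w : E) :
    altBilin lam u (lieCLM E G v w) + altBilin lam v (lieCLM E G w u) +
      altBilin lam w (lieCLM E G u v) = 0 := h u v w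

theorem leftMC_comp_tderiv_mul (g h : G) :
    (leftMC E (g * h)).comp (tderiv 𝓘(ℝ, E) 𝓘(ℝ, E) (fun x : G ↦ g * x) h) = leftMC E h := by
  have h1 := tderiv_comp (K := 𝓘(ℝ, E)) (mdifferentiableAt_mul_left' (E := E) (g * h)⁻¹ (g * h))
    (mdifferentiableAt_mul_left' g h)
  simp only [mul_inv_rev, mul_assoc, inv_mul_cancel_left] at h1
  unfold leftMC
  rw [h1, mul_inv_rev]
  simp only [mul_assoc]

theorem contDiffAt_adE_inv_symm (x : G) (w : E) :
    ContDiffAt ℝ ∞ (fun y ↦ adE E ((extChartAt 𝓘(ℝ, E) x).symm y)⁻¹ w)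
      (extChartAt 𝓘(ℝ, E) x x) :=
  ((contMDiff_adE_inv_apply w).contMDiffAt.comp _
    (contMDiffAt_extChartAt_symm' (mem_extChartAt_target x))).contDiffAt

theorem hasFDerivAt_adE_inv_symm (x : G) (w : E) :
    HasFDerivAt (fun y ↦ adE E ((extChartAt 𝓘(ℝ, E) x).symm y)⁻¹ w)
      (- ((lieCLM E G).flip (adE E x⁻¹ w)).comp (leftMC E x)) (extChartAt 𝓘(ℝ, E) x x) := by
  have h1 : HasMFDerivAt 𝓘(ℝ, E) 𝓘(ℝ, E) (fun g : G ↦ adE E g⁻¹ w)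
      ((extChartAt 𝓘(ℝ, E) x).symm (extChartAt 𝓘(ℝ, E) x x))
      (- ((lieCLM E G).flip (adE E x⁻¹ w)).comp (leftMC E x)) := by
    rw [extChartAt_to_inv]
    exact hasMFDerivAt_adE_inv w x
  have h2 := h1.comp _ (hasMFDerivAt_tderiv
    (mdifferentiableAt_extChartAt_symm' (I := 𝓘(ℝ, E)) (mem_extChartAt_target x)))
  have h3 := hasMFDerivAt_of_eq h2 (g' := - ((lieCLM E G).flip (adE E x⁻¹ w)).comp (leftMC E x)) (by
    rw [tderiv_extChartAt_symm_self]; rfl)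
  exact h3.hasFDerivAt

/-- The 1-form `a ↦ λ(g⁻¹ a, Ad_{g⁻¹} w)` on `G`. -/
def adjointForm (lam : E [⋀^Fin 2]→L[ℝ] ℝ) (w : E) : DiffForm 𝓘(ℝ, E) G 1 := fun g ↦
  (ofCovector (((altBilin lam).flip (adE E g⁻¹ w)).comp (leftMC E g)) : E [⋀^Fin 1]→L[ℝ] ℝ)

theorem inChart_adjointForm (lam : E [⋀^Fin 2]→L[ℝ] ℝ) (w : E) (x : G) (y : E) (v : Fin 1 → E) :
    inChart 𝓘(ℝ, E) (adjointForm lam w) x y v =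
      altBilin lam (chartMC E x y (v 0)) (adE E ((extChartAt 𝓘(ℝ, E) x).symm y)⁻¹ w) :=
  inChart_apply' (adjointForm lam w) x y v

theorem isSmoothForm_adjointForm (lam : E [⋀^Fin 2]→L[ℝ] ℝ) (w : E) :
    IsSmoothForm 𝓘(ℝ, E) (adjointForm (G := G) lam w) :=
  isSmoothForm_iff.2 fun x ↦ contDiffAt_alternating_of_apply fun v ↦ by
    simp only [inChart_adjointForm]
    exact (contDiffAt_const.clm_apply ((contDiffAt_chartMC x).clm_apply contDiffAt_const)).clm_apply
      (contDiffAt_adE_inv_symm x w)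

/-- With a, b left-trivialised and u = Ad_{x⁻¹} w, the Maurer-Cartan equation contributes -λ([a, b],
u) and the derivative of Ad contributes the terms λ(·, [·, u]); their sum is the cocycle identity
for a, b, u. -/
theorem extDer_adjointForm {lam : E [⋀^Fin 2]→L[ℝ] ℝ} (h : IsLieTwoCocycle (G := G) lam) (w : E) :
    extDer 𝓘(ℝ, E) (adjointForm (G := G) lam w) = 0 := by
  funext x
  rw [extDer_eq_extDeriv]
  have key : extDeriv (inChart 𝓘(ℝ, E) (adjointForm (G := G) lam w) x) (extChartAt 𝓘(ℝ, E) x x) = 0 := by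
    ext v
    have hv : v = ![v 0, v 1] := by ext i; fin_cases i <;> rfl
    rw [hv, extDeriv_one_apply
      ((isSmoothForm_iff.1 (isSmoothForm_adjointForm lam w) x).differentiableAt (by simp))]
    have hd : ∀ a b : E, fderiv ℝ (fun y ↦ inChart 𝓘(ℝ, E) (adjointForm (G := G) lam w) x y ![b])
        (extChartAt 𝓘(ℝ, E) x x) a =
        - altBilin lam (leftMC E x b) (lieCLM E G (leftMC E x a) (adE E x⁻¹ w)) +
        altBilin lam (fderiv ℝ (chartMC E x) (extChartAt 𝓘(ℝ, E) x x) a b) (adE E x⁻¹ w) := by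
      intro a b
      have h1 := (((contDiffAt_chartMC x).differentiableAt (by simp)).hasFDerivAt.clm_apply
        (hasFDerivAt_const b _)).hasMFDerivAt
      have h2 : HasFDerivAt (fun z ↦ altBilin lam (chartMC E x z b)
          (adE E ((extChartAt 𝓘(ℝ, E) x).symm z)⁻¹ w)) (_ : E →L[ℝ] ℝ) (extChartAt 𝓘(ℝ, E) x x) :=
        (hasMFDerivAt_bilinear (altBilin lam) h1 (HasFDerivAt.hasMFDerivAt
        (hasFDerivAt_adE_inv_symm x w))).hasFDerivAt
      simp only [inChart_adjointForm]
      refine (congrArg (fun A : E →L[ℝ] ℝ ↦ A a) h2.fderiv).trans ?_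
      change altBilin lam (chartMC E x (extChartAt 𝓘(ℝ, E) x x) b)
          (- lieCLM E G (leftMC E x a) (adE E x⁻¹ w)) + altBilin lam
          (chartMC E x (extChartAt 𝓘(ℝ, E) x x) 0 +
            fderiv ℝ (chartMC E x) (extChartAt 𝓘(ℝ, E) x x) a b)
          (adE E ((extChartAt 𝓘(ℝ, E) x).symm (extChartAt 𝓘(ℝ, E) x x))⁻¹ w) = _
      rw [chartMC_self, extChartAt_to_inv, map_zero, zero_add, map_neg]
    rw [hd, hd]
    have h3 := fderiv_chartMC_antisymm (E := E) x (v 0) (v 1)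
    have h4 := congrArg (fun z ↦ altBilin lam z (adE E x⁻¹ w)) h3
    have h5 := h.altBilin_add (leftMC E x (v 0)) (leftMC E x (v 1)) (adE E x⁻¹ w)
    simp only [map_sub, map_neg, _root_.sub_apply, _root_.neg_apply] at h4
    rw [altBilin_skew lam (lieCLM E G _ _)] at h4
    rw [lieCLM_skew (adE E x⁻¹ w) (leftMC E x (v 0)), map_neg] at h5
    change _ = (0 : ℝ)
    linarith
  rw [key]
  rfl

theorem CoadjointCocycle.map_one (χ : CoadjointCocycle E G) : χ.toFun 1 = 0 := by
  have h := χ.map_mul 1 1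
  rw [coAd_one, mul_one] at h
  exact left_eq_add.mp h

/-- From χ(x) = Ad^*_{g⁻¹} χ(g⁻¹x) + χ(g), the derivative at g is determined by the one at 1. The
result is the covector of `adjointForm lam w` at g. -/
theorem CoadjointCocycle.Integrates.hasMFDerivAt {χ : CoadjointCocycle E G}
    {lam : E [⋀^Fin 2]→L[ℝ] ℝ} (h : χ.Integrates lam) (g : G) (w : E) :
    HasMFDerivAt 𝓘(ℝ, E) 𝓘(ℝ, ℝ) (fun x ↦ χ.toFun x w) g
      (((altBilin lam).flip (adE E g⁻¹ w)).comp (leftMC E g)) := by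
  have h1 : HasMFDerivAt 𝓘(ℝ, E) 𝓘(ℝ, StrongDual ℝ E) χ.toFun (g⁻¹ * g)
      (tderiv 𝓘(ℝ, E) 𝓘(ℝ, StrongDual ℝ E) χ.toFun 1) := by
    rw [inv_mul_cancel]
    exact hasMFDerivAt_tderiv (χ.smooth.mdifferentiable (by simp) 1)
  have h2 := h1.comp g (hasMFDerivAt_tderiv (mdifferentiableAt_mul_left' (E := E) g⁻¹ g))
  have h3 := (hasMFDerivAt_clm_comp
    (ContinuousLinearMap.apply ℝ ℝ (adE E g⁻¹ w)) h2).add (hasMFDerivAt_const (χ.toFun g w) g)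
  have h4 : (fun x ↦ χ.toFun x w) = (fun x ↦ ContinuousLinearMap.apply ℝ ℝ (adE E g⁻¹ w)
      ((χ.toFun ∘ fun x ↦ g⁻¹ * x) x)) + fun _ ↦ χ.toFun g w := by
    funext x
    have := χ.map_mul g (g⁻¹ * x)
    rw [mul_inv_cancel_left] at this
    rw [this]
    rfl
  rw [h4]
  refine hasMFDerivAt_of_eq h3 ?_
  ext a
  have h5 := h (leftMC E g a) (adE E g⁻¹ w)
  exact (add_zero _).trans h5

theorem CoadjointCocycle.Integrates.unique [PreconnectedSpace G] {χ χ' : CoadjointCocycle E G}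
    {lam : E [⋀^Fin 2]→L[ℝ] ℝ} (h : χ.Integrates lam) (h' : χ'.Integrates lam) : χ = χ' := by
  have key : χ.toFun = χ'.toFun := by
    funext g
    ext w
    have h1 : ∀ x, HasMFDerivAt 𝓘(ℝ, E) 𝓘(ℝ, ℝ) (fun x ↦ χ.toFun x w - χ'.toFun x w) x
        (0 : E →L[ℝ] ℝ) := fun x ↦
      hasMFDerivAt_of_eq ((h.hasMFDerivAt x w).sub (h'.hasMFDerivAt x w)) (sub_self _)
    have h2 := eq_of_mfderiv_eq_zero h1 g 1
    rw [χ.map_one, χ'.map_one, sub_self] at h2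
    exact sub_eq_zero.1 h2
  cases χ
  cases χ'
  simpa using key

/-- The component of χ along w is the primitive, vanishing at 1, of `adjointForm lam w`. All
algebraic identities are checked by comparing derivatives, G being connected. -/
theorem exists_integrates [SimplyConnectedSpace G] {lam : E [⋀^Fin 2]→L[ℝ] ℝ}
    (hlam : IsLieTwoCocycle (G := G) lam) : ∃ χ : CoadjointCocycle E G, χ.Integrates lam := by
  have : LocallyPathConnectedSpace G := ChartedSpace.locallyPathConnectedSpace E G
  choose f hf1 hfs hfd using fun w ↦
    exists_primitive (I := 𝓘(ℝ, E)) (isSmoothForm_adjointForm (G := G) lam w) (extDer_adjointForm hlam w) (1 : G)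
  have hfd' : ∀ w (x : G), HasMFDerivAt 𝓘(ℝ, E) 𝓘(ℝ, ℝ) (f w) x
      (((altBilin lam).flip (adE E x⁻¹ w)).comp (leftMC E x)) := fun w x ↦
    hasMFDerivAt_of_eq (hfd w x) (by ext a; exact covectorField_apply _ _ _)
  have hadd : ∀ w w' g, f (w + w') g = f w g + f w' g := by
    intro w w' g
    have h1 : ∀ x, HasMFDerivAt 𝓘(ℝ, E) 𝓘(ℝ, ℝ) (fun x ↦ f (w + w') x - (f w x + f w' x)) x
        (0 : E →L[ℝ] ℝ) := fun x ↦
      hasMFDerivAt_of_eq ((hfd' (w + w') x).sub ((hfd' w x).add (hfd' w' x))) (by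
        ext a
        change altBilin lam (leftMC E x a) (adE E x⁻¹ (w + w')) -
          (altBilin lam (leftMC E x a) (adE E x⁻¹ w) + altBilin lam (leftMC E x a) (adE E x⁻¹ w')) = 0
        rw [map_add, map_add, sub_self])
    have h2 := eq_of_mfderiv_eq_zero h1 g 1
    simp only [hf1, add_zero, sub_self] at h2
    exact sub_eq_zero.1 h2
  have hsmul : ∀ (c : ℝ) w g, f (c • w) g = c * f w g := by
    intro c w g
    have h1 : ∀ x, HasMFDerivAt 𝓘(ℝ, E) 𝓘(ℝ, ℝ)
        (fun x ↦ f (c • w) x - (ContinuousLinearMap.lsmul ℝ ℝ c : ℝ →L[ℝ] ℝ) (f w x)) x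
        (0 : E →L[ℝ] ℝ) := fun x ↦
      hasMFDerivAt_of_eq ((hfd' (c • w) x).sub
        (hasMFDerivAt_clm_comp (ContinuousLinearMap.lsmul ℝ ℝ c : ℝ →L[ℝ] ℝ) (hfd' w x))) (by
        ext a
        change altBilin lam (leftMC E x a) (adE E x⁻¹ (c • w)) -
          c • (altBilin lam (leftMC E x a) (adE E x⁻¹ w)) = 0
        rw [map_smul, map_smul, sub_self])
    have h2 := eq_of_mfderiv_eq_zero h1 g 1
    simp only [hf1, map_zero, sub_self] at h2
    exact sub_eq_zero.1 h2
  let F : G → StrongDual ℝ E := fun g ↦ LinearMap.toContinuousLinearMap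
    { toFun := fun w ↦ f w g
      map_add' := fun w w' ↦ hadd w w' g
      map_smul' := fun c w ↦ hsmul c w g }
  have hFs : ContMDiff 𝓘(ℝ, E) 𝓘(ℝ, StrongDual ℝ E) ∞ F := fun x ↦
    contMDiffAt_clm_of_apply fun w ↦ (hfs w).contMDiffAt
  refine ⟨⟨F, hFs, fun g h ↦ ?_⟩, fun u v ↦ ?_⟩
  · ext w
    change f w (g * h) = f (adE E g⁻¹ w) h + f w g
    -- With g fixed, both functions of x have the same differential: θ is left-invariant, and
    -- Ad_{(gx)⁻¹} w = Ad_{x⁻¹}(Ad_{g⁻¹} w). Their difference at x = 1 is f w g.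
    have h1 : ∀ x, HasMFDerivAt 𝓘(ℝ, E) 𝓘(ℝ, ℝ)
        (fun x ↦ f w (g * x) - f (adE E g⁻¹ w) x) x (0 : E →L[ℝ] ℝ) := fun x ↦
      hasMFDerivAt_of_eq (((hfd' w (g * x)).comp x (hasMFDerivAt_tderiv
        (mdifferentiableAt_mul_left' (E := E) g x))).sub (hfd' (adE E g⁻¹ w) x)) (by
        ext a
        change altBilin lam (leftMC E (g * x) (tderiv 𝓘(ℝ, E) 𝓘(ℝ, E) (fun x : G ↦ g * x) x a))
          (adE E (g * x)⁻¹ w) - altBilin lam (leftMC E x a) (adE E x⁻¹ (adE E g⁻¹ w)) = 0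
        have h3 := congrArg (fun A : E →L[ℝ] E ↦ A a) (leftMC_comp_tderiv_mul (E := E) g x)
        have h4 := adE_mul (E := E) x⁻¹ g⁻¹
        rw [mul_inv_rev, h4]
        exact sub_eq_zero.2 (congrArg (fun z ↦ altBilin lam z (adE E x⁻¹ (adE E g⁻¹ w))) h3))
    have h2 := eq_of_mfderiv_eq_zero h1 h 1
    simp only [hf1, mul_one, sub_zero] at h2
    linarith
  · change E at u v
    have h1 : HasMFDerivAt 𝓘(ℝ, E) 𝓘(ℝ, ℝ) (fun x ↦ F x v) 1
        ((ContinuousLinearMap.apply ℝ ℝ v).comp (tderiv 𝓘(ℝ, E) 𝓘(ℝ, StrongDual ℝ E) F 1)) :=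
      hasMFDerivAt_clm_comp (ContinuousLinearMap.apply ℝ ℝ v)
        (hasMFDerivAt_tderiv (hFs.mdifferentiable (by simp) 1))
    have h2 := congrArg (fun A : E →L[ℝ] ℝ ↦ A u)
      ((HasMFDerivAt.tderiv_eq h1).symm.trans (HasMFDerivAt.tderiv_eq (hfd' v 1)))
    refine h2.trans ?_
    change altBilin lam (leftMC E (1 : G) u) (adE E (1 : G)⁻¹ v) = altBilin lam u v
    rw [leftMC_one, inv_one, adE_one]
    rfl

/-- The function λ(Ad_{x⁻¹} u, Ad_{x⁻¹} v) + ⟨χ(x), [u, v]⟩ has zero derivative, by the cocycle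
identity for θ b, Ad_{x⁻¹} u, Ad_{x⁻¹} v, and equals λ(u, v) at 1. -/
theorem CoadjointCocycle.Integrates.altBilin_adE [PreconnectedSpace G] {χ : CoadjointCocycle E G}
    {lam : E [⋀^Fin 2]→L[ℝ] ℝ} (h : χ.Integrates lam) (hlam : IsLieTwoCocycle (G := G) lam)
    (g : G) (u v : E) : altBilin lam (adE E g⁻¹ u) (adE E g⁻¹ v) =
      altBilin lam u v - χ.toFun g (lieCLM E G u v) := by
  have h1 : ∀ x, HasMFDerivAt 𝓘(ℝ, E) 𝓘(ℝ, ℝ) (fun x : G ↦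
      altBilin lam (adE E x⁻¹ u) (adE E x⁻¹ v) + χ.toFun x (lieCLM E G u v)) x (0 : E →L[ℝ] ℝ) := by
    intro x
    refine hasMFDerivAt_of_eq ((hasMFDerivAt_bilinear (altBilin lam) (hasMFDerivAt_adE_inv u x)
      (hasMFDerivAt_adE_inv v x)).add (h.hasMFDerivAt x (lieCLM E G u v))) ?_
    ext b
    change (altBilin lam (adE E x⁻¹ u) (- lieCLM E G (leftMC E x b) (adE E x⁻¹ v)) +
      altBilin lam (- lieCLM E G (leftMC E x b) (adE E x⁻¹ u)) (adE E x⁻¹ v)) +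
      altBilin lam (leftMC E x b) (adE E x⁻¹ (lieCLM E G u v)) = 0
    rw [adE_lieCLM, ← lieCLM_skew, altBilin_skew lam (- _), map_neg, neg_neg]
    linarith [hlam.altBilin_add (leftMC E x b) (adE E x⁻¹ u) (adE E x⁻¹ v)]
  have h2 := eq_of_mfderiv_eq_zero h1 g 1
  rw [χ.map_one, inv_one, adE_one] at h2
  have h3 : altBilin lam (adE E g⁻¹ u) (adE E g⁻¹ v) + χ.toFun g (lieCLM E G u v) =
    altBilin lam u v + 0 := h2
  linarith

end Cocycle

/-! ### Closedness of the left-invariant 2-form -/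

section LeftInvariant

variable {E : Type*} [NormedAddCommGroup E] [NormedSpace ℝ E] [FiniteDimensional ℝ E]
  {G : Type*} [TopologicalSpace G] [ChartedSpace E G] [Group G] [LieGroup 𝓘(ℝ, E) ∞ G]

theorem inChart_leftInvariantForm (lam : E [⋀^Fin 2]→L[ℝ] ℝ) (x : G) (y : E) :
    inChart 𝓘(ℝ, E) (leftInvariantForm (G := G) lam) x y =
      lam.compContinuousLinearMap (chartMC E x y) := by
  ext v
  exact inChart_apply' (leftInvariantForm (G := G) lam) x y v

theorem isSmoothForm_leftInvariantForm (lam : E [⋀^Fin 2]→L[ℝ] ℝ) :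
    IsSmoothForm 𝓘(ℝ, E) (leftInvariantForm (G := G) lam) :=
  isSmoothForm_iff.2 fun x ↦ by
    have h := contDiffAt_alternating_comp (contDiffAt_const (c := lam)) (contDiffAt_chartMC (E := E) x)
    exact h.congr_of_eventuallyEq (.of_forall fun y ↦ inChart_leftInvariantForm lam x y)

/-- In the chart the form is λ(θ·, θ·). Its exterior derivative involves only antisymmetrised
derivatives of θ, so the Maurer-Cartan equation turns it into the cyclic sum of the cocycle
condition. -/
theorem extDer_leftInvariantForm {lam : E [⋀^Fin 2]→L[ℝ] ℝ} (h : IsLieTwoCocycle (G := G) lam) :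
    extDer 𝓘(ℝ, E) (leftInvariantForm (G := G) lam) = 0 := by
  funext x
  rw [extDer_eq_extDeriv]
  have key : extDeriv (inChart 𝓘(ℝ, E) (leftInvariantForm (G := G) lam) x)
      (extChartAt 𝓘(ℝ, E) x x) = 0 := by
    ext v
    have hv : v = ![v 0, v 1, v 2] := by ext i; fin_cases i <;> rfl
    rw [hv, extDeriv_two_apply
      ((isSmoothForm_iff.1 (isSmoothForm_leftInvariantForm lam) x).differentiableAt (by simp))]
    set D := fderiv ℝ (chartMC E x) (extChartAt 𝓘(ℝ, E) x x) with hD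
    have hd : ∀ a b c : E, fderiv ℝ
        (fun y ↦ inChart 𝓘(ℝ, E) (leftInvariantForm (G := G) lam) x y ![b, c])
        (extChartAt 𝓘(ℝ, E) x x) a =
        altBilin lam (leftMC E x b) (D a c) + altBilin lam (D a b) (leftMC E x c) := by
      intro a b c
      have h1 : ∀ b, HasFDerivAt (fun y ↦ chartMC E x y b) _ _ := fun b ↦
        (((contDiffAt_chartMC x).differentiableAt (by simp)).hasFDerivAt.clm_apply
        (hasFDerivAt_const b _))
      have h2 : HasFDerivAt (fun z ↦ altBilin lam (chartMC E x z b) (chartMC E x z c))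
          (_ : E →L[ℝ] ℝ) (extChartAt 𝓘(ℝ, E) x x) :=
        (hasMFDerivAt_bilinear (altBilin lam) (h1 b).hasMFDerivAt (h1 c).hasMFDerivAt).hasFDerivAt
      have h3 : (fun y ↦ inChart 𝓘(ℝ, E) (leftInvariantForm (G := G) lam) x y ![b, c]) =
          fun z ↦ altBilin lam (chartMC E x z b) (chartMC E x z c) := by
        funext y
        rw [inChart_leftInvariantForm, altBilin_apply]
        change lam _ = _
        congr 1
        ext i
        fin_cases i <;> rfl
      rw [h3]
      refine (congrArg (fun A : E →L[ℝ] ℝ ↦ A a) h2.fderiv).trans ?_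
      change altBilin lam (chartMC E x (extChartAt 𝓘(ℝ, E) x x) b)
          (chartMC E x (extChartAt 𝓘(ℝ, E) x x) 0 + D a c) + altBilin lam
          (chartMC E x (extChartAt 𝓘(ℝ, E) x x) 0 + D a b)
          (chartMC E x (extChartAt 𝓘(ℝ, E) x x) c) = _
      rw [chartMC_self, map_zero, zero_add, zero_add]
    rw [hd, hd, hd]
    have hL : ∀ a b c : E, altBilin lam (leftMC E x c) (D a b) - altBilin lam (leftMC E x c) (D b a) =
        - altBilin lam (leftMC E x c) (lieCLM E G (leftMC E x a) (leftMC E x b)) := by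
      intro a b c
      rw [← map_sub, fderiv_chartMC_antisymm (E := E) x a b, map_neg]
    have h1 := hL (v 0) (v 1) (v 2)
    have h2 := hL (v 1) (v 2) (v 0)
    have h3 := hL (v 2) (v 0) (v 1)
    have h4 := h.altBilin_add (leftMC E x (v 0)) (leftMC E x (v 1)) (leftMC E x (v 2))
    rw [altBilin_skew lam (D _ _), altBilin_skew lam (D _ _), altBilin_skew lam (D _ _)]
    change _ = (0 : ℝ)
    linarith
  rw [key]
  rfl

end LeftInvariant

/-! ### The Liouville form and the magnetic 2-form in the left trivialization -/

section Cotangent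

variable {E : Type*} [NormedAddCommGroup E] [NormedSpace ℝ E] [FiniteDimensional ℝ E]
  {G : Type*} [TopologicalSpace G] [ChartedSpace E G] [Group G] [LieGroup 𝓘(ℝ, E) ∞ G]

instance isManifold_cotangentBundle : IsManifold (modelProd E) ∞ (CotangentBundle E G) := inferInstance

/-- These are the classical coordinates (q, p) of the cotangent bundle, in which the Liouville form
becomes p dq. -/
theorem cotangent_inCoordinates (g₀ : G) (α : CotangentBundle E G)
    (h : α.proj ∈ (extChartAt 𝓘(ℝ, E) g₀).source) (a : E) :
    (trivializationAt (E →L[ℝ] ℝ)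
      (fun g : G ↦ TangentSpace 𝓘(ℝ, E) g →L[ℝ] Bundle.Trivial G ℝ g) g₀ α).2 a =
      (α.snd : E →L[ℝ] ℝ) (tderiv 𝓘(ℝ, E) 𝓘(ℝ, E) (extChartAt 𝓘(ℝ, E) g₀).symm
        (extChartAt 𝓘(ℝ, E) g₀ α.proj) a) := by
  rw [hom_trivializationAt_apply]
  rw [extChartAt_source] at h
  have h1 := TangentBundle.symmL_trivializationAt (I := 𝓘(ℝ, E)) h
  rw [ModelWithCorners.range_eq_univ, mfderivWithin_univ] at h1
  have h2 := Bundle.Trivial.continuousLinearMapAt_trivialization ℝ G ℝ α.proj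
  exact (congrArg (fun A : ℝ →L[ℝ] ℝ ↦ A ((α.snd : E →L[ℝ] ℝ) _)) h2).trans
    (congrArg (fun A : E →L[ℝ] E ↦ (α.snd : E →L[ℝ] ℝ) (A a)) h1)

variable (E G) in
theorem contMDiff_cotangent_proj : ContMDiff (modelProd E) 𝓘(ℝ, E) ∞
    (fun α : CotangentBundle E G ↦ α.proj) := Bundle.contMDiff_proj _

variable (E G) in
theorem contMDiff_leftTrivialization :
    ContMDiff (modelProd E) (modelProd E) ∞ (leftTrivialization E G) := by
  intro p
  rw [Bundle.contMDiffAt_totalSpace]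
  refine ⟨contMDiffAt_fst, contMDiffAt_clm_of_apply fun a ↦ ?_⟩
  have h1 : ContMDiffAt (modelProd E) 𝓘(ℝ, E →L[ℝ] E) ∞
      (fun q : G × StrongDual ℝ E ↦ chartMC E p.1 (extChartAt 𝓘(ℝ, E) p.1 q.1)) p :=
    ContMDiffAt.comp (g := fun g : G ↦ chartMC E p.1 (extChartAt 𝓘(ℝ, E) p.1 g)) p
      ((contDiffAt_chartMC p.1).contMDiffAt.comp p.1 contMDiffAt_extChartAt) contMDiffAt_fst
  have h2 : ContMDiffAt (modelProd E) 𝓘(ℝ, ℝ) ∞ (fun q : G × StrongDual ℝ E ↦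
      q.2 (chartMC E p.1 (extChartAt 𝓘(ℝ, E) p.1 q.1) a)) p :=
    contMDiffAt_snd.clm_apply (h1.clm_apply contMDiffAt_const)
  refine h2.congr_of_eventuallyEq ?_
  filter_upwards [continuousAt_fst.preimage_mem_nhds (extChartAt_source_mem_nhds (I := 𝓘(ℝ, E)) p.1)]
    with q hq
  refine (cotangent_inCoordinates p.1 (leftTrivialization E G q) hq a).trans ?_
  change q.2 (leftMC E q.1 _) = q.2 (leftMC E ((extChartAt 𝓘(ℝ, E) p.1).symm
    (extChartAt 𝓘(ℝ, E) p.1 q.1)) _)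
  rw [(extChartAt 𝓘(ℝ, E) p.1).left_inv hq]
  rfl

theorem inChart_liouville (α₀ : CotangentBundle E G) {z : E × StrongDual ℝ E}
    (hz : z ∈ (extChartAt (modelProd E) α₀).target) (v : Fin 1 → E × StrongDual ℝ E) :
    inChart (modelProd E) (liouville E G) α₀ z v = z.2 (v 0).1 := by
  set α := (extChartAt (modelProd E) α₀).symm z with hα
  set e := trivializationAt (E →L[ℝ] ℝ)
    (fun g : G ↦ TangentSpace 𝓘(ℝ, E) g →L[ℝ] Bundle.Trivial G ℝ g) α₀.proj with he
  have hT : ∀ z ∈ (extChartAt (modelProd E) α₀).target,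
      z.1 ∈ (extChartAt 𝓘(ℝ, E) α₀.proj).target ∧
      ((extChartAt 𝓘(ℝ, E) α₀.proj).symm z.1, z.2) ∈ e.target := by
    intro z hz
    rw [FiberBundle.extChartAt_target] at hz
    exact ⟨hz.1.1, e.mem_target.2 hz.1.2⟩
  have hsymm : ∀ z, (extChartAt (modelProd E) α₀).symm z =
      e.toOpenPartialHomeomorph.symm ((extChartAt 𝓘(ℝ, E) α₀.proj).symm z.1, z.2) := by
    intro z
    rw [FiberBundle.extChartAt]
    rfl
  have hproj : ∀ z ∈ (extChartAt (modelProd E) α₀).target,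
      ((extChartAt (modelProd E) α₀).symm z).proj = (extChartAt 𝓘(ℝ, E) α₀.proj).symm z.1 := by
    intro z hz
    rw [hsymm]
    exact e.proj_symm_apply (hT z hz).2
  have h1 : tderiv 𝓘(ℝ, E × StrongDual ℝ E) 𝓘(ℝ, E)
      (fun z ↦ ((extChartAt (modelProd E) α₀).symm z).proj) z =
      (tderiv 𝓘(ℝ, E) 𝓘(ℝ, E) (extChartAt 𝓘(ℝ, E) α₀.proj).symm z.1).comp
        (ContinuousLinearMap.fst ℝ E (StrongDual ℝ E)) := by
    refine HasMFDerivAt.tderiv_eq (HasMFDerivAt.congr_of_eventuallyEq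
      ((hasMFDerivAt_tderiv (mdifferentiableAt_extChartAt_symm' (hT z hz).1)).comp z
        hasFDerivAt_fst.hasMFDerivAt) ?_)
    filter_upwards [(isOpen_extChartAt_target α₀).mem_nhds hz] with y hy using hproj y hy
  have h2 := tderiv_comp (K := 𝓘(ℝ, E)) (f := (extChartAt (modelProd E) α₀).symm)
    ((contMDiff_cotangent_proj E G).mdifferentiable (by simp) α)
    (mdifferentiableAt_extChartAt_symm' hz)
  have h3 : α.proj ∈ (extChartAt 𝓘(ℝ, E) α₀.proj).source := by
    rw [hα, hproj z hz]
    exact (extChartAt 𝓘(ℝ, E) α₀.proj).map_target (hT z hz).1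
  have h4 : extChartAt 𝓘(ℝ, E) α₀.proj α.proj = z.1 := by
    rw [hα, hproj z hz]
    exact (extChartAt 𝓘(ℝ, E) α₀.proj).right_inv (hT z hz).1
  have h5 := cotangent_inCoordinates α₀.proj α h3 (v 0).1
  have h6 : e α = ((extChartAt 𝓘(ℝ, E) α₀.proj).symm z.1, z.2) := by
    rw [hα, hsymm]
    exact e.apply_symm_apply (hT z hz).2
  rw [h4, ← he, h6] at h5
  refine (inChart_apply' (liouville E G) α₀ z v).trans (Eq.trans ?_ h5.symm)
  exact congrArg (fun A : E × StrongDual ℝ E →L[ℝ] E ↦ (α.snd : E →L[ℝ] ℝ) (A (v 0)))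
    (h2.symm.trans h1)

theorem isSmoothForm_liouville : IsSmoothForm (modelProd E) (liouville E G) :=
  isSmoothForm_iff.2 fun α ↦ contDiffAt_alternating_of_apply fun v ↦ by
    refine ContDiffAt.congr_of_eventuallyEq (f := fun z : E × StrongDual ℝ E ↦ z.2 (v 0).1) ?_ ?_
    · exact contDiffAt_snd.clm_apply contDiffAt_const
    · filter_upwards [(isOpen_extChartAt_target α).mem_nhds (mem_extChartAt_target α)] with z hz
      exact inChart_liouville α hz v

/-- The Liouville form in the left trivialization. -/
def trivLiouville : DiffForm (modelProd E) (G × StrongDual ℝ E) 1 := fun p ↦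
  (ofCovector ((p.2.comp (leftMC E p.1)).comp (ContinuousLinearMap.fst ℝ E (StrongDual ℝ E))) :
    (E × StrongDual ℝ E) [⋀^Fin 1]→L[ℝ] ℝ)

/-- The trivialization covers the identity of G, so the bundle projection composed with it is the
first projection. -/
theorem pullback_liouville : pullback (modelProd E) (modelProd E) (leftTrivialization E G)
    (liouville E G) = trivLiouville := by
  funext p
  refine ContinuousAlternatingMap.ext fun v ↦ ?_
  have h1 := tderiv_comp (K := 𝓘(ℝ, E)) (f := leftTrivialization E G)
    ((contMDiff_cotangent_proj E G).mdifferentiable (by simp) (leftTrivialization E G p))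
    ((contMDiff_leftTrivialization E G).mdifferentiable (by simp) p)
  have h2 : tderiv (modelProd E) 𝓘(ℝ, E) (fun p ↦ (leftTrivialization E G p).proj) p =
      ContinuousLinearMap.fst ℝ E (StrongDual ℝ E) := mfderiv_fst
  exact congrArg (fun A : E × StrongDual ℝ E →L[ℝ] E ↦ p.2 (leftMC E p.1 (A (v 0))))
    (h1.symm.trans h2)

theorem isSmoothForm_trivLiouville : IsSmoothForm (modelProd E) (trivLiouville (E := E) (G := G)) := by
  rw [← pullback_liouville]
  exact isSmoothForm_iff.2 fun p ↦ smoothFormAt_pullback (contMDiff_leftTrivialization E G p)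
    (isSmoothForm_iff.1 isSmoothForm_liouville _)

variable (E G) in
theorem contMDiff_fst_dual : ContMDiff (modelProd E) 𝓘(ℝ, E) ∞
    (fun p : G × StrongDual ℝ E ↦ p.1) := contMDiff_fst

/-- Naturality of d moves the pullback inside -dθ_L. The outer sign of ω_Γ cancels the sign of the
canonical form but not that of the magnetic term. -/
theorem omegaGamma_eq (lam : E [⋀^Fin 2]→L[ℝ] ℝ) : omegaGamma (G := G) lam =
    extDer (modelProd E) trivLiouville - pullback (modelProd E) 𝓘(ℝ, E)
      (fun p : G × StrongDual ℝ E ↦ p.1) (leftInvariantForm lam) := by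
  have h1 : extDer (modelProd E) (trivLiouville (E := E) (G := G)) = pullback (modelProd E)
      (modelProd E) (leftTrivialization E G) (extDer (modelProd E) (liouville E G)) := by
    rw [← pullback_liouville]
    funext p
    exact extDer_pullback_apply (contMDiff_leftTrivialization E G p)
      (isSmoothForm_iff.1 isSmoothForm_liouville _)
  have h2 : pullback (modelProd E) 𝓘(ℝ, E)
      (fun p : G × StrongDual ℝ E ↦ p.1) (leftInvariantForm lam) =
      pullback (modelProd E) (modelProd E) (leftTrivialization E G) (pullback (modelProd E) 𝓘(ℝ, E)
        (fun β : CotangentBundle E G ↦ β.proj) (leftInvariantForm lam)) :=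
    (pullback_pullback (contMDiff_leftTrivialization E G) (contMDiff_cotangent_proj E G)
      (leftInvariantForm lam)).symm
  rw [h1, h2]
  funext p
  refine ContinuousAlternatingMap.ext fun v ↦ ?_
  have hneg : ∀ a b : ℝ, -(-a + b) = a - b := fun a b ↦ by ring
  exact hneg ((extDer (modelProd E) (liouville E G) (leftTrivialization E G p) :
      (E × StrongDual ℝ E) [⋀^Fin 2]→L[ℝ] ℝ)
      (fun i ↦ tderiv (modelProd E) (modelProd E) (leftTrivialization E G) p (v i)))
    ((pullback (modelProd E) 𝓘(ℝ, E) (fun β : CotangentBundle E G ↦ β.proj) (leftInvariantForm lam)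
      (leftTrivialization E G p) : (E × StrongDual ℝ E) [⋀^Fin 2]→L[ℝ] ℝ)
      (fun i ↦ tderiv (modelProd E) (modelProd E) (leftTrivialization E G) p (v i)))

theorem isSmoothForm_omegaGamma (lam : E [⋀^Fin 2]→L[ℝ] ℝ) :
    IsSmoothForm (modelProd E) (omegaGamma (G := G) lam) := by
  rw [omegaGamma_eq]
  exact isSmoothForm_trivLiouville.extDer.sub (isSmoothForm_iff.2 fun p ↦
    smoothFormAt_pullback (contMDiff_fst_dual E G p)
      (isSmoothForm_iff.1 (isSmoothForm_leftInvariantForm lam) _))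

theorem extDer_omegaGamma {lam : E [⋀^Fin 2]→L[ℝ] ℝ} (h : IsLieTwoCocycle (G := G) lam) :
    extDer (modelProd E) (omegaGamma (G := G) lam) = 0 := by
  have h1 : extDer (modelProd E) (pullback (modelProd E) 𝓘(ℝ, E)
      (fun p : G × StrongDual ℝ E ↦ p.1) (leftInvariantForm (G := G) lam)) = 0 := by
    funext p
    rw [extDer_pullback_apply (contMDiff_fst_dual E G p)
      (isSmoothForm_iff.1 (isSmoothForm_leftInvariantForm lam) _), extDer_leftInvariantForm h]
    rfl
  rw [omegaGamma_eq, extDer_sub isSmoothForm_trivLiouville.extDer (isSmoothForm_iff.2 fun p ↦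
    smoothFormAt_pullback (contMDiff_fst_dual E G p)
      (isSmoothForm_iff.1 (isSmoothForm_leftInvariantForm lam) _)), h1,
    extDer_extDer isSmoothForm_trivLiouville, sub_zero]

theorem inChart_trivLiouville (p : G × StrongDual ℝ E) {z : E × StrongDual ℝ E}
    (hz : z.1 ∈ (extChartAt 𝓘(ℝ, E) p.1).target) (v : Fin 1 → E × StrongDual ℝ E) :
    inChart (modelProd E) trivLiouville p z v = z.2 (chartMC E p.1 z.1 (v 0).1) := by
  have h1 : HasMFDerivAt 𝓘(ℝ, E × StrongDual ℝ E) 𝓘(ℝ, E)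
      (fun z : E × StrongDual ℝ E ↦ (extChartAt 𝓘(ℝ, E) p.1).symm z.1) z
      ((tderiv 𝓘(ℝ, E) 𝓘(ℝ, E) (extChartAt 𝓘(ℝ, E) p.1).symm z.1).comp
        (ContinuousLinearMap.fst ℝ E (StrongDual ℝ E))) :=
    (hasMFDerivAt_tderiv (mdifferentiableAt_extChartAt_symm' hz)).comp z
      hasFDerivAt_fst.hasMFDerivAt
  have h2 := h1.prodMk (hasFDerivAt_snd (𝕜 := ℝ) (p := z)).hasMFDerivAt
  have h3 : tderiv 𝓘(ℝ, E × StrongDual ℝ E) (modelProd E) (extChartAt (modelProd E) p).symm z =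
      ((tderiv 𝓘(ℝ, E) 𝓘(ℝ, E) (extChartAt 𝓘(ℝ, E) p.1).symm z.1).comp
        (ContinuousLinearMap.fst ℝ E (StrongDual ℝ E))).prod
        (ContinuousLinearMap.snd ℝ E (StrongDual ℝ E)) := HasMFDerivAt.tderiv_eq h2
  refine (inChart_apply' trivLiouville p z v).trans ?_
  exact congrArg (fun A : E × StrongDual ℝ E →L[ℝ] E × StrongDual ℝ E ↦
    z.2 (leftMC E ((extChartAt 𝓘(ℝ, E) p.1).symm z.1) (A (v 0)).1)) h3

/-- In coordinates the form is (y, η) ↦ η ∘ `chartMC` y: differentiating η gives the two pairings,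
and differentiating `chartMC` gives the bracket term by the Maurer-Cartan equation. -/
theorem extDer_trivLiouville (p : G × StrongDual ℝ E) (X Y : E × StrongDual ℝ E) :
    (extDer (modelProd E) trivLiouville : G × StrongDual ℝ E → (E × StrongDual ℝ E) [⋀^Fin 2]→L[ℝ] ℝ)
      p ![X, Y] = X.2 (leftMC E p.1 Y.1) - Y.2 (leftMC E p.1 X.1)
        - p.2 (lieCLM E G (leftMC E p.1 X.1) (leftMC E p.1 Y.1)) := by
  set z₀ := extChartAt (modelProd E) p p with hz₀
  have hz1 : z₀.1 = extChartAt 𝓘(ℝ, E) p.1 p.1 := rfl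
  have hz2 : z₀.2 = p.2 := rfl
  have h1 : (extDer (modelProd E) trivLiouville :
      G × StrongDual ℝ E → (E × StrongDual ℝ E) [⋀^Fin 2]→L[ℝ] ℝ) p =
      (extDeriv (inChart (modelProd E) trivLiouville p) z₀).compContinuousLinearMap
        (tderiv (modelProd E) 𝓘(ℝ, E × StrongDual ℝ E) (extChartAt (modelProd E) p) p) :=
    extDer_eq_extDeriv trivLiouville p
  rw [h1, tderiv_extChartAt_self]
  change extDeriv (inChart (modelProd E) trivLiouville p) z₀ ![X, Y] = _
  rw [extDeriv_one_apply
    ((isSmoothForm_iff.1 isSmoothForm_trivLiouville p).differentiableAt (by simp))]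
  set D := fderiv ℝ (chartMC E p.1) (extChartAt 𝓘(ℝ, E) p.1 p.1) with hD
  have hd : ∀ X Y : E × StrongDual ℝ E, fderiv ℝ
      (fun z ↦ inChart (modelProd E) (trivLiouville (G := G)) p z ![Y]) z₀ X =
      p.2 (D X.1 Y.1) + X.2 (leftMC E p.1 Y.1) := by
    intro X Y
    have h2 : HasFDerivAt (fun z : E × StrongDual ℝ E ↦ chartMC E p.1 z.1 Y.1)
        ((D.flip Y.1).comp (ContinuousLinearMap.fst ℝ E (StrongDual ℝ E))) z₀ := by
      have h3 : HasFDerivAt (chartMC E p.1) D z₀.1 :=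
        ((contDiffAt_chartMC p.1).differentiableAt (by simp)).hasFDerivAt
      have h4 := (h3.comp z₀ hasFDerivAt_fst).clm_apply (hasFDerivAt_const Y.1 z₀)
      refine h4.congr_fderiv ?_
      ext v <;> simp
    have h3 := (hasFDerivAt_snd (𝕜 := ℝ) (p := z₀)).clm_apply h2
    have h4 : (fun z ↦ inChart (modelProd E) (trivLiouville (G := G)) p z ![Y]) =ᶠ[nhds z₀]
        fun z ↦ z.2 (chartMC E p.1 z.1 Y.1) := by
      filter_upwards [continuousAt_fst.preimage_mem_nhds
        ((isOpen_extChartAt_target (I := 𝓘(ℝ, E)) p.1).mem_nhds (mem_extChartAt_target p.1))] with z hz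
      exact inChart_trivLiouville p hz ![Y]
    rw [h4.fderiv_eq, h3.fderiv]
    change z₀.2 (D X.1 Y.1) + X.2 (chartMC E p.1 z₀.1 Y.1) = _
    rw [hz1, chartMC_self, hz2]
  rw [hd, hd]
  have h5 := congrArg p.2 (fderiv_chartMC_antisymm (E := E) p.1 X.1 Y.1)
  rw [map_sub, map_neg] at h5
  linarith

theorem omegaGamma_apply (lam : E [⋀^Fin 2]→L[ℝ] ℝ) (p : G × StrongDual ℝ E)
    (X Y : E × StrongDual ℝ E) :
    (omegaGamma lam : G × StrongDual ℝ E → (E × StrongDual ℝ E) [⋀^Fin 2]→L[ℝ] ℝ) p ![X, Y] =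
      X.2 (leftMC E p.1 Y.1) - Y.2 (leftMC E p.1 X.1)
        - p.2 (lieCLM E G (leftMC E p.1 X.1) (leftMC E p.1 Y.1))
        - altBilin lam (leftMC E p.1 X.1) (leftMC E p.1 Y.1) := by
  have h1 := extDer_trivLiouville p X Y
  have h2 : (pullback (modelProd E) 𝓘(ℝ, E) (fun p : G × StrongDual ℝ E ↦ p.1)
      (leftInvariantForm lam) : G × StrongDual ℝ E → (E × StrongDual ℝ E) [⋀^Fin 2]→L[ℝ] ℝ) p ![X, Y] =
      altBilin lam (leftMC E p.1 X.1) (leftMC E p.1 Y.1) := by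
    have h3 : tderiv (modelProd E) 𝓘(ℝ, E) (fun p : G × StrongDual ℝ E ↦ p.1) p =
      ContinuousLinearMap.fst ℝ E (StrongDual ℝ E) := mfderiv_fst
    refine (congrArg (fun A : E × StrongDual ℝ E →L[ℝ] E ↦
      lam (fun i ↦ leftMC E p.1 (A (![X, Y] i)))) h3).trans ?_
    rw [altBilin_apply]
    congr 1
    ext i
    fin_cases i <;> rfl
  rw [omegaGamma_eq, ← h1, ← h2]
  rfl

theorem isSymplecticForm_omegaGamma {lam : E [⋀^Fin 2]→L[ℝ] ℝ} (h : IsLieTwoCocycle (G := G) lam) :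
    IsSymplecticForm (modelProd E) (omegaGamma (G := G) lam) where
  smooth := isSmoothForm_omegaGamma lam
  closed := extDer_omegaGamma h
  nondegenerate := by
    intro p X hX
    change E × StrongDual ℝ E at X
    have hX' : ∀ Y : E × StrongDual ℝ E, X.2 (leftMC E p.1 Y.1) - Y.2 (leftMC E p.1 X.1)
        - p.2 (lieCLM E G (leftMC E p.1 X.1) (leftMC E p.1 Y.1))
        - altBilin lam (leftMC E p.1 X.1) (leftMC E p.1 Y.1) = 0 := fun Y ↦
      (omegaGamma_apply lam p X Y).symm.trans (hX Y)
    -- Testing against vertical vectors (0, ξ) kills the group component of X; testing afterwards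
    -- against left-invariant vectors kills the dual component.
    have h1 : leftMC E p.1 X.1 = 0 := by
      refine SeparatingDual.eq_zero_of_forall_dual_eq_zero (R := ℝ) fun ξ ↦ ?_
      have := hX' (0, ξ)
      simpa using this
    have h2 : X.2 = 0 := by
      ext b
      have := hX' (leftField b p.1, 0)
      simpa [h1, leftMC_leftField] using this
    have h3 : X.1 = 0 := by
      rw [← leftField_leftMC X.1 p.1, h1, leftField, map_zero]
    exact Prod.ext h3 h2

end Cotangent

/-! ### The affine action groupoid and multiplicativity -/

section Groupoid

variable {E : Type*} [NormedAddCommGroup E] [NormedSpace ℝ E] [FiniteDimensional ℝ E]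
  {G : Type*} [TopologicalSpace G] [ChartedSpace E G] [Group G] [LieGroup 𝓘(ℝ, E) ∞ G]

/-- The target map of the affine coadjoint action groupoid. -/
def affineTgt (χ : CoadjointCocycle E G) (p : G × StrongDual ℝ E) : StrongDual ℝ E :=
  p.2.comp (adE E p.1⁻¹) - χ.toFun p.1

theorem affineTgt_apply (χ : CoadjointCocycle E G) (p : G × StrongDual ℝ E) (w : E) :
    affineTgt χ p w = p.2 (adE E p.1⁻¹ w) - χ.toFun p.1 w := rfl

theorem contMDiff_affineTgt (χ : CoadjointCocycle E G) :
    ContMDiff (modelProd E) 𝓘(ℝ, StrongDual ℝ E) ∞ (affineTgt χ) := fun p ↦ by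
  have h1 : ContMDiff (modelProd E) 𝓘(ℝ, E →L[ℝ] E) ∞
      (fun p : G × StrongDual ℝ E ↦ adE E p.1⁻¹) :=
    ContMDiff.comp (g := fun g : G ↦ adE E g⁻¹) contMDiff_adE_inv contMDiff_fst
  have h2 : ContMDiff (modelProd E) 𝓘(ℝ, StrongDual ℝ E) ∞
      (fun p : G × StrongDual ℝ E ↦ χ.toFun p.1) := χ.smooth.comp contMDiff_fst
  exact (contMDiff_snd.clm_comp h1).contMDiffAt.sub h2.contMDiffAt

/-- Evaluated at w, the target is ⟨η, Ad_{g⁻¹} w⟩ - ⟨χ(g), w⟩, and the derivatives of both terms in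
g are known. -/
theorem tderiv_affineTgt {χ : CoadjointCocycle E G} {lam : E [⋀^Fin 2]→L[ℝ] ℝ}
    (h : χ.Integrates lam) (p X) (w : E) :
    tderiv (modelProd E) 𝓘(ℝ, StrongDual ℝ E) (affineTgt χ) p X w =
      X.2 (adE E p.1⁻¹ w) - p.2 (lieCLM E G (leftMC E p.1 X.1) (adE E p.1⁻¹ w)) -
        altBilin lam (leftMC E p.1 X.1) (adE E p.1⁻¹ w) := by
  have h1 : HasMFDerivAt (modelProd E) 𝓘(ℝ, ℝ) (fun p ↦ affineTgt χ p w) p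
      ((ContinuousLinearMap.apply ℝ ℝ w).comp
        (tderiv (modelProd E) 𝓘(ℝ, StrongDual ℝ E) (affineTgt χ) p)) :=
    hasMFDerivAt_clm_comp (ContinuousLinearMap.apply ℝ ℝ w)
      (hasMFDerivAt_tderiv ((contMDiff_affineTgt χ).mdifferentiable (by simp) p))
  have hfst : HasMFDerivAt (modelProd E) 𝓘(ℝ, E) (fun p : G × StrongDual ℝ E ↦ p.1) p
      (ContinuousLinearMap.fst ℝ E (StrongDual ℝ E)) := hasMFDerivAt_fst p
  have hsnd : HasMFDerivAt (modelProd E) 𝓘(ℝ, StrongDual ℝ E) (fun p : G × StrongDual ℝ E ↦ p.2) p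
      (ContinuousLinearMap.snd ℝ E (StrongDual ℝ E)) := hasMFDerivAt_snd p
  have h2 := hasMFDerivAt_bilinear (ContinuousLinearMap.id ℝ (E →L[ℝ] ℝ)) hsnd
    (HasMFDerivAt.comp p (hasMFDerivAt_adE_inv w p.1) hfst)
  have h3 := h2.sub (HasMFDerivAt.comp p (h.hasMFDerivAt p.1 w) hfst)
  refine (congrArg (fun A : E × StrongDual ℝ E →L[ℝ] ℝ ↦ A X) ((HasMFDerivAt.tderiv_eq h1).symm.trans
    (HasMFDerivAt.tderiv_eq h3))).trans ?_
  change p.2 (- lieCLM E G (leftMC E p.1 X.1) (adE E p.1⁻¹ w)) + X.2 (adE E p.1⁻¹ w) -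
    altBilin lam (leftMC E p.1 X.1) (adE E p.1⁻¹ w) = _
  rw [map_neg]
  ring

theorem isSmoothSubmersion_affineTgt {χ : CoadjointCocycle E G} {lam : E [⋀^Fin 2]→L[ℝ] ℝ}
    (h : χ.Integrates lam) :
    IsSmoothSubmersion (modelProd E) 𝓘(ℝ, StrongDual ℝ E) (affineTgt χ) where
  smooth := contMDiff_affineTgt χ
  surjective_mfderiv p ζ := by
    change StrongDual ℝ E at ζ
    -- For fixed g the action is affine with invertible linear part, so the fibre direction alone is
    -- enough.
    refine ⟨((0, ζ.comp (adE E p.1)) : E × StrongDual ℝ E), ?_⟩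
    change tderiv (modelProd E) 𝓘(ℝ, StrongDual ℝ E) (affineTgt χ) p (0, ζ.comp (adE E p.1)) = ζ
    ext w
    rw [tderiv_affineTgt h]
    change ζ (adE E p.1 (adE E p.1⁻¹ w)) - _ - _ = _
    rw [adE_adE_inv]
    simp

variable (E) in
/-- The model of the manifold of composable pairs. -/
abbrev modelPairs : ModelWithCorners ℝ (E × E × StrongDual ℝ E)
    (ModelProd E (ModelProd E (StrongDual ℝ E))) := 𝓘(ℝ, E).prod (modelProd E)

theorem hasMFDerivAt_composableSnd (c : G × G × StrongDual ℝ E) :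
    HasMFDerivAt (modelPairs E) (modelProd E) (composableSnd (E := E) (G := G)) c
      (ContinuousLinearMap.snd ℝ E (E × StrongDual ℝ E)) := hasMFDerivAt_snd c

theorem hasMFDerivAt_composableFst (χ : CoadjointCocycle E G) (c : G × G × StrongDual ℝ E) :
    HasMFDerivAt (modelPairs E) (modelProd E) (composableFst χ) c
      ((ContinuousLinearMap.fst ℝ E (E × StrongDual ℝ E)).prod
        ((tderiv (modelProd E) 𝓘(ℝ, StrongDual ℝ E) (affineTgt χ) c.2).comp
          (ContinuousLinearMap.snd ℝ E (E × StrongDual ℝ E)))) :=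
  (hasMFDerivAt_fst c).prodMk (HasMFDerivAt.comp c
    (hasMFDerivAt_tderiv ((contMDiff_affineTgt χ).mdifferentiable (by simp) c.2))
    (hasMFDerivAt_composableSnd c))

theorem contMDiff_composableSnd :
    ContMDiff (modelPairs E) (modelProd E) ∞ (composableSnd (E := E) (G := G)) := contMDiff_snd

theorem contMDiff_composableFst (χ : CoadjointCocycle E G) :
    ContMDiff (modelPairs E) (modelProd E) ∞ (composableFst χ) :=
  contMDiff_fst.prodMk ((contMDiff_affineTgt χ).comp contMDiff_composableSnd)

theorem isComposablePairs (χ : CoadjointCocycle E G) :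
    IsComposablePairs (modelProd E) (modelPairs E) (actionGroupoid (affineAction χ))
      (composableFst χ) composableSnd where
  smooth_fst := contMDiff_composableFst χ
  smooth_snd := contMDiff_composableSnd
  immersion c v h1 h2 := by
    change E × E × StrongDual ℝ E at v
    have h3 : v.2 = 0 := (congrArg (fun A : E × E × StrongDual ℝ E →L[ℝ] E × StrongDual ℝ E ↦ A v)
      (HasMFDerivAt.tderiv_eq (hasMFDerivAt_composableSnd c))).symm.trans h2
    have h4 := (congrArg (fun A : E × E × StrongDual ℝ E →L[ℝ] E × StrongDual ℝ E ↦ A v)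
      (HasMFDerivAt.tderiv_eq (hasMFDerivAt_composableFst χ c))).symm.trans h1
    exact Prod.ext (congrArg (fun z : E × StrongDual ℝ E ↦ z.1) h4) h3
  embedding := by
    -- The pairs form a graph: g from the first arrow and the whole second arrow determine the pair,
    -- which gives a continuous left inverse.
    refine Topology.IsEmbedding.of_leftInverse (f := fun q : (G × StrongDual ℝ E) × G × StrongDual ℝ E ↦
      (q.1.1, q.2)) (fun c ↦ rfl) (by fun_prop) ?_
    exact (contMDiff_composableFst χ).continuous.prodMk contMDiff_composableSnd.continuous
  range_eq := by
    ext q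
    constructor
    · rintro ⟨c, rfl⟩
      rfl
    · intro hq
      exact ⟨(q.1.1, q.2), Prod.ext (Prod.ext rfl hq.symm) rfl⟩

/-- The multiplication of composable pairs in the action groupoid. -/
def composableMul (c : G × G × StrongDual ℝ E) : G × StrongDual ℝ E := (c.1 * c.2.1, c.2.2)

theorem contMDiff_composableMul :
    ContMDiff (modelPairs E) (modelProd E) ∞ (composableMul (E := E) (G := G)) :=
  (contMDiff_fst.mul (contMDiff_fst.comp contMDiff_composableSnd)).prodMk
    (contMDiff_snd.comp contMDiff_composableSnd)

theorem tderiv_composableMul (c : G × G × StrongDual ℝ E) (X : E × E × StrongDual ℝ E) :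
    leftMC E (c.1 * c.2.1)
      (tderiv (modelPairs E) (modelProd E) (composableMul (E := E) (G := G)) c X).1 =
        adE E c.2.1⁻¹ (leftMC E c.1 X.1) + leftMC E c.2.1 X.2.1 ∧
      (tderiv (modelPairs E) (modelProd E) (composableMul (E := E) (G := G)) c X).2 = X.2.2 := by
  have hfst : HasMFDerivAt (modelPairs E) 𝓘(ℝ, E) (fun c : G × G × StrongDual ℝ E ↦ c.1) c
    (ContinuousLinearMap.fst ℝ E (E × StrongDual ℝ E)) := hasMFDerivAt_fst c
  have h21 : HasMFDerivAt (modelPairs E) 𝓘(ℝ, E) (fun c : G × G × StrongDual ℝ E ↦ c.2.1) c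
    ((ContinuousLinearMap.fst ℝ E (StrongDual ℝ E)).comp
      (ContinuousLinearMap.snd ℝ E (E × StrongDual ℝ E))) :=
    HasMFDerivAt.comp c (hasMFDerivAt_fst c.2) (hasMFDerivAt_composableSnd c)
  have h22 : HasMFDerivAt (modelPairs E) 𝓘(ℝ, StrongDual ℝ E)
    (fun c : G × G × StrongDual ℝ E ↦ c.2.2) c
    ((ContinuousLinearMap.snd ℝ E (StrongDual ℝ E)).comp
      (ContinuousLinearMap.snd ℝ E (E × StrongDual ℝ E))) :=
    HasMFDerivAt.comp c (hasMFDerivAt_snd c.2) (hasMFDerivAt_composableSnd c)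
  have hm : MDifferentiableAt (𝓘(ℝ, E).prod 𝓘(ℝ, E)) 𝓘(ℝ, E) (fun p : G × G ↦ p.1 * p.2)
      (c.1, c.2.1) := (contMDiff_mul 𝓘(ℝ, E) ∞).mdifferentiable (by simp) _
  have h := (HasMFDerivAt.comp (f := fun c : G × G × StrongDual ℝ E ↦ (c.1, c.2.1)) c
    (hasMFDerivAt_tderiv hm) (hfst.prodMk h21)).prodMk h22
  have h' := congrArg (fun A : E × E × StrongDual ℝ E →L[ℝ] E × StrongDual ℝ E ↦ A X)
    (HasMFDerivAt.tderiv_eq h)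
  exact ⟨(congrArg (fun z : E × StrongDual ℝ E ↦ leftMC E (c.1 * c.2.1) z.1) h').trans
    (leftMC_tderiv_mul c.1 c.2.1 X.1 X.2.1), (congrArg (fun z : E × StrongDual ℝ E ↦ z.2) h').trans rfl⟩

theorem isLieGroupoid {χ : CoadjointCocycle E G} {lam : E [⋀^Fin 2]→L[ℝ] ℝ}
    (h : χ.Integrates lam) :
    IsLieGroupoid (modelProd E) 𝓘(ℝ, StrongDual ℝ E) (modelPairs E)
      (actionGroupoid (affineAction χ)) (composableFst χ) composableSnd where
  isManifold_arrows := inferInstance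
  isManifold_objects := inferInstance
  isManifold_pairs := inferInstance
  pairs := isComposablePairs χ
  submersion_src :=
    { smooth := contMDiff_snd
      surjective_mfderiv := fun p ζ ↦ ⟨((0, ζ) : E × StrongDual ℝ E),
        congrArg (fun A : E × StrongDual ℝ E →L[ℝ] StrongDual ℝ E ↦ A (0, ζ))
          (HasMFDerivAt.tderiv_eq (f' := ContinuousLinearMap.snd ℝ E (StrongDual ℝ E))
            (hasMFDerivAt_snd (I := 𝓘(ℝ, E)) (I' := 𝓘(ℝ, StrongDual ℝ E)) p))⟩ }
  submersion_tgt := isSmoothSubmersion_affineTgt h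
  smooth_unit := contMDiff_const.prodMk contMDiff_id
  smooth_inv := contMDiff_fst.inv.prodMk (contMDiff_affineTgt χ)
  smooth_mul := contMDiff_composableMul

/-- At (g, k, η) let a, b be the left-trivialised g-components of the two vectors. The product
shifts their k-components by Ad_{k⁻¹} a and Ad_{k⁻¹} b; the mixed terms so created are those coming
from the derivative of the target in the first arrow. The remaining terms in a and b agree because
χ(k) in the target accounts for the difference of λ(a, b) and λ(Ad_{k⁻¹} a, Ad_{k⁻¹} b). -/
theorem multiplicative_omegaGamma [PreconnectedSpace G] {χ : CoadjointCocycle E G}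
    {lam : E [⋀^Fin 2]→L[ℝ] ℝ} (h : χ.Integrates lam) (hlam : IsLieTwoCocycle (G := G) lam) :
    pullback (modelPairs E) (modelProd E) (composableFst χ) (omegaGamma lam) +
      pullback (modelPairs E) (modelProd E) composableSnd (omegaGamma lam) -
      pullback (modelPairs E) (modelProd E) composableMul (omegaGamma lam) = 0 := by
  funext c
  refine ContinuousAlternatingMap.ext fun v ↦ ?_
  change Fin 2 → E × E × StrongDual ℝ E at v
  have hp : ∀ (f : G × G × StrongDual ℝ E → G × StrongDual ℝ E),
      (pullback (modelPairs E) (modelProd E) f (omegaGamma lam) :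
        G × G × StrongDual ℝ E → (E × E × StrongDual ℝ E) [⋀^Fin 2]→L[ℝ] ℝ) c v =
      (omegaGamma lam : G × StrongDual ℝ E → (E × StrongDual ℝ E) [⋀^Fin 2]→L[ℝ] ℝ) (f c)
        ![tderiv (modelPairs E) (modelProd E) f c (v 0),
          tderiv (modelPairs E) (modelProd E) f c (v 1)] := by
    intro f
    refine congrArg ((omegaGamma lam :
      G × StrongDual ℝ E → (E × StrongDual ℝ E) [⋀^Fin 2]→L[ℝ] ℝ) (f c)) ?_
    ext i : 1
    fin_cases i <;> rfl
  have h1 := hp (composableFst χ)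
  have h2 := hp composableSnd
  have h3 := hp composableMul
  rw [HasMFDerivAt.tderiv_eq (hasMFDerivAt_composableFst χ c), omegaGamma_apply] at h1
  rw [HasMFDerivAt.tderiv_eq (hasMFDerivAt_composableSnd c), omegaGamma_apply] at h2
  rw [omegaGamma_apply] at h3
  obtain ⟨g, k, η⟩ := c
  obtain ⟨m0, m0'⟩ := tderiv_composableMul (E := E) (g, k, η) (v 0)
  obtain ⟨m1, m1'⟩ := tderiv_composableMul (E := E) (g, k, η) (v 1)
  have e0 := tderiv_affineTgt h (k, η) (v 0).2 (leftMC E g (v 1).1)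
  have e1 := tderiv_affineTgt h (k, η) (v 1).2 (leftMC E g (v 0).1)
  have e2 := affineTgt_apply χ (k, η) (lieCLM E G (leftMC E g (v 0).1) (leftMC E g (v 1).1))
  have e3 := h.altBilin_adE hlam k (leftMC E g (v 0).1) (leftMC E g (v 1).1)
  have h1' := h1.trans (show _ = tderiv (modelProd E) 𝓘(ℝ, StrongDual ℝ E) (affineTgt χ) (k, η)
      (v 0).2 (leftMC E g (v 1).1) - tderiv (modelProd E) 𝓘(ℝ, StrongDual ℝ E) (affineTgt χ) (k, η)
      (v 1).2 (leftMC E g (v 0).1) -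
      affineTgt χ (k, η) (lieCLM E G (leftMC E g (v 0).1) (leftMC E g (v 1).1)) -
      altBilin lam (leftMC E g (v 0).1) (leftMC E g (v 1).1) from rfl)
  have h2' := h2.trans (show _ = (v 0).2.2 (leftMC E k (v 1).2.1) - (v 1).2.2 (leftMC E k (v 0).2.1) -
    η (lieCLM E G (leftMC E k (v 0).2.1) (leftMC E k (v 1).2.1)) -
      altBilin lam (leftMC E k (v 0).2.1) (leftMC E k (v 1).2.1) from rfl)
  simp only [composableMul] at h3 m0 m1 m0' m1'
  rw [m0, m1, m0', m1'] at h3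
  rw [e0, e1, e2, adE_lieCLM] at h1'
  dsimp only at h1' h2' h3 e3
  simp only [map_add, _root_.add_apply] at h3
  -- Mixed terms occur with their arguments in both orders; skew-symmetry brings them to one order.
  have s1 := congrArg η (lieCLM_skew (G := G) (leftMC E k (v 1).2.1) (adE E k⁻¹ (leftMC E g (v 0).1)))
  have s2 := altBilin_skew lam (leftMC E k (v 1).2.1) (adE E k⁻¹ (leftMC E g (v 0).1))
  rw [map_neg] at s1
  refine (congrArg₂ (fun a b : ℝ ↦ a - b) (congrArg₂ (fun a b : ℝ ↦ a + b) h1' h2') h3).trans ?_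
  change _ = (0 : ℝ)
  linarith

theorem omegaGamma_leftField (lam : E [⋀^Fin 2]→L[ℝ] ℝ) (g : G) (η : StrongDual ℝ E) (v₁ v₂ : E)
    (ξ₁ ξ₂ : StrongDual ℝ E) :
    (omegaGamma lam : G × StrongDual ℝ E → (E × StrongDual ℝ E) [⋀^Fin 2]→L[ℝ] ℝ) (g, η)
      ![(leftField v₁ g, ξ₁), (leftField v₂ g, ξ₂)] =
      ξ₁ v₂ - ξ₂ v₁ - η (lieCLM E G v₁ v₂) - altBilin lam v₁ v₂ := by
  rw [omegaGamma_apply, leftMC_leftField, leftMC_leftField]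

end Groupoid

/-! ### The affine Poisson structure and the symplectic realization -/

section Poisson

variable {E : Type*} [NormedAddCommGroup E] [NormedSpace ℝ E] [FiniteDimensional ℝ E]
  {G : Type*} [TopologicalSpace G] [ChartedSpace E G] [Group G] [LieGroup 𝓘(ℝ, E) ∞ G]

theorem hasFDerivAt_clm_fderiv {V W : Type*} [NormedAddCommGroup V] [NormedSpace ℝ V]
    [NormedAddCommGroup W] [NormedSpace ℝ W] (A : (V →L[ℝ] ℝ) →L[ℝ] W) {g : V → ℝ}
    (hg : ContDiff ℝ ∞ g) (x : V) : HasFDerivAt (fun x ↦ A (fderiv ℝ g x))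
      (A.comp (fderiv ℝ (fderiv ℝ g) x)) x := by
  have h1 : HasFDerivAt (fderiv ℝ g) (fderiv ℝ (fderiv ℝ g) x) x :=
    (((hg.fderiv_right (m := ∞) (by simp)).differentiable (by simp)) x).hasFDerivAt
  exact A.hasFDerivAt.comp x h1

variable (E) in
/-- The inverse of the identification of `E` with its bidual. -/
def ofBidual : StrongDual ℝ (StrongDual ℝ E) →L[ℝ] E :=
  (bidual E).symm.toContinuousLinearEquiv

theorem apply_ofBidual (α : StrongDual ℝ (StrongDual ℝ E)) (ζ : StrongDual ℝ E) :
    ζ (ofBidual E α) = α ζ :=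
  congrArg (fun β : StrongDual ℝ (StrongDual ℝ E) ↦ β ζ) ((bidual E).apply_symm_apply α)

variable (G) in
/-- The covector `λ(u, ·) + ⟨x, [u, ·]⟩`. -/
def affineHam (lam : E [⋀^Fin 2]→L[ℝ] ℝ) (x : StrongDual ℝ E) (u : E) : StrongDual ℝ E :=
  x.comp (lieCLM E G u) + altBilin lam u

theorem affineHam_apply (lam : E [⋀^Fin 2]→L[ℝ] ℝ) (x : StrongDual ℝ E) (u v : E) :
    affineHam G lam x u v = x (lieCLM E G u v) + altBilin lam u v := rfl

theorem affineHam_skew (lam : E [⋀^Fin 2]→L[ℝ] ℝ) (x : StrongDual ℝ E) (u v : E) :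
    affineHam G lam x u v = - affineHam G lam x v u := by
  rw [affineHam_apply, affineHam_apply, lieCLM_skew, altBilin_skew, map_neg]
  ring

theorem affinePoisson_eq (lam : E [⋀^Fin 2]→L[ℝ] ℝ) (x : StrongDual ℝ E)
    (α β : StrongDual ℝ (StrongDual ℝ E)) : affinePoisson (G := G) lam x α β =
      affineHam G lam x (ofBidual E α) (ofBidual E β) := rfl

theorem bracket_affinePoisson (lam : E [⋀^Fin 2]→L[ℝ] ℝ) (f g : StrongDual ℝ E → ℝ)
    (x : StrongDual ℝ E) : bracket 𝓘(ℝ, StrongDual ℝ E) (affinePoisson (G := G) lam) f g x =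
      affineHam G lam x (ofBidual E (fderiv ℝ f x)) (ofBidual E (fderiv ℝ g x)) := by
  have h : ∀ f : StrongDual ℝ E → ℝ,
      (differential 𝓘(ℝ, StrongDual ℝ E) f x : StrongDual ℝ (StrongDual ℝ E)) = fderiv ℝ f x :=
    fun f ↦ tderiv_eq_fderiv
  refine (affinePoisson_eq lam x _ _).trans ?_
  rw [h, h]

/-- Separates the part that would be there for linear functions from the terms with second
derivatives, the latter written on Hamiltonian covectors so that their symmetry can be used in the
Jacobi sum. -/
theorem bracket_affinePoisson_bracket (lam : E [⋀^Fin 2]→L[ℝ] ℝ) {f g h : StrongDual ℝ E → ℝ}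
    (hg : ContDiff ℝ ∞ g) (hh : ContDiff ℝ ∞ h) (x : StrongDual ℝ E) :
    bracket 𝓘(ℝ, StrongDual ℝ E) (affinePoisson (G := G) lam) f
      (bracket 𝓘(ℝ, StrongDual ℝ E) (affinePoisson (G := G) lam) g h) x =
    affineHam G lam x (ofBidual E (fderiv ℝ f x))
        (lieCLM E G (ofBidual E (fderiv ℝ g x)) (ofBidual E (fderiv ℝ h x)))
      - fderiv ℝ (fderiv ℝ g) x (affineHam G lam x (ofBidual E (fderiv ℝ f x)))
          (affineHam G lam x (ofBidual E (fderiv ℝ h x)))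
      + fderiv ℝ (fderiv ℝ h) x (affineHam G lam x (ofBidual E (fderiv ℝ f x)))
          (affineHam G lam x (ofBidual E (fderiv ℝ g x))) := by
  have hd : ∀ {g : StrongDual ℝ E → ℝ}, ContDiff ℝ ∞ g → HasFDerivAt (fun x ↦ ofBidual E (fderiv ℝ g x))
      ((ofBidual E).comp (fderiv ℝ (fderiv ℝ g) x)) x := fun hg ↦
    hasFDerivAt_clm_fderiv (ofBidual E) hg x
  have hbr : bracket 𝓘(ℝ, StrongDual ℝ E) (affinePoisson (G := G) lam) g h = fun x ↦
      x (lieCLM E G (ofBidual E (fderiv ℝ g x)) (ofBidual E (fderiv ℝ h x))) +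
        altBilin lam (ofBidual E (fderiv ℝ g x)) (ofBidual E (fderiv ℝ h x)) :=
    funext fun x ↦ bracket_affinePoisson lam g h x
  have h1 := ((hasFDerivAt_id (𝕜 := ℝ) x).clm_apply (hasMFDerivAt_bilinear (lieCLM E G)
    (hd hg).hasMFDerivAt (hd hh).hasMFDerivAt).hasFDerivAt).add
    (hasMFDerivAt_bilinear (altBilin lam) (hd hg).hasMFDerivAt (hd hh).hasMFDerivAt).hasFDerivAt
  rw [bracket_affinePoisson, apply_ofBidual, hbr]
  refine (congrArg (fun A : StrongDual ℝ E →L[ℝ] ℝ ↦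
    A (affineHam G lam x (ofBidual E (fderiv ℝ f x)))) h1.fderiv).trans ?_
  set ζ := affineHam G lam x (ofBidual E (fderiv ℝ f x)) with hζ
  set u := ofBidual E (fderiv ℝ g x) with hu
  set v := ofBidual E (fderiv ℝ h x) with hv
  change (x (lieCLM E G u (ofBidual E (fderiv ℝ (fderiv ℝ h) x ζ)) +
    lieCLM E G (ofBidual E (fderiv ℝ (fderiv ℝ g) x ζ)) v) + ζ (lieCLM E G u v)) +
    (altBilin lam u (ofBidual E (fderiv ℝ (fderiv ℝ h) x ζ)) +
      altBilin lam (ofBidual E (fderiv ℝ (fderiv ℝ g) x ζ)) v) = _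
  rw [← apply_ofBidual, ← apply_ofBidual, affineHam_skew lam x v, map_add]
  simp only [affineHam_apply]
  ring

theorem contMDiff_dual_iff {f : StrongDual ℝ E → ℝ} :
    ContMDiff 𝓘(ℝ, StrongDual ℝ E) 𝓘(ℝ, ℝ) ∞ f ↔ ContDiff ℝ ∞ f := contMDiff_iff_contDiff

/-- In the cyclic sum each Hessian occurs twice with opposite signs and exchanged arguments, so
Hessians cancel. What is left is ⟨x, ·⟩ of the Jacobi identity of 𝔤 plus the cocycle identity of λ.
-/
theorem isPoissonStructure_affinePoisson {lam : E [⋀^Fin 2]→L[ℝ] ℝ}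
    (hlam : IsLieTwoCocycle (G := G) lam) :
    IsPoissonStructure 𝓘(ℝ, StrongDual ℝ E) (affinePoisson (G := G) lam) where
  add_left x α α' β := by
    change StrongDual ℝ (StrongDual ℝ E) at α α' β
    have : affineHam G lam x (ofBidual E (α + α')) (ofBidual E β) =
      affineHam G lam x (ofBidual E α) (ofBidual E β) +
        affineHam G lam x (ofBidual E α') (ofBidual E β) := by
      simp only [affineHam_apply, map_add, _root_.add_apply]
      ring
    exact this
  smul_left x c α β := by
    change StrongDual ℝ (StrongDual ℝ E) at α β
    have : affineHam G lam x (ofBidual E (c • α)) (ofBidual E β) =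
      c * affineHam G lam x (ofBidual E α) (ofBidual E β) := by
      simp only [affineHam_apply, map_smul, _root_.smul_apply, smul_eq_mul]
      ring
    exact this
  skew x α β := affineHam_skew lam x _ _
  smooth f g hf hg := by
    rw [contMDiff_dual_iff] at hf hg ⊢
    have hbr : bracket 𝓘(ℝ, StrongDual ℝ E) (affinePoisson (G := G) lam) f g = fun x ↦
        x (lieCLM E G (ofBidual E (fderiv ℝ f x)) (ofBidual E (fderiv ℝ g x))) +
        altBilin lam (ofBidual E (fderiv ℝ f x)) (ofBidual E (fderiv ℝ g x)) :=
      funext fun x ↦ bracket_affinePoisson lam f g x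
    have hd : ∀ {g : StrongDual ℝ E → ℝ}, ContDiff ℝ ∞ g →
        ContDiff ℝ ∞ (fun x ↦ ofBidual E (fderiv ℝ g x)) := fun {g} hg ↦ by
      have h1 : ContDiff ℝ ∞ (fderiv ℝ g) := hg.fderiv_right (by simp)
      exact (ofBidual E).contDiff.comp h1
    rw [hbr]
    exact (contDiff_id.clm_apply ((contDiff_const.clm_apply (hd hf)).clm_apply (hd hg))).add
      ((contDiff_const.clm_apply (hd hf)).clm_apply (hd hg))
  jacobi f g h hf hg hh x := by
    rw [contMDiff_dual_iff] at hf hg hh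
    have hs : ∀ {f : StrongDual ℝ E → ℝ}, ContDiff ℝ ∞ f → ∀ a b,
        fderiv ℝ (fderiv ℝ f) x a b = fderiv ℝ (fderiv ℝ f) x b a := fun hf a b ↦
      (hf.contDiffAt.isSymmSndFDerivAt minSmoothness_two_le_infty) a b
    rw [bracket_affinePoisson_bracket lam hg hh, bracket_affinePoisson_bracket lam hh hf,
      bracket_affinePoisson_bracket lam hf hg, hs hf (affineHam G lam x (ofBidual E (fderiv ℝ g x))),
      hs hg (affineHam G lam x (ofBidual E (fderiv ℝ f x))),
      hs hh (affineHam G lam x (ofBidual E (fderiv ℝ f x)))]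
    have h1 := congrArg x (lieCLM_jacobi (G := G) (ofBidual E (fderiv ℝ f x))
      (ofBidual E (fderiv ℝ g x)) (ofBidual E (fderiv ℝ h x)))
    have h2 := hlam.altBilin_add (ofBidual E (fderiv ℝ f x))
      (ofBidual E (fderiv ℝ g x)) (ofBidual E (fderiv ℝ h x))
    simp only [map_add, map_zero] at h1
    simp only [affineHam_apply _ _ _ (lieCLM E G _ _)]
    linarith

/-- The Hamiltonian vector of the pulled back covector α is exhibited explicitly; applying the
differential of the target to it gives π_λ, as Ad respects brackets and χ corrects λ. -/
theorem isSymplecticRealization_affineTgt [PreconnectedSpace G] {χ : CoadjointCocycle E G}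
    {lam : E [⋀^Fin 2]→L[ℝ] ℝ} (h : χ.Integrates lam) (hlam : IsLieTwoCocycle (G := G) lam) :
    IsSymplecticRealization (modelProd E) 𝓘(ℝ, StrongDual ℝ E) (omegaGamma lam)
      (affinePoisson (G := G) lam) (affineTgt χ) where
  symplectic := isSymplecticForm_omegaGamma hlam
  submersion := isSmoothSubmersion_affineTgt h
  surjective η := ⟨(1, η), (actionGroupoid (affineAction χ)).tgt_unit η⟩
  poisson p α β := by
    change StrongDual ℝ (StrongDual ℝ E) at α β
    set T := tderiv (modelProd E) 𝓘(ℝ, StrongDual ℝ E) (affineTgt χ) p with hT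
    let σ : (E × StrongDual ℝ E) [⋀^Fin 2]→L[ℝ] ℝ :=
      (omegaGamma lam : G × StrongDual ℝ E → (E × StrongDual ℝ E) [⋀^Fin 2]→L[ℝ] ℝ) p
    -- Infinitesimally this is the right-invariant motion generated by minus the element of 𝔤 given
    -- by α: left-trivialised, a right-invariant field acquires Ad_{g⁻¹}, and η stays fixed.
    let X : E × StrongDual ℝ E := (leftField (- adE E p.1⁻¹ (ofBidual E α)) p.1, 0)
    have hLX : leftMC E p.1 X.1 = - adE E p.1⁻¹ (ofBidual E α) := leftMC_leftField _ _
    have hX : ∀ Y : E × StrongDual ℝ E, σ ![X, Y] = α (T Y) := by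
      intro Y
      rw [← apply_ofBidual, hT, tderiv_affineTgt h]
      refine (omegaGamma_apply lam p X Y).trans ?_
      rw [hLX, lieCLM_skew, altBilin_skew]
      simp only [map_neg]
      change (0 : ℝ) - _ - _ - _ = _
      ring
    let S : E × StrongDual ℝ E := sharp (modelProd E) (omegaGamma lam) p (α.comp T)
    have hS : ∀ Y : E × StrongDual ℝ E, σ ![S, Y] = α (T Y) :=
      Classical.epsilon_spec (p := fun X : E × StrongDual ℝ E ↦
        ∀ Y : E × StrongDual ℝ E, σ ![X, Y] = α (T Y)) ⟨X, hX⟩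
    -- `sharp` is a choice, known to solve the defining equation because X does; nondegeneracy
    -- identifies the two.
    have hSX : S = X := by
      refine sub_eq_zero.1 ((isSymplecticForm_omegaGamma hlam).nondegenerate p (S - X) fun Y ↦ ?_)
      change E × StrongDual ℝ E at Y
      have h1 : altBilin σ (S - X) Y = 0 := by
        rw [map_sub, _root_.sub_apply, altBilin_apply, altBilin_apply, hS, hX, sub_self]
      exact h1
    have h2 : β (T S) = affineHam G lam (affineTgt χ p) (ofBidual E α) (ofBidual E β) := by
      rw [hSX, ← apply_ofBidual, hT, tderiv_affineTgt h, hLX, affineHam_apply, affineTgt_apply,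
        adE_lieCLM]
      have h3 := h.altBilin_adE hlam p.1 (ofBidual E α) (ofBidual E β)
      simp only [map_neg, _root_.neg_apply]
      change (0 : ℝ) - _ - _ = _
      linarith
    exact h2

end Poisson

end AffineCoadjoint

end

/-! ### The main theorem -/

open AffineCoadjoint
theorem theoremC {E : Type*} [NormedAddCommGroup E] [NormedSpace ℝ E] [FiniteDimensional ℝ E]
    {G : Type*} [TopologicalSpace G] [ChartedSpace E G] [Group G] [LieGroup 𝓘(ℝ, E) ∞ G]
    [SimplyConnectedSpace G]
    (lam : GroupLieAlgebra 𝓘(ℝ, E) G [⋀^Fin 2]→L[ℝ] ℝ) (hlam : IsLieTwoCocycle lam) :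
    (∃! χ : CoadjointCocycle E G, χ.Integrates lam) ∧
    (∀ (g : G) (η : StrongDual ℝ E) (v₁ v₂ : GroupLieAlgebra 𝓘(ℝ, E) G) (ξ₁ ξ₂ : StrongDual ℝ E),
      omegaGamma lam (g, η) ![leftTangent g η v₁ ξ₁, leftTangent g η v₂ ξ₂] =
        ξ₁ v₂ - ξ₂ v₁ - η (⁅v₁, v₂⁆ : GroupLieAlgebra 𝓘(ℝ, E) G) - lam ![v₁, v₂]) ∧
    ∀ χ : CoadjointCocycle E G, χ.Integrates lam →
      IsSymplecticGroupoid (modelProd E) 𝓘(ℝ, StrongDual ℝ E) (𝓘(ℝ, E).prod (modelProd E))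
        (actionGroupoid (affineAction χ))
        (composableFst χ) composableSnd (omegaGamma lam) ∧
      IntegratesPoisson (modelProd E) 𝓘(ℝ, StrongDual ℝ E)
        (actionGroupoid (affineAction χ)) (omegaGamma lam) (affinePoisson lam) := by
  refine ⟨?_, ?_, fun χ hχ ↦ ⟨?_, ?_⟩⟩
  · obtain ⟨χ, hχ⟩ := exists_integrates hlam
    exact ⟨χ, hχ, fun χ' hχ' ↦ hχ'.unique hχ⟩
  · exact fun g η v₁ v₂ ξ₁ ξ₂ ↦ omegaGamma_leftField (E := E) lam g η v₁ v₂ ξ₁ ξ₂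
  -- The multiplication on composable pairs unfolds to `composableMul`, and the groupoid target to
  -- `affineTgt`.
  · exact
      { isLieGroupoid hχ with
        symplectic := isSymplecticForm_omegaGamma hlam
        multiplicative := multiplicative_omegaGamma hχ hlam }
  · exact
      { poisson := isPoissonStructure_affinePoisson hlam
        realization := isSymplecticRealization_affineTgt hχ hlam }
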